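/- **LF.** LF expressions are kinds $K ::= \mathrm{Type} \mid \Pi x{:}A.K$, types $A ::= u \mid \Pi x{:}A.B \mid \lambda x{:}A.B \mid A\,M$ and objects $M ::= x \mid \lambda x{:}A.M \mid M\,N$, up to renaming of bound variables; contexts $\Gamma$ are finite sequences of assignments $u:K$ and $x:A$ to distinct variables. $P^\beta$ denotes the $\beta$-normal form of $P$. The assertions $\vdash\Gamma\ \mathrm{ctx}$, $\Gamma\vdash K\ \mathrm{kind}$, $\Gamma\vdash A:K$, $\Gamma\vdash M:A$ are derived by the usual rules of LF in which the kind or type to the right of the colon is always kept in $\beta$-normal form (e.g. from $\Gamma\vdash M:\Pi x{:}A.B$ and $\Gamma\vdash N:A$ infer $\Gamma\vdash M\,N:(B[N/x])^\beta$; from $\Gamma\vdash A:\mathrm{Type}$ and $\Gamma,x{:}A\vdash M:B$ infer $\Gamma\vdash\lambda x{:}A.M:\Pi x{:}A^\beta.B$). An expression is *canonical* with respect to $\Gamma$ if it is $\beta$-normal and every variable occurrence in it is applied to as many arguments as the normal form of the type or kind of that variable (given by $\Gamma$ or by a binder) has $\Pi$'s in its prefix. A well-formed context is canonical if every type or kind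 it assigns is canonical. A *base type* is a well-formed, fully applied type $u\,M_1\ldots M_n$. **The logic.** Simply typed $\lambda$-terms, considered up to $\beta\eta$-equality, are built over the atomic types $o$, $\mathit{lf\text{-}obj}$, $\mathit{lf\text{-}type}$, a signature $\Sigma$ of typed nonlogical constants containing $\mathit{hastype}:\mathit{lf\text{-}obj}\to\mathit{lf\text{-}type}\to o$, and the logical constants $\top$, $\supset$ and $\forall$ (at each type). A $\Sigma$-term is a closed term whose nonlogical constants are in $\Sigma$. Sequents $\Sigma;\mathcal P\vdash G$ of the $hohh$ logic, and focused sequents $\Sigma;\mathcal P\mathbin{;}[D]\vdash A$ with $A$ atomic, are derived by the rules: - $\Sigma;\mathcal P\vdash\top$; - $\Sigma;\mathcal P\vdash D\supset G$ if $\Sigma;\mathcal P\cup\{D\}\vdash G$; - $\Sigma;\mathcal P\vdash\forall x.G$ if $\Sigma\cup\{c\};\mathcal P\vdash G[c/x]$ with $c\notin\Sigma$; - $\Sigma;\mathcal P\vdash A$ if $D\in\mathcal P$ and $\Sigma;\mathcal P;[D]\vdash A$; - $\Sigma;\mathcal P;[A]\vdash A$; - $\Sigma;\mathcal P;[\forall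 x.D]\vdash A$ if $\Sigma;\mathcal P;[D[t/x]]\vdash A$ for some $\Sigma$-term $t$ of the type of $x$; - $\Sigma;\mathcal P;[G\supset D]\vdash A$ if $\Sigma;\mathcal P\vdash G$ and $\Sigma;\mathcal P;[D]\vdash A$. **The translation.** Put $\phi(A)=\mathit{lf\text{-}obj}$ for a base type $A$, $\phi(\mathrm{Type})=\mathit{lf\text{-}type}$, $\phi(\Pi x{:}A.P)=\phi(A)\to\phi(P)$. Canonical objects and base types are encoded by $\langle w\,M_1\ldots M_n\rangle=w\,\langle M_1\rangle\ldots\langle M_n\rangle$ ($w$ an object or type variable) and $\langle\lambda x{:}A.M\rangle=\lambda^{\phi(A)}x.\langle M\rangle$. Canonical types are encoded as predicates by $$[\![\Pi x{:}A.B]\!]=\lambda M.\,\forall x.\,([\![A]\!]\,x)\supset([\![B]\!]\,(M\,x)),\qquad [\![A]\!]=\lambda M.\,\mathit{hastype}\;M\;\langle A\rangle\ \text{ for a base type } A,$$ and $[\![M:A]\!]$ is $[\![A]\!]\,\langle M\rangle$. $[\![\Gamma]\!]$ consists of the formulas $[\![A]\!]\,x$ for the object assignments $x:A$ in $\Gamma$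 (kind assignments are dropped), and $\Sigma_\Gamma$ consists of $\mathit{hastype}$ and a constant $w$ of type $\phi(P)$ for each assignment $w:P$ in $\Gamma$. We write $[\![\Gamma]\!]\vdash G$ for $\Sigma_\Gamma;[\![\Gamma]\!]\vdash G$. **Theorem.** Let $\Gamma$ be a well-formed canonical LF context and let $A$ be a canonical LF type such that $\Gamma\vdash A:\mathrm{Type}$ has a derivation. 1. If $M$ is a canonical LF object and $\Gamma\vdash M:A$ has a derivation, then $[\![\Gamma]\!]\vdash[\![M:A]\!]$ has a derivation. 2. Conversely, if $M$ is any $\Sigma_\Gamma$-term of type $\phi(A)$ such that $[\![\Gamma]\!]\vdash[\![A]\!]\,M$ has a derivation, then there is a canonical LF object $M'$ such that $M=\langle M'\rangle$ (up to $\beta\eta$-equality) and $\Gamma\vdash M':A$ has a derivation. -/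

import Mathlib

/-!
Variables are de Bruijn indices throughout, so expressions differing only in the names of
bound variables are identified and every context assigns distinct variables.
-/

namespace LF

/-- The three syntactic categories of LF. -/
inductive Cat where
  | kind
  | fam
  | obj

/-- LF expressions: kinds `K ::= Type | Πx:A.K`, types (families)
`A ::= u | Πx:A.B | λx:A.B | A M`, objects `M ::= x | λx:A.M | M N`.
An index, of a type variable or of an object variable, counts all the declarations and
binders that lie between the occurrence and the declaration or binder it refers to. -/
inductive Exp : Cat → Type where
  | typ : Exp .kind
  | piK (A : Exp .fam) (K : Exp .kind) : Exp .kind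
  | fvar (u : ℕ) : Exp .fam
  | piF (A B : Exp .fam) : Exp .fam
  | lamF (A B : Exp .fam) : Exp .fam
  | appF (A : Exp .fam) (M : Exp .obj) : Exp .fam
  | var (x : ℕ) : Exp .obj
  | lam (A : Exp .fam) (M : Exp .obj) : Exp .obj
  | app (M N : Exp .obj) : Exp .obj

/-- A renaming extended under a binder. -/
def liftRen (r : ℕ → ℕ) : ℕ → ℕ
  | 0 => 0
  | i + 1 => r i + 1

namespace Exp

/-- Renaming of the free variables. -/
def rename : {c : Cat} → (ℕ → ℕ) → Exp c → Exp c
  | _, _, typ => typ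
  | _, r, piK A K => piK (A.rename r) (K.rename (liftRen r))
  | _, r, fvar u => fvar (r u)
  | _, r, piF A B => piF (A.rename r) (B.rename (liftRen r))
  | _, r, lamF A B => lamF (A.rename r) (B.rename (liftRen r))
  | _, r, appF A M => appF (A.rename r) (M.rename r)
  | _, r, var x => var (r x)
  | _, r, lam A M => lam (A.rename r) (M.rename (liftRen r))
  | _, r, app M N => app (M.rename r) (N.rename r)

/-- `P.shift n` is `P` seen in a context extended by `n` declarations. -/
def shift {c : Cat} (n : ℕ) (P : Exp c) : Exp c := P.rename (· + n)

/-- A substitution of objects for object variables extended under a binder. -/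
def liftSub (s : ℕ → Exp .obj) : ℕ → Exp .obj
  | 0 => var 0
  | i + 1 => (s i).shift 1

/-- Simultaneous capture-avoiding substitution: objects `s` for the object variables;
type variables are only renumbered, by `r`. -/
def subst : {c : Cat} → (ℕ → Exp .obj) → (ℕ → ℕ) → Exp c → Exp c
  | _, _, _, typ => typ
  | _, s, r, piK A K => piK (A.subst s r) (K.subst (liftSub s) (liftRen r))
  | _, _, r, fvar u => fvar (r u)
  | _, s, r, piF A B => piF (A.subst s r) (B.subst (liftSub s) (liftRen r))
  | _, s, r, lamF A B => lamF (A.subst s r) (B.subst (liftSub s) (liftRen r))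
  | _, s, r, appF A M => appF (A.subst s r) (M.subst s r)
  | _, s, _, var x => s x
  | _, s, r, lam A M => lam (A.subst s r) (M.subst (liftSub s) (liftRen r))
  | _, s, r, app M N => app (M.subst s r) (N.subst s r)

/-- The substitution that sends variable `0` to `N` and lowers the others by one. -/
def instSub (N : Exp .obj) : ℕ → Exp .obj
  | 0 => N
  | i + 1 => var i

/-- `P[N/x]`, where `x` is the innermost variable (index `0`) of `P`. -/
def inst {c : Cat} (P : Exp c) (N : Exp .obj) : Exp c := P.subst (instSub N) (· - 1)

/-- One step of β-reduction, `(λx:A.P) N → P[N/x]`, anywhere inside an expression. -/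
inductive Step : {c : Cat} → Exp c → Exp c → Prop where
  | betaF (A B : Exp .fam) (N : Exp .obj) : Step (appF (lamF A B) N) (B.inst N)
  | beta (A : Exp .fam) (M N : Exp .obj) : Step (app (lam A M) N) (M.inst N)
  | piK_left {A A' : Exp .fam} {K : Exp .kind} : Step A A' → Step (piK A K) (piK A' K)
  | piK_right {A : Exp .fam} {K K' : Exp .kind} : Step K K' → Step (piK A K) (piK A K')
  | piF_left {A A' B : Exp .fam} : Step A A' → Step (piF A B) (piF A' B)
  | piF_right {A B B' : Exp .fam} : Step B B' → Step (piF A B) (piF A B')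
  | lamF_left {A A' B : Exp .fam} : Step A A' → Step (lamF A B) (lamF A' B)
  | lamF_right {A B B' : Exp .fam} : Step B B' → Step (lamF A B) (lamF A B')
  | appF_left {A A' : Exp .fam} {M : Exp .obj} : Step A A' → Step (appF A M) (appF A' M)
  | appF_right {A : Exp .fam} {M M' : Exp .obj} : Step M M' → Step (appF A M) (appF A M')
  | lam_left {A A' : Exp .fam} {M : Exp .obj} : Step A A' → Step (lam A M) (lam A' M)
  | lam_right {A : Exp .fam} {M M' : Exp .obj} : Step M M' → Step (lam A M) (lam A M')
  | app_left {M M' N : Exp .obj} : Step M M' → Step (app M N) (app M' N)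
  | app_right {M N N' : Exp .obj} : Step N N' → Step (app M N) (app M N')

/-- `P` is in (β-)normal form. -/
def Normal {c : Cat} (P : Exp c) : Prop := ∀ Q : Exp c, ¬ Step P Q

/-- `Q` is the normal form `P^β` of `P`. -/
def NF {c : Cat} (P Q : Exp c) : Prop := Relation.ReflTransGen Step P Q ∧ Q.Normal

/-- The length of the prefix of `Π`s of a kind or type. -/
def piLength : {c : Cat} → Exp c → ℕ
  | _, piK _ K => K.piLength + 1
  | _, piF _ B => B.piLength + 1
  | _, _ => 0

end Exp

/-- An assignment `u : K` or `x : A`. -/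
inductive Decl where
  | kd (K : Exp .kind)
  | ty (A : Exp .fam)

/-- Contexts, the most recent assignment first; each assigned kind or type is an expression
over the assignments that precede it (the tail of the list). -/
abbrev Ctx := List Decl

/-- The four forms of assertions. -/
inductive Assertion where
  | ctx
  | kind (K : Exp .kind)
  | fam (A : Exp .fam) (K : Exp .kind)
  | obj (M : Exp .obj) (A : Exp .fam)

open Exp in
/-- Derivability of LF assertions: `⊢ Γ ctx`, `Γ ⊢ K kind`, `Γ ⊢ A : K`, `Γ ⊢ M : A`. -/
inductive Derives : Ctx → Assertion → Prop where
  | nullCtx : Derives [] .ctx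
  | kindCtx {Γ : Ctx} {K : Exp .kind} :
      Derives Γ (.kind K) → Derives Γ .ctx → Derives (.kd K :: Γ) .ctx
  | typeCtx {Γ : Ctx} {A : Exp .fam} :
      Derives Γ (.fam A typ) → Derives Γ .ctx → Derives (.ty A :: Γ) .ctx
  | typeKind {Γ : Ctx} : Derives Γ .ctx → Derives Γ (.kind typ)
  | piKind {Γ : Ctx} {A : Exp .fam} {K : Exp .kind} :
      Derives Γ (.fam A typ) → Derives (.ty A :: Γ) (.kind K) → Derives Γ (.kind (piK A K))
  | varFam {Γ : Ctx} {u : ℕ} {K K' : Exp .kind} :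
      Derives Γ .ctx → Γ[u]? = some (.kd K) → NF (K.shift (u + 1)) K' →
      Derives Γ (.fam (fvar u) K')
  | varObj {Γ : Ctx} {x : ℕ} {A A' : Exp .fam} :
      Derives Γ .ctx → Γ[x]? = some (.ty A) → NF (A.shift (x + 1)) A' →
      Derives Γ (.obj (var x) A')
  | piFam {Γ : Ctx} {A B : Exp .fam} :
      Derives Γ (.fam A typ) → Derives (.ty A :: Γ) (.fam B typ) →
      Derives Γ (.fam (piF A B) typ)
  | absFam {Γ : Ctx} {A A' B : Exp .fam} {K : Exp .kind} :
      Derives Γ (.fam A typ) → Derives (.ty A :: Γ) (.fam B K) → NF A A' →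
      Derives Γ (.fam (lamF A B) (piK A' K))
  | appFam {Γ : Ctx} {A B : Exp .fam} {K K' : Exp .kind} {M : Exp .obj} :
      Derives Γ (.fam A (piK B K)) → Derives Γ (.obj M B) → NF (K.inst M) K' →
      Derives Γ (.fam (appF A M) K')
  | absObj {Γ : Ctx} {A A' B : Exp .fam} {M : Exp .obj} :
      Derives Γ (.fam A typ) → Derives (.ty A :: Γ) (.obj M B) → NF A A' →
      Derives Γ (.obj (lam A M) (piF A' B))
  | appObj {Γ : Ctx} {A B B' : Exp .fam} {M N : Exp .obj} :
      Derives Γ (.obj M (piF A B)) → Derives Γ (.obj N A) → NF (B.inst N) B' →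
      Derives Γ (.obj (app M N) B')

open Exp in
/-- `FullyApplied Γ k P`: in the expression `P` over `Γ`, standing in a position where it is
applied to `k` arguments, every variable occurrence has as many arguments as the normal form
of the kind or type of that variable has `Π`s in its prefix. -/
def FullyApplied : {c : Cat} → Ctx → ℕ → Exp c → Prop
  | _, _, _, typ => True
  | _, Γ, _, piK A K => FullyApplied Γ 0 A ∧ FullyApplied (.ty A :: Γ) 0 K
  | _, Γ, k, fvar u => ∃ K K' : Exp .kind, Γ[u]? = some (.kd K) ∧ NF K K' ∧ K'.piLength = k
  | _, Γ, _, piF A B => FullyApplied Γ 0 A ∧ FullyApplied (.ty A :: Γ) 0 B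
  | _, Γ, _, lamF A B => FullyApplied Γ 0 A ∧ FullyApplied (.ty A :: Γ) 0 B
  | _, Γ, k, appF A M => FullyApplied Γ (k + 1) A ∧ FullyApplied Γ 0 M
  | _, Γ, k, var x => ∃ A A' : Exp .fam, Γ[x]? = some (.ty A) ∧ NF A A' ∧ A'.piLength = k
  | _, Γ, _, lam A M => FullyApplied Γ 0 A ∧ FullyApplied (.ty A :: Γ) 0 M
  | _, Γ, k, app M N => FullyApplied Γ (k + 1) M ∧ FullyApplied Γ 0 N

/-- `P` is canonical with respect to `Γ`. -/
def Canonical {c : Cat} (Γ : Ctx) (P : Exp c) : Prop := P.Normal ∧ FullyApplied Γ 0 P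

/-- Every kind or type assigned by the context is canonical (relative to the assignments
before it, which are the only ones it may mention in a well-formed context). -/
def CanonicalCtx : Ctx → Prop
  | [] => True
  | .kd K :: Γ => Canonical Γ K ∧ CanonicalCtx Γ
  | .ty A :: Γ => Canonical Γ A ∧ CanonicalCtx Γ

end LF

namespace HH

/-- Simple types over the atomic types `o` (propositions), `lf-obj` and `lf-type`. -/
inductive Ty where
  | o
  | lfObj
  | lfType
  | arr (a b : Ty)

/-- Terms. A signature is a list of types; its constants, like bound variables, are de Bruijn
indices, the signature following the local binders. `hastype` is a fixed nonlogical constant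
present in every signature; the logical constants are `⊤`, `⊃` and `Π` at each type. -/
inductive Tm where
  | var (i : ℕ)
  | hastype
  | top
  | imp
  | all (a : Ty)
  | app (s t : Tm)
  | lam (a : Ty) (t : Tm)

abbrev Sig := List Ty

namespace Tm

/-- Renaming of the free indices. -/
def rename : (ℕ → ℕ) → Tm → Tm
  | r, var i => var (r i)
  | _, hastype => hastype
  | _, top => top
  | _, imp => imp
  | _, all a => all a
  | r, app s t => app (s.rename r) (t.rename r)
  | r, lam a t => lam a (t.rename (LF.liftRen r))

/-- `t.shift n` is `t` seen in a signature extended by `n` constants. -/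
def shift (n : ℕ) (t : Tm) : Tm := t.rename (· + n)

/-- A substitution extended under a binder. -/
def liftSub (s : ℕ → Tm) : ℕ → Tm
  | 0 => var 0
  | i + 1 => (s i).shift 1

/-- Simultaneous capture-avoiding substitution. -/
def subst : (ℕ → Tm) → Tm → Tm
  | s, var i => s i
  | _, hastype => hastype
  | _, top => top
  | _, imp => imp
  | _, all a => all a
  | s, app t u => app (t.subst s) (u.subst s)
  | s, lam a t => lam a (t.subst (liftSub s))

/-- The substitution that sends index `0` to `t` and lowers the others by one. -/
def instSub (t : Tm) : ℕ → Tm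
  | 0 => t
  | i + 1 => var i

/-- `s[t/x]`, where `x` is the innermost variable (index `0`) of `s`. -/
def inst (s t : Tm) : Tm := s.subst (instSub t)

/-- `D ⊃ G`. -/
def implies (D G : Tm) : Tm := app (app imp D) G

/-- `∀x.F` for `x` of type `a`, that is `Π (λx.F)`. -/
def forAll (a : Ty) (F : Tm) : Tm := app (all a) (lam a F)

/-- The shape `p t₁ … tₙ` of atomic formulas, `p` a nonlogical constant. -/
def IsAtomic : Tm → Prop
  | var _ => True
  | hastype => True
  | app s _ => s.IsAtomic
  | _ => False

end Tm

open Tm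

/-- `HasType S t a`: `t` is an `S`-term of type `a`, that is, a closed simply typed term of
type `a` whose nonlogical constants belong to the signature `S`. -/
inductive HasType : Sig → Tm → Ty → Prop where
  | var {S : Sig} {i : ℕ} {a : Ty} : S[i]? = some a → HasType S (var i) a
  | hastype {S : Sig} : HasType S hastype (.arr .lfObj (.arr .lfType .o))
  | top {S : Sig} : HasType S top .o
  | imp {S : Sig} : HasType S imp (.arr .o (.arr .o .o))
  | all {S : Sig} {a : Ty} : HasType S (all a) (.arr (.arr a .o) .o)
  | app {S : Sig} {s t : Tm} {a b : Ty} :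
      HasType S s (.arr a b) → HasType S t a → HasType S (app s t) b
  | lam {S : Sig} {t : Tm} {a b : Ty} :
      HasType (a :: S) t b → HasType S (lam a t) (.arr a b)

/-- Equality of the `S`-terms of a type: the congruence generated by β and η. -/
inductive Eqv : Sig → Tm → Tm → Ty → Prop where
  | refl {S : Sig} {t : Tm} {a : Ty} : HasType S t a → Eqv S t t a
  | symm {S : Sig} {s t : Tm} {a : Ty} : Eqv S s t a → Eqv S t s a
  | trans {S : Sig} {s t u : Tm} {a : Ty} : Eqv S s t a → Eqv S t u a → Eqv S s u a
  | app {S : Sig} {s s' t t' : Tm} {a b : Ty} :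
      Eqv S s s' (.arr a b) → Eqv S t t' a → Eqv S (app s t) (app s' t') b
  | lam {S : Sig} {t t' : Tm} {a b : Ty} :
      Eqv (a :: S) t t' b → Eqv S (lam a t) (lam a t') (.arr a b)
  | beta {S : Sig} {s t : Tm} {a b : Ty} :
      HasType (a :: S) s b → HasType S t a → Eqv S (app (lam a s) t) (s.inst t) b
  | eta {S : Sig} {t : Tm} {a b : Ty} :
      HasType S t (.arr a b) → Eqv S (lam a (app (t.shift 1) (var 0))) t (.arr a b)

/-- Right-hand sides of sequents: a goal `G`, or an atomic formula `A` under focus on `D`. -/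
inductive Rhs where
  | goal (G : Tm)
  | focus (A D : Tm)

/-- `Prov S P (.goal G)` is derivability of `S; P ⟶ G` and `Prov S P (.focus A D)` that of
the focused sequent, on `D`, for `A`. The rules `convGoal` and `convFocus` express that
βη-equal formulas are identified. The fresh constant of `allR` is the new index `0`. -/
inductive Prov : Sig → List Tm → Rhs → Prop where
  | topR {S : Sig} {P : List Tm} : Prov S P (.goal top)
  | impR {S : Sig} {P : List Tm} {D G : Tm} :
      Prov S (D :: P) (.goal G) → Prov S P (.goal (implies D G))
  | allR {S : Sig} {P : List Tm} {a : Ty} {G : Tm} :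
      Prov (a :: S) (P.map (shift 1)) (.goal G) → Prov S P (.goal (forAll a G))
  | decide {S : Sig} {P : List Tm} {A D : Tm} :
      A.IsAtomic → D ∈ P → Prov S P (.focus A D) → Prov S P (.goal A)
  | init {S : Sig} {P : List Tm} {A : Tm} : A.IsAtomic → Prov S P (.focus A A)
  | allL {S : Sig} {P : List Tm} {A D t : Tm} {a : Ty} :
      HasType S t a → Prov S P (.focus A (D.inst t)) → Prov S P (.focus A (forAll a D))
  | impL {S : Sig} {P : List Tm} {A D G : Tm} :
      Prov S P (.goal G) → Prov S P (.focus A D) → Prov S P (.focus A (implies G D))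
  | convGoal {S : Sig} {P P' : List Tm} {G G' : Tm} :
      List.Forall₂ (fun D D' => Eqv S D D' .o) P P' → Eqv S G G' .o →
      Prov S P (.goal G) → Prov S P' (.goal G')
  | convFocus {S : Sig} {P P' : List Tm} {A A' D D' : Tm} :
      List.Forall₂ (fun D D' => Eqv S D D' .o) P P' → Eqv S A A' .o → Eqv S D D' .o →
      Prov S P (.focus A D) → Prov S P' (.focus A' D')

end HH

namespace Translation

open LF LF.Exp HH HH.Tm

/-- `φ`: the simple type of the encodings of the inhabitants of a canonical type or kind.
(The values on family-level abstractions and on objects are never used.) -/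
def phi : {c : Cat} → Exp c → Ty
  | _, typ => .lfType
  | _, piK A K => .arr (phi A) (phi K)
  | _, piF A B => .arr (phi A) (phi B)
  | _, _ => .lfObj

/-- `⟨Q⟩`: the encoding of a canonical object or base type as a simply typed term; each LF
variable is reused as the constant or bound variable with the same index. (The values on
kinds, on `Π`-types and on family-level abstractions are never used.) -/
def encTerm : {c : Cat} → Exp c → Tm
  | _, fvar u => .var u
  | _, appF A M => .app (encTerm A) (encTerm M)
  | _, Exp.var x => .var x
  | _, Exp.app M N => .app (encTerm M) (encTerm N)
  | _, Exp.lam A M => .lam (phi A) (encTerm M)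
  | _, _ => .top

/-- `⟦A⟧`, for a canonical type `A`:
`⟦Πx:A.B⟧ = λM. ∀x. (⟦A⟧ x) ⊃ (⟦B⟧ (M x))` and, for a base type, `⟦A⟧ = λM. hastype M ⟨A⟩`.
In the body of the first clause `M` has index `1` and `x` has index `0`. (The values on
kinds and on objects are never used.) -/
def encType : {c : Cat} → Exp c → Tm
  | _, piF A B =>
      .lam (.arr (phi A) (phi B))
        (forAll (phi A)
          (implies (.app ((encType A).shift 2) (.var 0))
            (.app ((encType B).rename (liftRen (· + 1))) (.app (.var 1) (.var 0)))))
  | _, A => .lam .lfObj (.app (.app .hastype (.var 0)) ((encTerm A).shift 1))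

/-- `⟦M : A⟧ = ⟦A⟧ ⟨M⟩`. -/
def encOf (M : Exp .obj) (A : Exp .fam) : Tm := .app (encType A) (encTerm M)

/-- The signature consisting of a copy of the symbols in the domain of the context. -/
def sigOf : Ctx → Sig
  | [] => []
  | .kd K :: Γ => phi K :: sigOf Γ
  | .ty A :: Γ => phi A :: sigOf Γ

/-- `⟦Γ⟧`: kind assignments are dropped, each type assignment `x : A` becomes `⟦x : A⟧`. -/
def encCtx : Ctx → List Tm
  | [] => []
  | .kd _ :: Γ => (encCtx Γ).map (HH.Tm.shift 1)
  | .ty A :: Γ => encOf (Exp.var 0) (A.shift 1) :: (encCtx Γ).map (HH.Tm.shift 1)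

end Translation

/-!
The encoding identifies the canonical LF objects of type `A` with the βη-long normal terms `t` of
type `φ(A)` for which `⟦A⟧ t` is derivable: a derivation of `⟦A⟧ t` has the structure of an LF
derivation for the object that `t` encodes. An abstraction corresponds to the right rules for
`∀` and `⊃`. A variable applied to arguments corresponds to focusing on the assumption for that
variable, where each left `∀` supplies an argument and the left `⊃` that follows it checks the
type of that argument. Three bodies of theory make this precise.

*The simply typed calculus.* Formulas are identified up to βη-equality, so the shape of a formula
must be an invariant. Normalization by evaluation gives this: the full set-theoretic type
hierarchy over level-indexed terms validates βη, so equal terms have the same normal form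
(`HH.Eqv.nf_eq`), and a Kripke logical relation shows that every term is equal to its normal form
(`HH.HasType.eqv_nf`). Hence `⊃`, `∀` and `hastype` are injective up to equality and no two of the
shapes overlap; and since encodings of canonical objects are their own normal forms, base types
with equal encodings are equal (`LF.Derives.base_type_eq`).

*Substitution in LF.* The type of `M N` is the normal form of `B[N/x]`, which has to exist, be
canonical, be well formed and have the encoding `⟦B⟧[⟨N⟩/x]`. `LF.Simple` describes canonical
expressions by their simple types alone. Hereditary substitution, by induction on the simple type
of the variable, gives existence and the encoding (`LF.Simple.exists_subst`). Confluence gives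
uniqueness; it is proved for raw expressions (`LF.Raw.Conv`), because the substitution of `Exp`
keeps type variables apart from object variables and behaves well only on expressions in which
no type variable refers to the binder of an object variable (`LF.Exp.Clean`). A second induction
on simple types shows that derivations are preserved (`LF.TypedSub.derives`); it is run first for
renamings, where no redex arises, to obtain weakening.

*The two directions.* `LF.Derives.prov` turns LF derivations into derivations in the logic, by
induction on the former. `LF.Reads.of_prov` inverts this by induction on derivations in the
logic, for the four shapes of sequent that occur above `⟦A⟧ M`.
-/

/-! ### Substitution in simply typed terms -/

namespace HH

open LF (liftRen)

namespace Tm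

theorem liftRen_comp (r r' : ℕ → ℕ) : liftRen r' ∘ liftRen r = liftRen (r' ∘ r) := by
  funext i; cases i <;> rfl

theorem rename_rename (t : Tm) (r r' : ℕ → ℕ) :
    (t.rename r).rename r' = t.rename (r' ∘ r) := by
  induction t generalizing r r' <;> simp_all [rename, liftRen_comp]

theorem shift_rename_lift (t : Tm) (r : ℕ → ℕ) :
    (t.shift 1).rename (liftRen r) = (t.rename r).shift 1 := by
  simp only [shift, rename_rename]; rfl

theorem shift_shift (t : Tm) (m n : ℕ) : (t.shift m).shift n = t.shift (m + n) := by
  simp only [shift, rename_rename]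
  congr 1; funext i; simp [add_assoc]

@[simp] theorem rename_id (t : Tm) : t.rename id = t := by
  have h : liftRen id = id := by funext i; cases i <;> rfl
  induction t <;> simp_all [rename]

@[simp] theorem shift_zero (t : Tm) : t.shift 0 = t := rename_id t

theorem liftSub_comp_liftRen (r : ℕ → ℕ) (s : ℕ → Tm) :
    liftSub s ∘ liftRen r = liftSub (s ∘ r) := by
  funext i; cases i <;> rfl

theorem subst_rename (t : Tm) (r : ℕ → ℕ) (s : ℕ → Tm) :
    (t.rename r).subst s = t.subst (s ∘ r) := by
  induction t generalizing r s <;> simp_all [rename, subst, liftSub_comp_liftRen]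

theorem rename_liftSub (s : ℕ → Tm) (r : ℕ → ℕ) :
    (fun i => (liftSub s i).rename (liftRen r)) = liftSub (fun i => (s i).rename r) := by
  funext i; cases i with
  | zero => rfl
  | succ i => exact shift_rename_lift _ _

theorem rename_subst (t : Tm) (s : ℕ → Tm) (r : ℕ → ℕ) :
    (t.subst s).rename r = t.subst (fun i => (s i).rename r) := by
  induction t generalizing r s <;> simp_all [rename, subst, rename_liftSub]

theorem shift_subst_lift (t : Tm) (s : ℕ → Tm) :
    (t.shift 1).subst (liftSub s) = (t.subst s).shift 1 := by
  simp only [shift, subst_rename, rename_subst]; rfl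

theorem subst_liftSub (s s' : ℕ → Tm) :
    (fun i => (liftSub s i).subst (liftSub s')) = liftSub (fun i => (s i).subst s') := by
  funext i; cases i with
  | zero => rfl
  | succ i => exact shift_subst_lift _ _

theorem subst_subst (t : Tm) (s s' : ℕ → Tm) :
    (t.subst s).subst s' = t.subst (fun i => (s i).subst s') := by
  induction t generalizing s s' <;> simp_all [subst, subst_liftSub]

theorem rename_eq_subst (t : Tm) (r : ℕ → ℕ) : t.rename r = t.subst (fun i => var (r i)) := by
  have h : ∀ r : ℕ → ℕ, liftSub (fun i => var (r i)) = fun i => var (liftRen r i) := by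
    intro r; funext i; cases i <;> rfl
  induction t generalizing r <;> simp_all [rename, subst]

@[simp] theorem subst_var (t : Tm) : t.subst var = t := by
  rw [← rename_id t, subst_rename, rename_eq_subst]; rfl

@[simp] theorem shift_inst (t u : Tm) : (t.shift 1).inst u = t := by
  rw [shift, inst, subst_rename]; exact subst_var t

theorem inst_subst (t u : Tm) (s : ℕ → Tm) :
    (t.inst u).subst s = (t.subst (liftSub s)).inst (u.subst s) := by
  simp only [inst, subst_subst]
  congr 1; funext i; cases i with
  | zero => rfl
  | succ i => exact (shift_inst _ _).symm

theorem rename_lift_inst_var (t : Tm) : (t.rename (liftRen (· + 1))).inst (var 0) = t := by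
  rw [inst, subst_rename]
  conv_rhs => rw [← subst_var t]
  congr 1; funext i; cases i <;> rfl

end Tm

open Tm

/-! ### Typing and βη-equality -/

theorem HasType.rename {S S' : Sig} {t : Tm} {a : Ty} {r : ℕ → ℕ} (h : HasType S t a)
    (hr : ∀ i b, S[i]? = some b → S'[r i]? = some b) : HasType S' (t.rename r) a := by
  induction h generalizing S' r with
  | var h => exact .var (hr _ _ h)
  | hastype => exact .hastype
  | top => exact .top
  | imp => exact .imp
  | all => exact .all
  | app _ _ ih₁ ih₂ => exact .app (ih₁ hr) (ih₂ hr)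
  | lam _ ih =>
    refine .lam (ih ?_)
    rintro (_ | i) b hb
    · simpa [liftRen] using hb
    · simpa [liftRen] using hr i b (by simpa using hb)

theorem HasType.shift {S : Sig} {t : Tm} {a : Ty} (E : Sig) (h : HasType S t a) :
    HasType (E ++ S) (t.shift E.length) a :=
  h.rename fun i b hb => by simpa [List.getElem?_append_right] using hb

theorem HasType.shift_one {S : Sig} {t : Tm} {a : Ty} (b : Ty) (h : HasType S t a) :
    HasType (b :: S) (t.shift 1) a := h.shift [b]

theorem HasType.liftSub {S S' : Sig} {s : ℕ → Tm} (c : Ty)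
    (hs : ∀ i b, S[i]? = some b → HasType S' (s i) b) :
    ∀ i b, (c :: S)[i]? = some b → HasType (c :: S') (liftSub s i) b := by
  rintro (_ | i) b hb
  · exact .var (by simpa using hb)
  · exact (hs i b (by simpa using hb)).shift_one c

theorem HasType.subst {S S' : Sig} {t : Tm} {a : Ty} {s : ℕ → Tm} (h : HasType S t a)
    (hs : ∀ i b, S[i]? = some b → HasType S' (s i) b) : HasType S' (t.subst s) a := by
  induction h generalizing S' s with
  | var h => exact hs _ _ h
  | hastype => exact .hastype
  | top => exact .top
  | imp => exact .imp
  | all => exact .all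
  | app _ _ ih₁ ih₂ => exact .app (ih₁ hs) (ih₂ hs)
  | lam _ ih => exact .lam (ih (HasType.liftSub _ hs))

theorem HasType.instSub {S : Sig} {t : Tm} {b : Ty} (ht : HasType S t b) :
    ∀ i c, (b :: S)[i]? = some c → HasType S (instSub t i) c := by
  rintro (_ | i) c hc
  · obtain rfl : b = c := by simpa using hc
    exact ht
  · exact .var (by simpa using hc)

theorem HasType.inst {S : Sig} {s t : Tm} {a b : Ty} (h : HasType (b :: S) s a)
    (ht : HasType S t b) : HasType S (s.inst t) a :=
  h.subst ht.instSub

theorem Eqv.hasType {S : Sig} {s t : Tm} {a : Ty} (h : Eqv S s t a) :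
    HasType S s a ∧ HasType S t a := by
  induction h with
  | refl h => exact ⟨h, h⟩
  | symm _ ih => exact ih.symm
  | trans _ _ ih₁ ih₂ => exact ⟨ih₁.1, ih₂.2⟩
  | app _ _ ih₁ ih₂ => exact ⟨.app ih₁.1 ih₂.1, .app ih₁.2 ih₂.2⟩
  | lam _ ih => exact ⟨.lam ih.1, .lam ih.2⟩
  | beta h₁ h₂ => exact ⟨.app (.lam h₁) h₂, h₁.inst h₂⟩
  | eta h => exact ⟨.lam (.app (h.shift_one _) (.var rfl)), h⟩

theorem Eqv.subst {S S' : Sig} {t t' : Tm} {a : Ty} {s : ℕ → Tm} (h : Eqv S t t' a)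
    (hs : ∀ i b, S[i]? = some b → HasType S' (s i) b) :
    Eqv S' (t.subst s) (t'.subst s) a := by
  induction h generalizing S' s with
  | refl h => exact .refl (h.subst hs)
  | symm _ ih => exact (ih hs).symm
  | trans _ _ ih₁ ih₂ => exact (ih₁ hs).trans (ih₂ hs)
  | app _ _ ih₁ ih₂ => exact .app (ih₁ hs) (ih₂ hs)
  | lam _ ih => exact .lam (ih (HasType.liftSub _ hs))
  | beta h₁ h₂ =>
    rw [inst_subst]
    exact .beta (h₁.subst (HasType.liftSub _ hs)) (h₂.subst hs)
  | eta h =>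
    have := Eqv.eta (h.subst hs)
    rwa [← shift_subst_lift] at this

theorem Eqv.rename {S S' : Sig} {t t' : Tm} {a : Ty} {r : ℕ → ℕ} (h : Eqv S t t' a)
    (hr : ∀ i b, S[i]? = some b → S'[r i]? = some b) :
    Eqv S' (t.rename r) (t'.rename r) a := by
  rw [rename_eq_subst, rename_eq_subst]
  exact h.subst fun i b hb => .var (hr i b hb)

theorem Eqv.shift {S : Sig} {t t' : Tm} {a : Ty} (E : Sig) (h : Eqv S t t' a) :
    Eqv (E ++ S) (t.shift E.length) (t'.shift E.length) a :=
  h.rename fun i b hb => by simpa [List.getElem?_append_right] using hb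

theorem Eqv.shift_one {S : Sig} {t t' : Tm} {a : Ty} (b : Ty) (h : Eqv S t t' a) :
    Eqv (b :: S) (t.shift 1) (t'.shift 1) a := h.shift [b]

theorem Eqv.liftSub {S S' : Sig} {s s' : ℕ → Tm} (c : Ty)
    (hs : ∀ i b, S[i]? = some b → Eqv S' (s i) (s' i) b) :
    ∀ i b, (c :: S)[i]? = some b → Eqv (c :: S') (liftSub s i) (liftSub s' i) b := by
  rintro (_ | i) b hb
  · exact .refl (.var (by simpa using hb))
  · exact (hs i b (by simpa using hb)).shift_one c

theorem HasType.subst_eqv {S S' : Sig} {t : Tm} {a : Ty} {s s' : ℕ → Tm} (h : HasType S t a)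
    (hs : ∀ i b, S[i]? = some b → Eqv S' (s i) (s' i) b) :
    Eqv S' (t.subst s) (t.subst s') a := by
  induction h generalizing S' s s' with
  | var h => exact hs _ _ h
  | hastype => exact .refl .hastype
  | top => exact .refl .top
  | imp => exact .refl .imp
  | all => exact .refl .all
  | app _ _ ih₁ ih₂ => exact .app (ih₁ hs) (ih₂ hs)
  | lam _ ih => exact .lam (ih (Eqv.liftSub _ hs))

theorem Eqv.inst {S : Sig} {s s' t t' : Tm} {a b : Ty} (h : Eqv (b :: S) s s' a)
    (ht : Eqv S t t' b) : Eqv S (s.inst t) (s'.inst t') a := by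
  refine (h.subst ht.hasType.1.instSub).trans (h.hasType.2.subst_eqv ?_)
  rintro (_ | i) c hc
  · obtain rfl : b = c := by simpa using hc
    exact ht
  · exact .refl (.var (by simpa using hc))

/-! ### Normalization by evaluation -/

/-- The full set-theoretic type hierarchy over the terms that depend on the length of the
ambient signature: a variable is named by its distance from the outer end, which does not
change when the signature grows. -/
def Dom : Ty → Type
  | .arr a b => Dom a → Dom b
  | .o => ℕ → Tm
  | .lfObj => ℕ → Tm
  | .lfType => ℕ → Tm

/-- The variable at distance `l` from the outer end, in a signature of length `n`. -/
def level (l n : ℕ) : Tm := .var (n - (l + 1))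

mutual
/-- The η-long term that denotes an element of the hierarchy. -/
def reify : (a : Ty) → Dom a → ℕ → Tm
  | .arr a b, f, n => .lam a (reify b (f (reflect a (level n))) (n + 1))
  | .o, d, n => d n
  | .lfObj, d, n => d n
  | .lfType, d, n => d n
/-- The denotation of a neutral term. -/
def reflect : (a : Ty) → (ℕ → Tm) → Dom a
  | .arr a b, u => fun d => reflect b fun n => .app (u n) (reify a d n)
  | .o, u => u
  | .lfObj, u => u
  | .lfType, u => u
end

/-- The type of a typable term whose variables have the types `τ`. -/
def infer (τ : ℕ → Ty) : Tm → Ty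
  | .var i => τ i
  | .hastype => .arr .lfObj (.arr .lfType .o)
  | .top => .o
  | .imp => .arr .o (.arr .o .o)
  | .all a => .arr (.arr a .o) .o
  | .app s _ => match infer τ s with
    | .arr _ b => b
    | c => c
  | .lam a t => .arr a (infer (fun | 0 => a | i + 1 => τ i) t)

/-- Assignments of elements of the hierarchy to the variables. -/
abbrev Env := ℕ → Σ a, Dom a

/-- The environment extended under a binder. -/
def Env.cons {a : Ty} (d : Dom a) (ρ : Env) : Env
  | 0 => ⟨a, d⟩
  | i + 1 => ρ i

/-- The environment assigns values of the right types to the constants of `S`. -/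
def Env.Models (ρ : Env) (S : Sig) : Prop := ∀ i b, S[i]? = some b → (ρ i).1 = b

/-- The denotation of an abstraction, given the denotations of its body. -/
def abstraction : (a : Ty) → ((c b : Ty) → Dom c → Dom b) → Dom a
  | .arr c b, F => F c b
  | .o, _ => fun _ => .top
  | .lfObj, _ => fun _ => .top
  | .lfType, _ => fun _ => .top

open Classical in
/-- The denotation of a term of type `a`. The values on ill-typed terms are never used. -/
noncomputable def eval : Tm → (a : Ty) → Env → Dom a
  | .var i, a, ρ => if h : (ρ i).1 = a then h ▸ (ρ i).2 else reflect a (fun _ => .top)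
  | .hastype, a, _ => reflect a fun _ => .hastype
  | .top, a, _ => reflect a fun _ => .top
  | .imp, a, _ => reflect a fun _ => .imp
  | .all b, a, _ => reflect a fun _ => .all b
  | .app s t, b, ρ =>
    (eval s (.arr (infer (fun i => (ρ i).1) t) b) ρ) (eval t (infer (fun i => (ρ i).1) t) ρ)
  | .lam _ t, a, ρ => abstraction a fun _ b d => eval t b (Env.cons d ρ)

theorem HasType.infer_eq {S : Sig} {t : Tm} {a : Ty} {τ : ℕ → Ty} (h : HasType S t a)
    (hτ : ∀ i b, S[i]? = some b → τ i = b) : infer τ t = a := by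
  induction h generalizing τ with
  | var h => exact hτ _ _ h
  | hastype => rfl
  | top => rfl
  | imp => rfl
  | all => rfl
  | app _ _ ih₁ _ => simp [infer, ih₁ hτ]
  | lam _ ih =>
    rw [infer, ih]
    rintro (_ | i) b hb
    · simpa using hb
    · exact hτ i b (by simpa using hb)

theorem HasType.unique {S : Sig} {t : Tm} {a b : Ty} (h : HasType S t a)
    (h' : HasType S t b) : a = b := by
  have hS : ∀ i c, S[i]? = some c → S.getD i .o = c := fun i c hc => by simp [List.getD, hc]
  rw [← h.infer_eq (τ := fun i => S.getD i .o) hS, h'.infer_eq hS]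

theorem eval_var {i : ℕ} {a : Ty} {ρ : Env} {d : Dom a} (h : ρ i = ⟨a, d⟩) :
    eval (.var i) a ρ = d := by
  have h₁ : (ρ i).1 = a := by rw [h]
  rw [eval, dif_pos h₁]
  generalize ρ i = x at h h₁
  subst h
  rfl

theorem eval_app {S : Sig} {s t : Tm} {a b : Ty} {ρ : Env} (ht : HasType S t a)
    (hρ : ρ.Models S) : eval (.app s t) b ρ = (eval s (.arr a b) ρ) (eval t a ρ) := by
  rw [eval, ht.infer_eq hρ]

theorem Env.Models.cons {ρ : Env} {S : Sig} {a : Ty} (d : Dom a) (h : ρ.Models S) :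
    (Env.cons d ρ).Models (a :: S) := by
  rintro (_ | i) b hb
  · simpa [Env.cons] using hb
  · exact h i b (by simpa using hb)

theorem eval_rename {S S' : Sig} {t : Tm} {a : Ty} {r : ℕ → ℕ} {ρ ρ' : Env}
    (h : HasType S t a) (hr : ∀ i b, S[i]? = some b → S'[r i]? = some b)
    (hρ : ρ.Models S') (hρ' : ∀ i b, S[i]? = some b → ρ' i = ρ (r i)) :
    eval (t.rename r) a ρ = eval t a ρ' := by
  have hM : ρ'.Models S := fun i b hb => by rw [hρ' i b hb]; exact hρ _ _ (hr i b hb)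
  induction h generalizing S' r ρ ρ' with
  | var h => simp only [Tm.rename, eval]; rw [hρ' _ _ h]
  | hastype => rfl
  | top => rfl
  | imp => rfl
  | all => rfl
  | app h₁ h₂ ih₁ ih₂ =>
    rw [Tm.rename, eval_app (h₂.rename hr) hρ, eval_app h₂ hM, ih₁ hr hρ hρ' hM,
      ih₂ hr hρ hρ' hM]
  | lam h ih =>
    funext d
    refine ih (S' := _ :: S') ?_ (hρ.cons d) ?_ (hM.cons d)
    · rintro (_ | i) b hb
      · simpa [liftRen] using hb
      · exact hr i b (by simpa using hb)
    · rintro (_ | i) b hb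
      · rfl
      · exact hρ' i b (by simpa using hb)

theorem eval_subst {S S' : Sig} {t : Tm} {a : Ty} {s : ℕ → Tm} {ρ ρ' : Env}
    (h : HasType S t a) (hs : ∀ i b, S[i]? = some b → HasType S' (s i) b)
    (hρ : ρ.Models S') (hρ' : ∀ i b, S[i]? = some b → ρ' i = ⟨b, eval (s i) b ρ⟩) :
    eval (t.subst s) a ρ = eval t a ρ' := by
  have hM : ρ'.Models S := fun i b hb => by rw [hρ' i b hb]
  induction h generalizing S' s ρ ρ' with
  | var h => exact (eval_var (hρ' _ _ h)).symm
  | hastype => rfl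
  | top => rfl
  | imp => rfl
  | all => rfl
  | app h₁ h₂ ih₁ ih₂ =>
    rw [Tm.subst, eval_app (h₂.subst hs) hρ, eval_app h₂ hM, ih₁ hs hρ hρ' hM,
      ih₂ hs hρ hρ' hM]
  | lam h ih =>
    funext d
    refine ih (HasType.liftSub _ hs) (hρ.cons d) ?_ (hM.cons d)
    rintro (_ | i) b hb
    · obtain rfl := by simpa using hb
      exact congrArg _ (eval_var rfl).symm
    · have hb' := by simpa using hb
      refine (hρ' i b hb').trans (congrArg _ ?_)
      exact (eval_rename (r := (· + 1)) (S' := _ :: S') (hs i b hb')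
        (fun i b hb => by simpa using hb) (hρ.cons d) fun _ _ _ => rfl).symm

/-- The hierarchy validates β and η, the latter by function extensionality. -/
theorem Eqv.eval_eq {S : Sig} {s t : Tm} {a : Ty} {ρ : Env} (h : Eqv S s t a)
    (hρ : ρ.Models S) : eval s a ρ = eval t a ρ := by
  induction h generalizing ρ with
  | refl => rfl
  | symm _ ih => exact (ih hρ).symm
  | trans _ _ ih₁ ih₂ => exact (ih₁ hρ).trans (ih₂ hρ)
  | app h₁ h₂ ih₁ ih₂ =>
    rw [eval_app h₂.hasType.1 hρ, eval_app h₂.hasType.2 hρ, ih₁ hρ, ih₂ hρ]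
  | lam _ ih => funext d; exact ih (hρ.cons d)
  | @beta S s t a b h₁ h₂ =>
    rw [eval_app h₂ hρ]
    refine (eval_subst h₁ h₂.instSub hρ ?_).symm
    rintro (_ | i) c hc
    · obtain rfl := by simpa using hc
      rfl
    · have hc' : S[i]? = some c := by simpa using hc
      have := hρ i c hc'
      subst this
      exact congrArg (Sigma.mk _) (eval_var (ρ := ρ) (d := (ρ i).2) rfl).symm
  | @eta S t a b h =>
    funext d
    refine (eval_app (S := a :: S) (.var rfl) (hρ.cons d)).trans ?_
    rw [eval_var (d := d) rfl]
    exact congrFun (eval_rename (S' := a :: S) h (fun i b hb => by simpa using hb) (hρ.cons d)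
      fun _ _ _ => rfl) d

/-- The environment that interprets each constant of `S` by itself. -/
def idEnv (S : Sig) : Env := fun i =>
  ⟨S.getD i .o, reflect _ (level (S.length - 1 - i))⟩

theorem idEnv_models (S : Sig) : (idEnv S).Models S := fun i b hb => by
  simp [idEnv, List.getD, hb]

theorem idEnv_cons (a : Ty) (S : Sig) :
    idEnv (a :: S) = Env.cons (reflect a (level S.length)) (idEnv S) := by
  funext i
  cases i with
  | zero => rfl
  | succ i =>
    have : S.length + 1 - 1 - (i + 1) = S.length - 1 - i := by omega
    exact congrArg (fun l => (⟨S.getD i .o, reflect _ (level l)⟩ : Σ a, Dom a)) this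

theorem eval_var_idEnv {S : Sig} {i : ℕ} {a : Ty} (h : S[i]? = some a) :
    eval (.var i) a (idEnv S) = reflect a (level (S.length - 1 - i)) := by
  apply eval_var
  have : S.getD i .o = a := by simp [List.getD, h]
  subst this
  rfl

/-- The βη-long normal form of a term of type `a` over `S`. -/
noncomputable def nf (S : Sig) (a : Ty) (t : Tm) : Tm := reify a (eval t a (idEnv S)) S.length

theorem Eqv.nf_eq {S : Sig} {s t : Tm} {a : Ty} (h : Eqv S s t a) : nf S a s = nf S a t := by
  rw [nf, h.eval_eq (idEnv_models S), nf]

/-- The Kripke logical relation between terms and elements of the hierarchy; the worlds are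
signatures, ordered by extension. -/
def Rel : (a : Ty) → Sig → Tm → Dom a → Prop
  | .arr a b, S, t, f => HasType S t (.arr a b) ∧ ∀ (E : Sig) (s : Tm) (d : Dom a),
      Rel a (E ++ S) s d → Rel b (E ++ S) (.app (t.shift E.length) s) (f d)
  | .o, S, t, d => ∀ E : Sig, Eqv (E ++ S) (t.shift E.length) (d (E.length + S.length)) .o
  | .lfObj, S, t, d =>
      ∀ E : Sig, Eqv (E ++ S) (t.shift E.length) (d (E.length + S.length)) .lfObj
  | .lfType, S, t, d =>
      ∀ E : Sig, Eqv (E ++ S) (t.shift E.length) (d (E.length + S.length)) .lfType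

theorem Rel.hasType {a : Ty} {S : Sig} {t : Tm} {d : Dom a} (h : Rel a S t d) :
    HasType S t a := by
  cases a with
  | arr a b => exact h.1
  | o => simpa using (h []).hasType.1
  | lfObj => simpa using (h []).hasType.1
  | lfType => simpa using (h []).hasType.1

theorem Rel.conv {a : Ty} {S : Sig} {t t' : Tm} {d : Dom a} (h : Rel a S t d)
    (e : Eqv S t t' a) : Rel a S t' d := by
  induction a generalizing S t t' with
  | arr a b _ ihb =>
    exact ⟨e.hasType.2, fun E s x hx =>
      ihb (h.2 E s x hx) ((e.shift E).app (.refl hx.hasType))⟩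
  | o => exact fun E => (e.shift E).symm.trans (h E)
  | lfObj => exact fun E => (e.shift E).symm.trans (h E)
  | lfType => exact fun E => (e.shift E).symm.trans (h E)

theorem Rel.shift {a : Ty} {S : Sig} {t : Tm} {d : Dom a} (E : Sig) (h : Rel a S t d) :
    Rel a (E ++ S) (t.shift E.length) d := by
  have key : ∀ (c : Ty) (u : ℕ → Tm),
      (∀ E : Sig, Eqv (E ++ S) (t.shift E.length) (u (E.length + S.length)) c) →
      ∀ E' : Sig, Eqv (E' ++ (E ++ S)) ((t.shift E.length).shift E'.length)
        (u (E'.length + (E ++ S).length)) c := fun c u hu E' => by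
    have := hu (E' ++ E)
    rw [shift_shift, ← List.append_assoc, List.length_append, ← add_assoc, add_comm E.length,
      ← List.length_append]
    exact this
  cases a with
  | arr a b =>
    refine ⟨h.1.shift E, fun E' s x hx => ?_⟩
    rw [shift_shift, add_comm, ← List.length_append]
    rw [← List.append_assoc] at hx ⊢
    exact h.2 _ s x hx
  | o => exact key _ _ h
  | lfObj => exact key _ _ h
  | lfType => exact key _ _ h

theorem rel_reify_reflect (a : Ty) :
    (∀ {S : Sig} {t : Tm} {d : Dom a}, Rel a S t d → Eqv S t (reify a d S.length) a) ∧
    ∀ {S : Sig} {t : Tm} {u : ℕ → Tm},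
      (∀ E : Sig, Eqv (E ++ S) (t.shift E.length) (u (E.length + S.length)) a) →
      Rel a S t (reflect a u) := by
  induction a with
  | arr a b iha ihb =>
    constructor
    · intro S t f h
      refine (Eqv.eta h.1).symm.trans (.lam (ihb.1 (h.2 [a] _ _ (iha.2 fun E => ?_))))
      have : level S.length (E.length + ([a] ++ S).length) = .var E.length := by
        simp [level]
      rw [this]
      have h₀ := HasType.shift E (S := a :: S) (.var (i := 0) (a := a) rfl)
      simp only [Tm.shift, Tm.rename, zero_add] at h₀ ⊢
      exact .refl h₀
    · intro S t u h
      refine ⟨by simpa using (h []).hasType.1, fun E s d hd => ihb.2 fun E' => ?_⟩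
      refine Eqv.app (a := a) ?_ ?_
      · have := h (E' ++ E)
        change Eqv _ ((t.shift E.length).shift E'.length) _ _
        rw [shift_shift, ← List.append_assoc, List.length_append, ← add_assoc,
          add_comm E.length, ← List.length_append]
        exact this
      · have := iha.1 (hd.shift E')
        rwa [List.length_append] at this
  | o => exact ⟨fun h => by simpa [reify] using h [], fun h => h⟩
  | lfObj => exact ⟨fun h => by simpa [reify] using h [], fun h => h⟩
  | lfType => exact ⟨fun h => by simpa [reify] using h [], fun h => h⟩

/-- The fundamental theorem of the logical relation. -/
theorem HasType.rel {S S' : Sig} {t : Tm} {a : Ty} {s : ℕ → Tm} {ρ : Env}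
    (h : HasType S t a)
    (hs : ∀ i b, S[i]? = some b → ∃ d : Dom b, ρ i = ⟨b, d⟩ ∧ Rel b S' (s i) d) :
    Rel a S' (t.subst s) (eval t a ρ) := by
  have const : ∀ {c : Ty} {S : Sig} {t : Tm}, HasType S t c → (∀ n, t.shift n = t) →
      Rel c S t (reflect c fun _ => t) := fun {c S t} ht hc =>
    (rel_reify_reflect c).2 fun E => by
      rw [hc]; have := ht.shift E; rw [hc] at this; exact .refl this
  induction h generalizing S' s ρ with
  | var h =>
    obtain ⟨d, hd, hr⟩ := hs _ _ h
    rwa [eval_var hd]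
  | hastype => exact const .hastype fun _ => rfl
  | top => exact const .top fun _ => rfl
  | imp => exact const .imp fun _ => rfl
  | all => exact const .all fun _ => rfl
  | app h₁ h₂ ih₁ ih₂ =>
    have hM : ρ.Models _ := fun i b hb => by
      obtain ⟨d, hd, _⟩ := hs i b hb
      rw [hd]
    rw [eval_app h₂ hM]
    simpa [Tm.subst] using (ih₁ hs).2 [] _ _ (ih₂ hs)
  | @lam S t a b h ih =>
    have hT : HasType S' ((Tm.lam a t).subst s) (.arr a b) := (HasType.lam h).subst fun i b hb => by
      obtain ⟨d, _, hr⟩ := hs i b hb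
      exact hr.hasType
    refine ⟨hT, fun E u d hd => ?_⟩
    have hr : Rel b (E ++ S') (t.subst fun | 0 => u | i + 1 => (s i).shift E.length)
        (eval t b (Env.cons d ρ)) := by
      refine ih ?_
      rintro (_ | i) c hc
      · obtain rfl := by simpa using hc
        exact ⟨d, rfl, hd⟩
      · obtain ⟨x, hx, hr⟩ := hs i c (by simpa using hc)
        exact ⟨x, hx, hr.shift E⟩
    refine hr.conv ?_
    have hT' := hT.shift E
    cases hT' with
    | lam h' =>
      have := Eqv.beta h' hd.hasType
      refine Eqv.symm ?_
      convert this using 1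
      · rfl
      simp only [Tm.inst, Tm.subst_rename, Tm.subst_subst]
      congr 1
      funext i
      cases i with
      | zero => rfl
      | succ i =>
        simp only [Tm.liftSub, Tm.shift, subst_rename]
        exact rename_eq_subst _ _

theorem HasType.eqv_nf {S : Sig} {t : Tm} {a : Ty} (h : HasType S t a) :
    Eqv S t (nf S a t) a := by
  have : Rel a S (t.subst Tm.var) (eval t a (idEnv S)) := by
    refine h.rel fun i b hb => ?_
    have hS : S.getD i .o = b := by simp [List.getD, hb]
    refine ⟨reflect b (level (S.length - 1 - i)), by subst hS; rfl,
      (rel_reify_reflect b).2 fun E => ?_⟩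
    have hi : i < S.length := (List.getElem?_eq_some_iff.1 hb).1
    have : level (S.length - 1 - i) (E.length + S.length) = Tm.var (i + E.length) := by
      simp only [level]; congr 1; omega
    rw [this]
    exact .refl ((HasType.var hb).shift E)
  rw [Tm.subst_var] at this
  exact (rel_reify_reflect a).1 this

theorem Eqv.of_nf_eq {S : Sig} {s t : Tm} {a : Ty} (hs : HasType S s a) (ht : HasType S t a)
    (h : nf S a s = nf S a t) : Eqv S s t a :=
  hs.eqv_nf.trans (h ▸ ht.eqv_nf.symm)

/-! ### The shapes of formulas are invariant under βη-equality -/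

theorem nf_hastype {S : Sig} {M A : Tm} (hM : HasType S M .lfObj) (hA : HasType S A .lfType) :
    nf S .o (.app (.app .hastype M) A) =
      .app (.app .hastype (nf S .lfObj M)) (nf S .lfType A) := by
  rw [nf, eval_app hA (idEnv_models S), eval_app hM (idEnv_models S)]
  rfl

theorem nf_implies {S : Sig} {D G : Tm} (hD : HasType S D .o) (hG : HasType S G .o) :
    nf S .o (implies D G) = implies (nf S .o D) (nf S .o G) := by
  rw [implies, nf, eval_app hG (idEnv_models S), eval_app hD (idEnv_models S)]
  rfl

theorem nf_lam {S : Sig} {a b : Ty} {t : Tm} :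
    nf S (.arr a b) (.lam a t) = .lam a (nf (a :: S) b t) := by
  rw [nf, nf, idEnv_cons]
  rfl

theorem nf_forAll {S : Sig} {a : Ty} {F : Tm} (hF : HasType (a :: S) F .o) :
    nf S .o (forAll a F) = forAll a (nf (a :: S) .o F) := by
  rw [forAll, forAll, nf, eval_app (.lam hF) (idEnv_models S), ← nf_lam (S := S)]
  rfl

theorem HasType.implies_inv {S : Sig} {D G : Tm} (h : HasType S (implies D G) .o) :
    HasType S D .o ∧ HasType S G .o := by
  cases h with
  | app h₁ h₂ => cases h₁ with
    | app h₁ h₃ => cases h₁; exact ⟨h₃, h₂⟩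

theorem HasType.forAll_inv {S : Sig} {a : Ty} {F : Tm} (h : HasType S (forAll a F) .o) :
    HasType (a :: S) F .o := by
  cases h with
  | app h₁ h₂ => cases h₁; cases h₂; assumption

theorem HasType.hastype_inv {S : Sig} {M A : Tm}
    (h : HasType S (.app (.app .hastype M) A) .o) :
    HasType S M .lfObj ∧ HasType S A .lfType := by
  cases h with
  | app h₁ h₂ => cases h₁ with
    | app h₁ h₃ => cases h₁; exact ⟨h₃, h₂⟩

theorem Eqv.implies_inj {S : Sig} {D D' G G' : Tm}
    (h : Eqv S (implies D G) (implies D' G') .o) : Eqv S D D' .o ∧ Eqv S G G' .o := by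
  obtain ⟨hD, hG⟩ := h.hasType.1.implies_inv
  obtain ⟨hD', hG'⟩ := h.hasType.2.implies_inv
  have := h.nf_eq
  rw [nf_implies hD hG, nf_implies hD' hG'] at this
  simp only [Tm.implies, Tm.app.injEq, true_and] at this
  exact ⟨.of_nf_eq hD hD' this.1, .of_nf_eq hG hG' this.2⟩

theorem Eqv.forAll_inj {S : Sig} {a b : Ty} {F G : Tm}
    (h : Eqv S (forAll a F) (forAll b G) .o) : a = b ∧ Eqv (a :: S) F G .o := by
  have hF := h.hasType.1.forAll_inv
  have hG := h.hasType.2.forAll_inv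
  have := h.nf_eq
  rw [nf_forAll hF, nf_forAll hG] at this
  simp only [Tm.forAll, Tm.app.injEq, Tm.all.injEq, Tm.lam.injEq] at this
  obtain ⟨rfl, -, h⟩ := this
  exact ⟨rfl, .of_nf_eq hF hG h⟩

theorem Eqv.hastype_inj {S : Sig} {M M' A A' : Tm}
    (h : Eqv S (.app (.app .hastype M) A) (.app (.app .hastype M') A') .o) :
    Eqv S M M' .lfObj ∧ Eqv S A A' .lfType := by
  obtain ⟨hD, hG⟩ := h.hasType.1.hastype_inv
  obtain ⟨hD', hG'⟩ := h.hasType.2.hastype_inv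
  have := h.nf_eq
  rw [nf_hastype hD hG, nf_hastype hD' hG'] at this
  simp only [Tm.app.injEq, true_and] at this
  exact ⟨.of_nf_eq hD hD' this.1, .of_nf_eq hG hG' this.2⟩

theorem Tm.IsAtomic.eval {S : Sig} {t : Tm} {a : Ty} (ht : t.IsAtomic) (h : HasType S t a) :
    ∃ u : ℕ → Tm, HH.eval t a (idEnv S) = reflect a u ∧ ∀ n, (u n).IsAtomic := by
  induction h with
  | var h => exact ⟨_, eval_var_idEnv h, fun _ => trivial⟩
  | hastype => exact ⟨_, rfl, fun _ => trivial⟩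
  | app h₁ h₂ ih₁ _ =>
    obtain ⟨u, hu, hn⟩ := ih₁ ht
    rw [eval_app h₂ (idEnv_models _), hu]
    exact ⟨_, rfl, hn⟩
  | _ => exact ht.elim

theorem Tm.IsAtomic.nf {S : Sig} {t : Tm} (ht : t.IsAtomic) (h : HasType S t .o) :
    (nf S .o t).IsAtomic := by
  obtain ⟨u, hu, hn⟩ := ht.eval h
  rw [HH.nf, hu]
  exact hn _

theorem not_eqv_implies_of_isAtomic {S : Sig} {t D G : Tm} (ht : t.IsAtomic) :
    ¬ Eqv S t (implies D G) .o := fun h => by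
  obtain ⟨hD, hG⟩ := h.hasType.2.implies_inv
  have h' := ht.nf h.hasType.1
  rw [h.nf_eq, nf_implies hD hG] at h'
  exact h'

theorem not_eqv_forAll_of_isAtomic {S : Sig} {a : Ty} {t F : Tm} (ht : t.IsAtomic) :
    ¬ Eqv S t (forAll a F) .o := fun h => by
  have h' := ht.nf h.hasType.1
  rw [h.nf_eq, nf_forAll h.hasType.2.forAll_inv] at h'
  exact h'

theorem not_eqv_implies_forAll {S : Sig} {a : Ty} {D G F : Tm} :
    ¬ Eqv S (implies D G) (forAll a F) .o := fun h => by
  obtain ⟨hD, hG⟩ := h.hasType.1.implies_inv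
  have h' := h.nf_eq
  rw [nf_implies hD hG, nf_forAll h.hasType.2.forAll_inv] at h'
  simp [implies, forAll] at h'

theorem nf_top {S : Sig} : nf S .o .top = .top := rfl

theorem not_eqv_top_implies {S : Sig} {D G : Tm} : ¬ Eqv S .top (implies D G) .o := fun h => by
  obtain ⟨hD, hG⟩ := h.hasType.2.implies_inv
  have h' := h.nf_eq
  rw [nf_implies hD hG, nf_top] at h'
  cases h'

theorem not_eqv_top_forAll {S : Sig} {a : Ty} {F : Tm} : ¬ Eqv S .top (forAll a F) .o :=
  fun h => by
    have h' := h.nf_eq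
    rw [nf_forAll h.hasType.2.forAll_inv, nf_top] at h'
    cases h'

theorem not_eqv_top_of_isAtomic {S : Sig} {t : Tm} (ht : t.IsAtomic) : ¬ Eqv S t .top .o :=
  fun h => by
    have h' := ht.nf h.hasType.1
    rw [h.nf_eq, nf_top] at h'
    exact h'

end HH

/-! ### Confluence of β-reduction -/

namespace LF

open Relation

/-- LF expressions with the syntactic categories forgotten, so that type variables and object
variables are no longer distinguished and a substitution acts on both. -/
inductive Raw where
  | typ
  | var (x : ℕ)
  | pi (A B : Raw)
  | lam (A M : Raw)
  | app (M N : Raw)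

namespace Raw

/-- Renaming of the free variables. -/
def rename : (ℕ → ℕ) → Raw → Raw
  | _, typ => typ
  | r, var x => var (r x)
  | r, pi A B => pi (A.rename r) (B.rename (liftRen r))
  | r, lam A M => lam (A.rename r) (M.rename (liftRen r))
  | r, app M N => app (M.rename r) (N.rename r)

/-- A substitution extended under a binder. -/
def liftSub (s : ℕ → Raw) : ℕ → Raw
  | 0 => var 0
  | i + 1 => (s i).rename (· + 1)

/-- Simultaneous capture-avoiding substitution. -/
def subst : (ℕ → Raw) → Raw → Raw
  | _, typ => typ
  | s, var x => s x
  | s, pi A B => pi (A.subst s) (B.subst (liftSub s))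
  | s, lam A M => lam (A.subst s) (M.subst (liftSub s))
  | s, app M N => app (M.subst s) (N.subst s)

/-- The substitution that sends variable `0` to `N` and lowers the others by one. -/
def instSub (N : Raw) : ℕ → Raw
  | 0 => N
  | i + 1 => var i

/-- `P[N/x]`, where `x` is the innermost variable of `P`. -/
def inst (P N : Raw) : Raw := P.subst (instSub N)

theorem rename_rename (t : Raw) (r r' : ℕ → ℕ) :
    (t.rename r).rename r' = t.rename (r' ∘ r) := by
  induction t generalizing r r' <;> simp_all [rename, HH.Tm.liftRen_comp]

theorem liftSub_comp_liftRen (r : ℕ → ℕ) (s : ℕ → Raw) :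
    liftSub s ∘ liftRen r = liftSub (s ∘ r) := by
  funext i; cases i <;> rfl

theorem subst_rename (t : Raw) (r : ℕ → ℕ) (s : ℕ → Raw) :
    (t.rename r).subst s = t.subst (s ∘ r) := by
  induction t generalizing r s <;> simp_all [rename, subst, liftSub_comp_liftRen]

theorem rename_liftSub (s : ℕ → Raw) (r : ℕ → ℕ) :
    (fun i => (liftSub s i).rename (liftRen r)) = liftSub (fun i => (s i).rename r) := by
  funext i; cases i with
  | zero => rfl
  | succ i => simp only [liftSub, rename_rename]; rfl

theorem rename_subst (t : Raw) (s : ℕ → Raw) (r : ℕ → ℕ) :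
    (t.subst s).rename r = t.subst (fun i => (s i).rename r) := by
  induction t generalizing r s <;> simp_all [rename, subst, rename_liftSub]

theorem shift_subst_lift (t : Raw) (s : ℕ → Raw) :
    (t.rename (· + 1)).subst (liftSub s) = (t.subst s).rename (· + 1) := by
  simp only [subst_rename, rename_subst]; rfl

theorem subst_liftSub (s s' : ℕ → Raw) :
    (fun i => (liftSub s i).subst (liftSub s')) = liftSub (fun i => (s i).subst s') := by
  funext i; cases i with
  | zero => rfl
  | succ i => exact shift_subst_lift _ _

theorem subst_subst (t : Raw) (s s' : ℕ → Raw) :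
    (t.subst s).subst s' = t.subst (fun i => (s i).subst s') := by
  induction t generalizing s s' <;> simp_all [subst, subst_liftSub]

@[simp] theorem subst_var (t : Raw) : t.subst var = t := by
  have h : liftSub var = var := by funext i; cases i <;> rfl
  induction t <;> simp_all [subst]

theorem rename_eq_subst (t : Raw) (r : ℕ → ℕ) : t.rename r = t.subst (fun i => var (r i)) := by
  have h : ∀ r : ℕ → ℕ, liftSub (fun i => var (r i)) = fun i => var (liftRen r i) := by
    intro r; funext i; cases i <;> rfl
  induction t generalizing r <;> simp_all [rename, subst]

theorem shift_inst (t u : Raw) : (t.rename (· + 1)).inst u = t := by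
  rw [inst, subst_rename]; exact subst_var t

theorem inst_subst (t u : Raw) (s : ℕ → Raw) :
    (t.inst u).subst s = (t.subst (liftSub s)).inst (u.subst s) := by
  simp only [inst, subst_subst]
  congr 1; funext i; cases i with
  | zero => rfl
  | succ i => exact (shift_inst _ _).symm

theorem inst_rename (t u : Raw) (r : ℕ → ℕ) :
    (t.inst u).rename r = (t.rename (liftRen r)).inst (u.rename r) := by
  simp only [inst, rename_subst, subst_rename]
  congr 1; funext i; cases i <;> rfl

/-- Parallel β-reduction. -/
inductive Par : Raw → Raw → Prop where
  | typ : Par typ typ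
  | var (x : ℕ) : Par (var x) (var x)
  | pi {A A' B B' : Raw} : Par A A' → Par B B' → Par (pi A B) (pi A' B')
  | lam {A A' M M' : Raw} : Par A A' → Par M M' → Par (lam A M) (lam A' M')
  | app {M M' N N' : Raw} : Par M M' → Par N N' → Par (app M N) (app M' N')
  | beta {A M M' N N' : Raw} : Par M M' → Par N N' → Par (app (lam A M) N) (M'.inst N')

theorem Par.refl : (P : Raw) → Par P P
  | .typ => .typ
  | .var x => .var x
  | .pi A B => .pi (.refl A) (.refl B)
  | .lam A M => .lam (.refl A) (.refl M)
  | .app M N => .app (.refl M) (.refl N)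

theorem Par.rename {P Q : Raw} (h : Par P Q) (r : ℕ → ℕ) : Par (P.rename r) (Q.rename r) := by
  induction h generalizing r with
  | typ => exact .typ
  | var x => exact .refl _
  | pi _ _ ih₁ ih₂ => exact .pi (ih₁ _) (ih₂ _)
  | lam _ _ ih₁ ih₂ => exact .lam (ih₁ _) (ih₂ _)
  | app _ _ ih₁ ih₂ => exact .app (ih₁ _) (ih₂ _)
  | beta _ _ ih₁ ih₂ => rw [inst_rename]; exact .beta (ih₁ _) (ih₂ _)

theorem Par.liftSub {s s' : ℕ → Raw} (h : ∀ i, Par (s i) (s' i)) :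
    ∀ i, Par (Raw.liftSub s i) (Raw.liftSub s' i)
  | 0 => .refl _
  | i + 1 => (h i).rename _

theorem Par.subst {P Q : Raw} (h : Par P Q) {s s' : ℕ → Raw} (hs : ∀ i, Par (s i) (s' i)) :
    Par (P.subst s) (Q.subst s') := by
  induction h generalizing s s' with
  | typ => exact .typ
  | var x => exact hs x
  | pi _ _ ih₁ ih₂ => exact .pi (ih₁ hs) (ih₂ (Par.liftSub hs))
  | lam _ _ ih₁ ih₂ => exact .lam (ih₁ hs) (ih₂ (Par.liftSub hs))
  | app _ _ ih₁ ih₂ => exact .app (ih₁ hs) (ih₂ hs)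
  | beta _ _ ih₁ ih₂ => rw [inst_subst]; exact .beta (ih₁ (Par.liftSub hs)) (ih₂ hs)

theorem Par.inst {P Q N N' : Raw} (h : Par P Q) (hN : Par N N') :
    Par (P.inst N) (Q.inst N') :=
  h.subst fun
    | 0 => hN
    | _ + 1 => .refl _

/-- Complete development: contraction of all the β-redexes present. -/
def dev : Raw → Raw
  | typ => typ
  | var x => var x
  | pi A B => pi (dev A) (dev B)
  | lam A M => lam (dev A) (dev M)
  | app (lam _ M) N => (dev M).inst (dev N)
  | app M N => app (dev M) (dev N)

theorem Par.dev {P Q : Raw} (h : Par P Q) : Par Q P.dev := by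
  induction h with
  | typ => exact .typ
  | var x => exact .var x
  | pi _ _ ih₁ ih₂ => exact .pi ih₁ ih₂
  | lam _ _ ih₁ ih₂ => exact .lam ih₁ ih₂
  | @app M M' N N' h _ ih₁ ih₂ =>
    cases M with
    | lam A M =>
      cases h with
      | lam h₁ h₂ => cases ih₁ with
        | lam ih₁ ih₃ => exact .beta ih₃ ih₂
    | _ => exact .app ih₁ ih₂
  | beta _ _ ih₁ ih₂ => exact ih₁.inst ih₂

/-- β-equality, as the existence of a common reduct. -/
def Conv : Raw → Raw → Prop := Join (ReflTransGen Par)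

theorem Conv.equivalence : Equivalence Conv :=
  equivalence_join_reflTransGen fun P _ _ h₁ h₂ =>
    ⟨P.dev, .single h₁.dev, .single h₂.dev⟩

theorem Conv.refl (P : Raw) : Conv P P := Conv.equivalence.refl P

theorem Conv.symm {P Q : Raw} (h : Conv P Q) : Conv Q P := Conv.equivalence.symm h

theorem Conv.trans {P Q R : Raw} (h : Conv P Q) (h' : Conv Q R) : Conv P R :=
  Conv.equivalence.trans h h'

theorem Par.conv {P Q : Raw} (h : Par P Q) : Conv P Q := ⟨Q, .single h, .refl⟩

/-- An operation that preserves parallel reduction in each argument preserves β-equality. -/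
theorem Conv.map₂ {f : Raw → Raw → Raw}
    (hf : ∀ {M M' N N'}, Par M M' → Par N N' → Par (f M N) (f M' N'))
    {M M' N N' : Raw} (h : Conv M M') (h' : Conv N N') : Conv (f M N) (f M' N') := by
  obtain ⟨P, h₁, h₂⟩ := h
  obtain ⟨Q, h₃, h₄⟩ := h'
  have key : ∀ {M P N Q : Raw}, ReflTransGen Par M P → ReflTransGen Par N Q →
      ReflTransGen Par (f M N) (f P Q) := fun {M P N Q} h h' =>
    (h.lift (f · N) fun _ _ h => hf h (.refl N)).trans
      (h'.lift (f P) fun _ _ h => hf (.refl P) h)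
  exact ⟨f P Q, key h₁ h₃, key h₂ h₄⟩

theorem Conv.subst {P Q : Raw} (h : Conv P Q) (s : ℕ → Raw) :
    Conv (P.subst s) (Q.subst s) :=
  h.map₂ (f := fun P _ => P.subst s) (fun h _ => h.subst fun _ => .refl _) (.refl .typ)

theorem Conv.rename {P Q : Raw} (h : Conv P Q) (r : ℕ → ℕ) :
    Conv (P.rename r) (Q.rename r) := by
  simpa only [rename_eq_subst] using h.subst _

theorem Conv.inst {P Q N N' : Raw} (h : Conv P Q) (h' : Conv N N') :
    Conv (P.inst N) (Q.inst N') := h.map₂ Par.inst h'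

theorem Conv.beta (A M N : Raw) : Conv (app (lam A M) N) (M.inst N) :=
  (Par.beta (.refl M) (.refl N)).conv

end Raw

namespace Exp

/-- The underlying raw expression. -/
def raw : {c : Cat} → Exp c → Raw
  | _, typ => .typ
  | _, piK A K => .pi A.raw K.raw
  | _, fvar u => .var u
  | _, piF A B => .pi A.raw B.raw
  | _, lamF A B => .lam A.raw B.raw
  | _, appF A M => .app A.raw M.raw
  | _, var x => .var x
  | _, lam A M => .lam A.raw M.raw
  | _, app M N => .app M.raw N.raw

/-- Within a category, an expression is determined by its raw expression. -/
theorem raw_injective {c : Cat} {P Q : Exp c} (h : P.raw = Q.raw) : P = Q := by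
  induction P <;> cases Q <;> simp_all [raw] <;> grind

theorem raw_rename {c : Cat} (P : Exp c) (r : ℕ → ℕ) : (P.rename r).raw = P.raw.rename r := by
  induction P generalizing r <;> simp_all [raw, rename, Raw.rename]

theorem raw_shift {c : Cat} (P : Exp c) (n : ℕ) : (P.shift n).raw = P.raw.rename (· + n) :=
  P.raw_rename _

theorem shift_shift {c : Cat} (P : Exp c) (m n : ℕ) :
    (P.shift m).shift n = P.shift (m + n) := by
  apply raw_injective
  simp only [raw_shift, Raw.rename_rename]
  congr 1; funext i; simp [add_assoc]

/-- A set of indices extended under the binder of an object variable. -/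
def liftSet (χ : ℕ → Prop) : ℕ → Prop
  | 0 => False
  | i + 1 => χ i

/-- All free type variables belong to `χ`. In particular no type variable refers to the binder
of an object variable; without this, `inst` and renaming need not commute. -/
def Clean : {c : Cat} → (ℕ → Prop) → Exp c → Prop
  | _, _, typ => True
  | _, χ, piK A K => A.Clean χ ∧ K.Clean (liftSet χ)
  | _, χ, fvar u => χ u
  | _, χ, piF A B => A.Clean χ ∧ B.Clean (liftSet χ)
  | _, χ, lamF A B => A.Clean χ ∧ B.Clean (liftSet χ)
  | _, χ, appF A M => A.Clean χ ∧ M.Clean χ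
  | _, _, var _ => True
  | _, χ, lam A M => A.Clean χ ∧ M.Clean (liftSet χ)
  | _, χ, app M N => M.Clean χ ∧ N.Clean χ

theorem Clean.rename {c : Cat} {P : Exp c} {χ χ' : ℕ → Prop} {r : ℕ → ℕ} (h : P.Clean χ)
    (hr : ∀ u, χ u → χ' (r u)) : (P.rename r).Clean χ' := by
  have lift : ∀ {χ χ' : ℕ → Prop} {r : ℕ → ℕ}, (∀ u, χ u → χ' (r u)) →
      ∀ u, liftSet χ u → liftSet χ' (liftRen r u) := by
    rintro χ χ' r hr (_ | u) hu
    · exact hu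
    · exact hr u hu
  induction P generalizing χ χ' r with
  | typ => trivial
  | piK A K ih₁ ih₂ => exact ⟨ih₁ h.1 hr, ih₂ h.2 (lift hr)⟩
  | fvar u => exact hr u h
  | piF A B ih₁ ih₂ => exact ⟨ih₁ h.1 hr, ih₂ h.2 (lift hr)⟩
  | lamF A B ih₁ ih₂ => exact ⟨ih₁ h.1 hr, ih₂ h.2 (lift hr)⟩
  | appF A M ih₁ ih₂ => exact ⟨ih₁ h.1 hr, ih₂ h.2 hr⟩
  | var x => trivial
  | lam A M ih₁ ih₂ => exact ⟨ih₁ h.1 hr, ih₂ h.2 (lift hr)⟩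
  | app M N ih₁ ih₂ => exact ⟨ih₁ h.1 hr, ih₂ h.2 hr⟩

theorem Clean.subst {c : Cat} {P : Exp c} {χ χ' : ℕ → Prop} {s : ℕ → Exp .obj} {r : ℕ → ℕ}
    (h : P.Clean χ) (hr : ∀ u, χ u → χ' (r u)) (hs : ∀ x, (s x).Clean χ') :
    (P.subst s r).Clean χ' := by
  have lift : ∀ {χ χ' : ℕ → Prop} {r : ℕ → ℕ}, (∀ u, χ u → χ' (r u)) →
      ∀ u, liftSet χ u → liftSet χ' (liftRen r u) := by
    rintro χ χ' r hr (_ | u) hu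
    · exact hu
    · exact hr u hu
  have liftS : ∀ {χ' : ℕ → Prop} {s : ℕ → Exp .obj}, (∀ x, (s x).Clean χ') →
      ∀ x, (liftSub s x).Clean (liftSet χ') := by
    rintro χ' s hs (_ | x)
    · trivial
    · exact (hs x).rename fun u hu => hu
  induction P generalizing χ χ' s r with
  | typ => trivial
  | piK A K ih₁ ih₂ => exact ⟨ih₁ h.1 hr hs, ih₂ h.2 (lift hr) (liftS hs)⟩
  | fvar u => exact hr u h
  | piF A B ih₁ ih₂ => exact ⟨ih₁ h.1 hr hs, ih₂ h.2 (lift hr) (liftS hs)⟩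
  | lamF A B ih₁ ih₂ => exact ⟨ih₁ h.1 hr hs, ih₂ h.2 (lift hr) (liftS hs)⟩
  | appF A M ih₁ ih₂ => exact ⟨ih₁ h.1 hr hs, ih₂ h.2 hr hs⟩
  | var x => exact hs x
  | lam A M ih₁ ih₂ => exact ⟨ih₁ h.1 hr hs, ih₂ h.2 (lift hr) (liftS hs)⟩
  | app M N ih₁ ih₂ => exact ⟨ih₁ h.1 hr hs, ih₂ h.2 hr hs⟩

theorem Clean.inst {c : Cat} {P : Exp c} {N : Exp .obj} {χ : ℕ → Prop}
    (h : P.Clean (liftSet χ)) (hN : N.Clean χ) : (P.inst N).Clean χ := by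
  refine h.subst ?_ ?_
  · rintro (_ | u) hu
    · exact hu.elim
    · exact hu
  · rintro (_ | x)
    · exact hN
    · trivial

theorem Clean.raw_subst {c : Cat} {P : Exp c} {χ : ℕ → Prop} {s : ℕ → Exp .obj} {r : ℕ → ℕ}
    {e : ℕ → Raw} (h : P.Clean χ) (hr : ∀ u, χ u → e u = .var (r u))
    (hs : ∀ x, e x = (s x).raw) : (P.subst s r).raw = P.raw.subst e := by
  have lift : ∀ {χ : ℕ → Prop} {r : ℕ → ℕ} {e : ℕ → Raw}, (∀ u, χ u → e u = .var (r u)) →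
      ∀ u, liftSet χ u → Raw.liftSub e u = .var (liftRen r u) := by
    rintro χ r e hr (_ | u) hu
    · exact hu.elim
    · rw [Raw.liftSub, hr u hu]; rfl
  have liftS : ∀ {s : ℕ → Exp .obj} {e : ℕ → Raw}, (∀ x, e x = (s x).raw) →
      ∀ x, Raw.liftSub e x = (liftSub s x).raw := by
    rintro s e hs (_ | x)
    · rfl
    · rw [Raw.liftSub, hs x, liftSub, raw_shift]
  induction P generalizing χ s r e with
  | typ => rfl
  | piK A K ih₁ ih₂ =>
    exact congrArg₂ Raw.pi (ih₁ h.1 hr hs) (ih₂ h.2 (lift hr) (liftS hs))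
  | fvar u => exact (hr u h).symm
  | piF A B ih₁ ih₂ =>
    exact congrArg₂ Raw.pi (ih₁ h.1 hr hs) (ih₂ h.2 (lift hr) (liftS hs))
  | lamF A B ih₁ ih₂ =>
    exact congrArg₂ Raw.lam (ih₁ h.1 hr hs) (ih₂ h.2 (lift hr) (liftS hs))
  | appF A M ih₁ ih₂ => exact congrArg₂ Raw.app (ih₁ h.1 hr hs) (ih₂ h.2 hr hs)
  | var x => exact (hs x).symm
  | lam A M ih₁ ih₂ =>
    exact congrArg₂ Raw.lam (ih₁ h.1 hr hs) (ih₂ h.2 (lift hr) (liftS hs))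
  | app M N ih₁ ih₂ => exact congrArg₂ Raw.app (ih₁ h.1 hr hs) (ih₂ h.2 hr hs)

theorem Clean.raw_inst {c : Cat} {P : Exp c} {χ : ℕ → Prop} (h : P.Clean (liftSet χ))
    (N : Exp .obj) : (P.inst N).raw = P.raw.inst N.raw := by
  refine h.raw_subst ?_ ?_
  · rintro (_ | u) hu
    · exact hu.elim
    · rfl
  · rintro (_ | x) <;> rfl

theorem Step.par {c : Cat} {P Q : Exp c} (h : Step P Q) {χ : ℕ → Prop} (hP : P.Clean χ) :
    P.raw.Par Q.raw ∧ Q.Clean χ := by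
  induction h generalizing χ with
  | betaF A B N =>
    rw [hP.1.2.raw_inst]
    exact ⟨.beta (.refl _) (.refl _), hP.1.2.inst hP.2⟩
  | beta A M N =>
    rw [hP.1.2.raw_inst]
    exact ⟨.beta (.refl _) (.refl _), hP.1.2.inst hP.2⟩
  | piK_left _ ih => exact ⟨.pi (ih hP.1).1 (.refl _), (ih hP.1).2, hP.2⟩
  | piK_right _ ih => exact ⟨.pi (.refl _) (ih hP.2).1, hP.1, (ih hP.2).2⟩
  | piF_left _ ih => exact ⟨.pi (ih hP.1).1 (.refl _), (ih hP.1).2, hP.2⟩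
  | piF_right _ ih => exact ⟨.pi (.refl _) (ih hP.2).1, hP.1, (ih hP.2).2⟩
  | lamF_left _ ih => exact ⟨.lam (ih hP.1).1 (.refl _), (ih hP.1).2, hP.2⟩
  | lamF_right _ ih => exact ⟨.lam (.refl _) (ih hP.2).1, hP.1, (ih hP.2).2⟩
  | appF_left _ ih => exact ⟨.app (ih hP.1).1 (.refl _), (ih hP.1).2, hP.2⟩
  | appF_right _ ih => exact ⟨.app (.refl _) (ih hP.2).1, hP.1, (ih hP.2).2⟩
  | lam_left _ ih => exact ⟨.lam (ih hP.1).1 (.refl _), (ih hP.1).2, hP.2⟩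
  | lam_right _ ih => exact ⟨.lam (.refl _) (ih hP.2).1, hP.1, (ih hP.2).2⟩
  | app_left _ ih => exact ⟨.app (ih hP.1).1 (.refl _), (ih hP.1).2, hP.2⟩
  | app_right _ ih => exact ⟨.app (.refl _) (ih hP.2).1, hP.1, (ih hP.2).2⟩

theorem Clean.conv_of_steps {c : Cat} {P Q : Exp c} {χ : ℕ → Prop} (hP : P.Clean χ)
    (h : ReflTransGen Step P Q) : P.raw.Conv Q.raw := by
  suffices P.raw.Conv Q.raw ∧ Q.Clean χ from this.1
  induction h with
  | refl => exact ⟨.refl _, hP⟩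
  | tail _ h ih => exact ⟨ih.1.trans (h.par ih.2).1.conv, (h.par ih.2).2⟩

theorem Normal.par_eq {c : Cat} {P : Exp c} (h : P.Normal) {R : Raw} (hR : P.raw.Par R) :
    P.raw = R := by
  induction P generalizing R with
  | typ => cases hR; rfl
  | fvar u => cases hR; rfl
  | var x => cases hR; rfl
  | piK A K ih₁ ih₂ =>
    cases hR with
    | pi h₁ h₂ =>
      exact congrArg₂ Raw.pi (ih₁ (fun Q hQ => h _ (.piK_left hQ)) h₁)
        (ih₂ (fun Q hQ => h _ (.piK_right hQ)) h₂)
  | piF A B ih₁ ih₂ =>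
    cases hR with
    | pi h₁ h₂ =>
      exact congrArg₂ Raw.pi (ih₁ (fun Q hQ => h _ (.piF_left hQ)) h₁)
        (ih₂ (fun Q hQ => h _ (.piF_right hQ)) h₂)
  | lamF A B ih₁ ih₂ =>
    cases hR with
    | lam h₁ h₂ =>
      exact congrArg₂ Raw.lam (ih₁ (fun Q hQ => h _ (.lamF_left hQ)) h₁)
        (ih₂ (fun Q hQ => h _ (.lamF_right hQ)) h₂)
  | lam A M ih₁ ih₂ =>
    cases hR with
    | lam h₁ h₂ =>
      exact congrArg₂ Raw.lam (ih₁ (fun Q hQ => h _ (.lam_left hQ)) h₁)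
        (ih₂ (fun Q hQ => h _ (.lam_right hQ)) h₂)
  | appF A M ih₁ ih₂ =>
    generalize hA : A.raw = A' at *
    simp only [raw, hA] at hR ⊢
    cases hR with
    | app h₁ h₂ =>
      exact congrArg₂ Raw.app (ih₁ (fun Q hQ => h _ (.appF_left hQ)) h₁)
        (ih₂ (fun Q hQ => h _ (.appF_right hQ)) h₂)
    | beta h₁ h₂ => cases A <;> cases hA; exact (h _ (.betaF _ _ _)).elim
  | app M N ih₁ ih₂ =>
    generalize hM : M.raw = M' at *
    simp only [raw, hM] at hR ⊢
    cases hR with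
    | app h₁ h₂ =>
      exact congrArg₂ Raw.app (ih₁ (fun Q hQ => h _ (.app_left hQ)) h₁)
        (ih₂ (fun Q hQ => h _ (.app_right hQ)) h₂)
    | beta h₁ h₂ => cases M <;> cases hM; exact (h _ (.beta _ _ _)).elim

theorem Normal.eq_of_conv {c : Cat} {P Q : Exp c} (hP : P.Normal) (hQ : Q.Normal)
    (h : P.raw.Conv Q.raw) : P = Q := by
  have key : ∀ {P : Exp c} {R : Raw}, P.Normal → ReflTransGen Raw.Par P.raw R →
      P.raw = R := fun hP h => by
    induction h with
    | refl => rfl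
    | tail _ h ih => subst ih; exact hP.par_eq h
  obtain ⟨R, h₁, h₂⟩ := h
  exact raw_injective ((key hP h₁).trans (key hQ h₂).symm)

end Exp
end LF

/-! ### Encodings of types as predicates -/

namespace HH

open Tm

/-- The simple type at the end of the spine of arrows. -/
def Ty.target : Ty → Ty
  | .arr _ b => b.target
  | a => a

/-- The number of nodes of a simple type. -/
def Ty.size : Ty → ℕ
  | .arr a b => a.size + b.size + 1
  | _ => 1

/-- The predicate `λM. ∀x. (p x) ⊃ (q (M x))`, where `x` may occur in `q`. -/
def piPred (a b : Ty) (p q : Tm) : Tm :=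
  .lam (.arr a b) (forAll a (implies (.app (p.shift 2) (.var 0))
    (.app (q.rename (LF.liftRen (· + 1))) (.app (.var 1) (.var 0)))))

/-- The body of `piPred`, applied to `M`. -/
def piBody (p q M : Tm) : Tm :=
  implies (.app (p.shift 1) (.var 0)) (.app q (.app (M.shift 1) (.var 0)))

/-- The predicate `λM. hastype M P`. -/
def basePred (P : Tm) : Tm := .lam .lfObj (.app (.app .hastype (.var 0)) (P.shift 1))

section

variable {S : Sig} {a b : Ty} {p p' q q' M P : Tm}

theorem HasType.zero : HasType (a :: S) (.var 0) a := .var (i := 0) rfl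

theorem piPred_rename (r : ℕ → ℕ) :
    (piPred a b p q).rename r = piPred a b (p.rename r) (q.rename (LF.liftRen r)) := by
  simp only [piPred, forAll, implies, Tm.rename, Tm.shift, rename_rename, LF.liftRen, liftRen_comp]
  rfl

theorem piPred_subst (s : ℕ → Tm) :
    (piPred a b p q).subst s = piPred a b (p.subst s) (q.subst (Tm.liftSub s)) := by
  have h₁ : Tm.liftSub (Tm.liftSub s) ∘ (· + 2) = fun i => (s i).rename (· + 2) := by
    funext i
    exact shift_shift (s i) 1 1
  have h₂ : Tm.liftSub (Tm.liftSub s) ∘ LF.liftRen (· + 1) =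
      fun i => (Tm.liftSub s i).rename (LF.liftRen (· + 1)) := by
    funext i
    cases i with
    | zero => rfl
    | succ i => exact (shift_rename_lift (s i) (· + 1)).symm
  simp only [piPred, forAll, implies, Tm.subst, Tm.shift, subst_rename, rename_subst, h₁, h₂]
  rfl

theorem basePred_rename (r : ℕ → ℕ) : (basePred P).rename r = basePred (P.rename r) := by
  simp only [basePred, Tm.rename, shift_rename_lift, LF.liftRen]

theorem basePred_subst (s : ℕ → Tm) : (basePred P).subst s = basePred (P.subst s) := by
  simp only [basePred, Tm.subst, shift_subst_lift, Tm.liftSub]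

theorem piPred_eq : piPred a b p q = .lam (.arr a b)
    (forAll a (piBody (p.shift 1) (q.rename (LF.liftRen (· + 1))) (.var 0))) := by
  simp only [piPred, HH.piBody, shift_shift]; rfl

theorem Eqv.implies {D D' G G' : Tm} (hD : Eqv S D D' .o) (hG : Eqv S G G' .o) :
    Eqv S (implies D G) (implies D' G') .o := .app (.app (.refl .imp) hD) hG

theorem Eqv.forAll {F F' : Tm} (h : Eqv (a :: S) F F' .o) :
    Eqv S (forAll a F) (forAll a F') .o := .app (.refl .all) (.lam h)

theorem Eqv.rename_lift_one (c : Ty) (hq : Eqv (a :: S) q q' b) :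
    Eqv (a :: c :: S) (q.rename (LF.liftRen (· + 1))) (q'.rename (LF.liftRen (· + 1))) b :=
  hq.rename fun i d hd => by cases i <;> simpa [LF.liftRen] using hd

theorem Eqv.piPred (hp : Eqv S p p' (.arr a .o)) (hq : Eqv (a :: S) q q' (.arr b .o)) :
    Eqv S (piPred a b p q) (piPred a b p' q') (.arr (.arr a b) .o) := by
  rw [piPred_eq, piPred_eq]
  refine .lam (.forAll (.implies (.app ((hp.shift_one _).shift_one a) (.refl .zero))
    (.app (hq.rename_lift_one _) (.refl ?_))))
  exact .app (.var (i := 1) rfl) .zero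

theorem Eqv.basePred {P' : Tm} (h : Eqv S P P' .lfType) :
    Eqv S (basePred P) (basePred P') (.arr .lfObj .o) :=
  .lam (.app (.refl (.app .hastype .zero)) (h.shift_one _))

theorem HasType.piPred (hp : HasType S p (.arr a .o)) (hq : HasType (a :: S) q (.arr b .o)) :
    HasType S (piPred a b p q) (.arr (.arr a b) .o) :=
  (Eqv.piPred (.refl hp) (.refl hq)).hasType.1

theorem piBody_subst (s : ℕ → Tm) : (piBody p q M).subst (Tm.liftSub s) =
    piBody (p.subst s) (q.subst (Tm.liftSub s)) (M.subst s) := by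
  simp only [piBody, Tm.implies, Tm.subst, shift_subst_lift]; rfl

theorem piBody_inst (t : Tm) : (piBody p q M).inst t =
    Tm.implies (.app p t) (.app (q.inst t) (.app M t)) := by
  have : (piBody p q M).inst t = Tm.implies (.app ((p.shift 1).inst t) t)
      (.app (q.inst t) (.app ((M.shift 1).inst t) t)) := rfl
  rw [this, shift_inst, shift_inst]

theorem piPred_app_eqv (hp : HasType S p (.arr a .o)) (hq : HasType (a :: S) q (.arr b .o))
    (hM : HasType S M (.arr a b)) :
    Eqv S (.app (piPred a b p q) M) (forAll a (piBody p q M)) .o := by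
  have h := HasType.piPred hp hq
  rw [piPred_eq] at h ⊢
  cases h with
  | lam h =>
    have hq' : (q.rename (LF.liftRen (· + 1))).subst (Tm.liftSub (instSub M)) = q := by
      conv_rhs => rw [← subst_var q]
      rw [subst_rename]
      congr 1; funext i; rcases i with _ | i <;> rfl
    have e := Eqv.beta h hM
    change Eqv S _ (forAll a ((piBody _ _ _).subst (Tm.liftSub (instSub M)))) _ at e
    rw [piBody_subst, hq', ← inst, shift_inst] at e
    exact e

theorem basePred_app_eqv (hP : HasType S P .lfType) (hM : HasType S M .lfObj) :
    Eqv S (.app (basePred P) M) (.app (.app .hastype M) P) .o := by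
  have := Eqv.beta (HasType.app (.app .hastype .zero) (hP.shift_one .lfObj)) hM
  change Eqv _ _ (.app (.app .hastype M) ((P.shift 1).inst M)) _ at this
  rwa [shift_inst] at this

end

end HH

/-! ### Simply typed canonical forms -/

namespace LF

open Relation HH Translation

/-- The roles in which an LF expression can be well formed: as a kind or type, as a canonical
form of a simple type, or as a variable applied to arguments, of a simple type. -/
inductive Mode where
  | wf
  | chk (a : Ty)
  | neu (a : Ty)

/-- Canonical LF expressions with the dependencies of the types forgotten: the signature `S`
records the simple type of each variable, whose target tells object variables from type
variables. Canonical forms are η-long, since a neutral object counts as one only at `lf-obj`. -/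
inductive Simple : {c : Cat} → Sig → Exp c → Mode → Prop where
  | typ {S : Sig} : Simple S Exp.typ .wf
  | piK {S : Sig} {A : Exp .fam} {K : Exp .kind} :
      Simple S A .wf → Simple (phi A :: S) K .wf → Simple S (.piK A K) .wf
  | piF {S : Sig} {A B : Exp .fam} :
      Simple S A .wf → Simple (phi A :: S) B .wf → Simple S (.piF A B) .wf
  | base {S : Sig} {P : Exp .fam} : Simple S P (.neu .lfType) → Simple S P .wf
  | fvar {S : Sig} {u : ℕ} {a : Ty} :
      S[u]? = some a → a.target = .lfType → Simple S (.fvar u) (.neu a)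
  | appF {S : Sig} {A : Exp .fam} {M : Exp .obj} {a b : Ty} :
      Simple S A (.neu (.arr a b)) → Simple S M (.chk a) → Simple S (.appF A M) (.neu b)
  | var {S : Sig} {x : ℕ} {a : Ty} :
      S[x]? = some a → a.target = .lfObj → Simple S (.var x) (.neu a)
  | app {S : Sig} {M N : Exp .obj} {a b : Ty} :
      Simple S M (.neu (.arr a b)) → Simple S N (.chk a) → Simple S (.app M N) (.neu b)
  | lam {S : Sig} {A : Exp .fam} {M : Exp .obj} {b : Ty} :
      Simple S A .wf → Simple (phi A :: S) M (.chk b) →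
      Simple S (.lam A M) (.chk (.arr (phi A) b))
  | atom {S : Sig} {M : Exp .obj} : Simple S M (.neu .lfObj) → Simple S M (.chk .lfObj)

theorem target_phi_fam : (A : Exp .fam) → (phi A).target = .lfObj
  | .piF _ B => target_phi_fam B
  | .fvar _ => rfl
  | .lamF _ _ => rfl
  | .appF _ _ => rfl

theorem target_phi_kind : (K : Exp .kind) → (phi K).target = .lfType
  | .typ => rfl
  | .piK _ K => target_phi_kind K

theorem phi_rename {c : Cat} (P : Exp c) (r : ℕ → ℕ) : phi (P.rename r) = phi P := by
  induction P generalizing r <;> simp_all [Exp.rename, phi]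

theorem phi_shift {c : Cat} (P : Exp c) (n : ℕ) : phi (P.shift n) = phi P := phi_rename P _

theorem encTerm_rename {c : Cat} (P : Exp c) (r : ℕ → ℕ) :
    encTerm (P.rename r) = (encTerm P).rename r := by
  induction P generalizing r <;> simp_all [Exp.rename, encTerm, Tm.rename, phi_rename]

theorem encType_piF (A B : Exp .fam) :
    encType (.piF A B) = piPred (phi A) (phi B) (encType A) (encType B) := rfl

theorem encType_rename : (A : Exp .fam) → (r : ℕ → ℕ) →
    encType (A.rename r) = (encType A).rename r
  | .piF A B, r => by
    rw [Exp.rename, encType_piF, encType_piF, piPred_rename, encType_rename A,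
      encType_rename B, phi_rename, phi_rename]
  | .fvar u, r => (basePred_rename (P := encTerm (.fvar u)) r).symm
  | .lamF A B, r => (basePred_rename (P := encTerm (.lamF A B)) r).symm
  | .appF A M, r => by
    refine Eq.trans ?_ (basePred_rename (P := encTerm (.appF A M)) r).symm
    rw [← encTerm_rename]; rfl

theorem encOf_shift (M : Exp .obj) (A : Exp .fam) (n : ℕ) :
    (encOf M A).shift n = encOf (M.shift n) (A.shift n) := by
  simp only [encOf, Tm.shift, Exp.shift, Tm.rename, encType_rename, encTerm_rename]

namespace Simple

variable {c : Cat} {S S' : Sig} {P P' : Exp c} {m : Mode} {a b : Ty}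

theorem rename {r : ℕ → ℕ} (h : Simple S P m)
    (hr : ∀ i b, S[i]? = some b → S'[r i]? = some b) : Simple S' (P.rename r) m := by
  have lift : ∀ {S S' : Sig} {r : ℕ → ℕ} (A : Exp .fam),
      (∀ i b, S[i]? = some b → S'[r i]? = some b) →
      ∀ i b, (phi A :: S)[i]? = some b → (phi (A.rename r) :: S')[liftRen r i]? = some b := by
    rintro S S' r A hr (_ | i) b hb
    · simpa [phi_rename, liftRen] using hb
    · simpa [liftRen] using hr i b (by simpa using hb)
  induction h generalizing S' r with
  | typ => exact .typ
  | piK _ _ ih₁ ih₂ => exact .piK (ih₁ hr) (ih₂ (lift _ hr))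
  | piF _ _ ih₁ ih₂ => exact .piF (ih₁ hr) (ih₂ (lift _ hr))
  | base _ ih => exact .base (ih hr)
  | fvar h ht => exact .fvar (hr _ _ h) ht
  | appF _ _ ih₁ ih₂ => exact .appF (ih₁ hr) (ih₂ hr)
  | var h ht => exact .var (hr _ _ h) ht
  | app _ _ ih₁ ih₂ => exact .app (ih₁ hr) (ih₂ hr)
  | @lam S A M b _ _ ih₁ ih₂ =>
    have := Simple.lam (ih₁ hr) (ih₂ (lift _ hr))
    rwa [phi_rename] at this
  | atom _ ih => exact .atom (ih hr)

theorem shift_one (b : Ty) (h : Simple S P m) : Simple (b :: S) (P.shift 1) m :=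
  h.rename fun i c hc => by simpa using hc

theorem clean {χ : ℕ → Prop} (h : Simple S P m)
    (hχ : ∀ u b, S[u]? = some b → b.target = .lfType → χ u) : P.Clean χ := by
  have lift : ∀ {S : Sig} {χ : ℕ → Prop} (A : Exp .fam),
      (∀ u b, S[u]? = some b → b.target = .lfType → χ u) →
      ∀ u b, (phi A :: S)[u]? = some b → b.target = .lfType → Exp.liftSet χ u := by
    rintro S χ A hχ (_ | u) b hb ht
    · obtain rfl : phi A = b := by simpa using hb
      rw [target_phi_fam] at ht; cases ht
    · exact hχ u b (by simpa using hb) ht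
  induction h generalizing χ with
  | typ => trivial
  | piK _ _ ih₁ ih₂ => exact ⟨ih₁ hχ, ih₂ (lift _ hχ)⟩
  | piF _ _ ih₁ ih₂ => exact ⟨ih₁ hχ, ih₂ (lift _ hχ)⟩
  | base _ ih => exact ih hχ
  | fvar h ht => exact hχ _ _ h ht
  | appF _ _ ih₁ ih₂ => exact ⟨ih₁ hχ, ih₂ hχ⟩
  | var h ht => trivial
  | app _ _ ih₁ ih₂ => exact ⟨ih₁ hχ, ih₂ hχ⟩
  | lam _ _ ih₁ ih₂ => exact ⟨ih₁ hχ, ih₂ (lift _ hχ)⟩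
  | atom _ ih => exact ih hχ

theorem normal (h : Simple S P m) : P.Normal := by
  induction h with
  | typ => intro Q hQ; cases hQ
  | piK _ _ ih₁ ih₂ =>
    intro Q hQ
    cases hQ with
    | piK_left h => exact ih₁ _ h
    | piK_right h => exact ih₂ _ h
  | piF _ _ ih₁ ih₂ =>
    intro Q hQ
    cases hQ with
    | piF_left h => exact ih₁ _ h
    | piF_right h => exact ih₂ _ h
  | base _ ih => exact ih
  | fvar h ht => intro Q hQ; cases hQ
  | appF h _ ih₁ ih₂ =>
    intro Q hQ
    cases hQ with
    | betaF => cases h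
    | appF_left h => exact ih₁ _ h
    | appF_right h => exact ih₂ _ h
  | var h ht => intro Q hQ; cases hQ
  | app h _ ih₁ ih₂ =>
    intro Q hQ
    cases hQ with
    | beta => cases h
    | app_left h => exact ih₁ _ h
    | app_right h => exact ih₂ _ h
  | lam _ _ ih₁ ih₂ =>
    intro Q hQ
    cases hQ with
    | lam_left h => exact ih₁ _ h
    | lam_right h => exact ih₂ _ h
  | atom _ ih => exact ih

/-- The encodings of canonical forms have the simple types that they are assigned. -/
theorem hasType_mode (h : Simple S P m) : match m with
    | .wf => True
    | .chk a => HasType S (encTerm P) a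
    | .neu a => HasType S (encTerm P) a := by
  induction h with
  | typ | piK | piF | base => trivial
  | fvar h _ | var h _ => exact .var h
  | appF _ _ ih₁ ih₂ | app _ _ ih₁ ih₂ => exact .app ih₁ ih₂
  | lam _ _ _ ih => exact .lam ih
  | atom _ ih => exact ih

theorem hasType_chk (h : Simple S P (.chk a)) : HasType S (encTerm P) a := h.hasType_mode

theorem hasType_neu (h : Simple S P (.neu a)) : HasType S (encTerm P) a := h.hasType_mode

/-- A neutral type is not a `Π`-type. -/
theorem encType_base {P : Exp .fam} (h : Simple S P (.neu a)) :
    encType P = basePred (encTerm P) ∧ phi P = .lfObj := by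
  cases h <;> exact ⟨rfl, rfl⟩

theorem hasType_encType {S : Sig} {A : Exp .fam} (h : Simple S A .wf) :
    HasType S (encType A) (.arr (phi A) .o) := by
  match A, h with
  | .piF A B, .piF hA hB => exact .piPred (hasType_encType hA) (hasType_encType hB)
  | A, .base h =>
    rw [h.encType_base.1, h.encType_base.2]
    exact (Eqv.basePred (.refl h.hasType_neu)).hasType.1

end Simple

/-! ### Hereditary substitution -/

namespace Exp

variable {A A' : Exp .fam} {M M' N N' : Exp .obj}

theorem steps_piK {K K' : Exp .kind} (h : ReflTransGen Step A A')
    (h' : ReflTransGen Step K K') : ReflTransGen Step (piK A K) (piK A' K') :=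
  (h.lift (piK · K) fun _ _ => .piK_left).trans (h'.lift (piK A') fun _ _ => .piK_right)

theorem steps_piF {B B' : Exp .fam} (h : ReflTransGen Step A A')
    (h' : ReflTransGen Step B B') : ReflTransGen Step (piF A B) (piF A' B') :=
  (h.lift (piF · B) fun _ _ => .piF_left).trans (h'.lift (piF A') fun _ _ => .piF_right)

theorem steps_appF (h : ReflTransGen Step A A')
    (h' : ReflTransGen Step M M') : ReflTransGen Step (appF A M) (appF A' M') :=
  (h.lift (appF · M) fun _ _ => .appF_left).trans (h'.lift (appF A') fun _ _ => .appF_right)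

theorem steps_lam (h : ReflTransGen Step A A')
    (h' : ReflTransGen Step M M') : ReflTransGen Step (lam A M) (lam A' M') :=
  (h.lift (lam · M) fun _ _ => .lam_left).trans (h'.lift (lam A') fun _ _ => .lam_right)

theorem steps_app (h : ReflTransGen Step M M')
    (h' : ReflTransGen Step N N') : ReflTransGen Step (app M N) (app M' N') :=
  (h.lift (app · N) fun _ _ => .app_left).trans (h'.lift (app M') fun _ _ => .app_right)

theorem Normal.eq_of_steps {c : Cat} {P Q : Exp c} (h : P.Normal)
    (hs : ReflTransGen Step P Q) : P = Q :=
  hs.cases_head.elim id fun ⟨_, h', _⟩ => (h _ h').elim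

theorem Normal.nf_self {c : Cat} {P : Exp c} (h : P.Normal) : NF P P := ⟨.refl, h⟩

theorem Normal.eq_of_nf {c : Cat} {P Q : Exp c} (h : P.Normal) (hs : NF P Q) : Q = P :=
  (h.eq_of_steps hs.1).symm

end Exp

/-- A substitution from `S` to `S'` in its three forms: objects `s` and indices `r` for the
variables of LF expressions, `e` for the constants of their encodings, and `q` for the
variables of raw expressions. Each object variable becomes a variable or else a canonical form
of a simple type of size at most `n`. -/
structure SimpleSub (n : ℕ) (S' S : Sig) (s : ℕ → Exp .obj) (r : ℕ → ℕ) (e : ℕ → Tm)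
    (q : ℕ → Raw) : Prop where
  obj : ∀ x a, S[x]? = some a → a.target = .lfObj →
    ((∃ y, s x = .var y ∧ S'[y]? = some a) ∨ (Simple S' (s x) (.chk a) ∧ a.size ≤ n)) ∧
      e x = encTerm (s x) ∧ q x = (s x).raw
  fam : ∀ u a, S[u]? = some a → a.target = .lfType →
    S'[r u]? = some a ∧ e u = .var (r u) ∧ q u = .var (r u)

theorem encTerm_shift {c : Cat} (P : Exp c) (n : ℕ) : encTerm (P.shift n) = (encTerm P).shift n :=
  encTerm_rename _ _

namespace SimpleSub

variable {n : ℕ} {S S' : Sig} {s : ℕ → Exp .obj} {r : ℕ → ℕ} {e : ℕ → Tm} {q : ℕ → Raw}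

theorem lift {a : Ty} (ha : a.target = .lfObj) (h : SimpleSub n S' S s r e q) :
    SimpleSub n (a :: S') (a :: S) (Exp.liftSub s) (liftRen r) (Tm.liftSub e)
      (Raw.liftSub q) where
  obj := by
    rintro (_ | x) b hb ht
    · exact ⟨.inl ⟨0, rfl, hb⟩, rfl, rfl⟩
    · obtain ⟨h₁, h₂, h₃⟩ := h.obj x b (by simpa using hb) ht
      refine ⟨?_, ?_, ?_⟩
      · rcases h₁ with ⟨y, hy, hS⟩ | ⟨h₁, hn⟩
        · refine .inl ⟨y + 1, ?_, by simpa using hS⟩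
          rw [Exp.liftSub, hy]; rfl
        · exact .inr ⟨h₁.shift_one _, hn⟩
      · rw [Tm.liftSub, Exp.liftSub, h₂, encTerm_shift]
      · rw [Raw.liftSub, Exp.liftSub, h₃, Exp.raw_shift]
  fam := by
    rintro (_ | u) b hb ht
    · obtain rfl : a = b := by simpa using hb
      rw [ha] at ht; cases ht
    · obtain ⟨h₁, h₂, h₃⟩ := h.fam u b (by simpa using hb) ht
      refine ⟨by simpa [liftRen] using h₁, ?_, ?_⟩
      · rw [Tm.liftSub, h₂]; rfl
      · rw [Raw.liftSub, h₃]; rfl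

theorem inst {a : Ty} {N : Exp .obj} (ha : a.target = .lfObj) (h : Simple S N (.chk a)) :
    SimpleSub a.size S (a :: S) (Exp.instSub N) (· - 1) (Tm.instSub (encTerm N))
      (Raw.instSub N.raw) where
  obj := by
    rintro (_ | x) b hb ht
    · obtain rfl : a = b := by simpa using hb
      exact ⟨.inr ⟨h, le_rfl⟩, rfl, rfl⟩
    · exact ⟨.inl ⟨x, rfl, by simpa using hb⟩, rfl, rfl⟩
  fam := by
    rintro (_ | u) b hb ht
    · obtain rfl : a = b := by simpa using hb
      rw [ha] at ht; cases ht
    · exact ⟨by simpa using hb, rfl, rfl⟩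

theorem hasType_enc (h : SimpleSub n S' S s r e q) {i : ℕ} {a : Ty} (hi : S[i]? = some a)
    (ha : a.target = .lfObj ∨ a.target = .lfType) : HasType S' (e i) a := by
  rcases ha with ha | ha
  · obtain ⟨h₁, h₂, -⟩ := h.obj i a hi ha
    rw [h₂]
    rcases h₁ with ⟨y, hy, hS⟩ | ⟨h₁, -⟩
    · rw [hy]; exact .var hS
    · exact h₁.hasType_chk
  · obtain ⟨h₁, h₂, -⟩ := h.fam i a hi ha
    rw [h₂]; exact .var h₁

end SimpleSub

/-- What substitution makes of an expression `P` in the role `m`: its normal form `P'` has the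
same role, except that a neutral object may become a canonical form whose simple type has size
at most `n`; and the encoding of `P'` is that of `P` after substitution. -/
def Result (n : ℕ) (S' : Sig) (e : ℕ → Tm) : {c : Cat} → Exp c → Exp c → Mode → Prop
  | .fam, P, P', .wf => Simple S' P' .wf ∧ phi P' = phi P ∧
      Eqv S' ((encType P).subst e) (encType P') (.arr (phi P) .o)
  | _, P, P', .wf => Simple S' P' .wf ∧ phi P' = phi P
  | _, P, P', .chk a => Simple S' P' (.chk a) ∧ Eqv S' ((encTerm P).subst e) (encTerm P') a
  | _, P, P', .neu a => (Simple S' P' (.neu a) ∨ (Simple S' P' (.chk a) ∧ a.size ≤ n)) ∧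
      Eqv S' ((encTerm P).subst e) (encTerm P') a

/-- Hereditary substitution: by induction on the bound `n` and on `P`. A redex arises only
where a variable is replaced by an abstraction; its contraction substitutes at a smaller simple
type. -/
theorem Simple.exists_subst (n : ℕ) {c : Cat} {S : Sig} {P : Exp c} {m : Mode}
    (h : Simple S P m) : ∀ {S' : Sig} {s : ℕ → Exp .obj} {r : ℕ → ℕ} {e : ℕ → Tm} {q : ℕ → Raw},
    SimpleSub n S' S s r e q → ∃ P' : Exp c, ReflTransGen Exp.Step (P.subst s r) P' ∧
      P'.raw.Conv (P.raw.subst q) ∧ Result n S' e P P' m := by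
  induction n using Nat.strong_induction_on generalizing c S P m with | _ n ihn => ?_
  induction h with
  | typ => exact fun _ => ⟨.typ, .refl, .refl _, .typ, rfl⟩
  | @piK S A K hA hK ihA ihK =>
    intro S' s r e q h
    obtain ⟨A', sA, cA, rA, pA, -⟩ := ihA h
    obtain ⟨K', sK, cK, rK, pK⟩ := ihK (h.lift (target_phi_fam A))
    refine ⟨.piK A' K', Exp.steps_piK sA sK, cA.map₂ .pi cK, .piK rA (pA ▸ rK), ?_⟩
    simp only [phi, pA, pK]
  | @piF S A B hA hB ihA ihB =>
    intro S' s r e q h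
    obtain ⟨A', sA, cA, rA, pA, eA⟩ := ihA h
    obtain ⟨B', sB, cB, rB, pB, eB⟩ := ihB (h.lift (target_phi_fam A))
    refine ⟨.piF A' B', Exp.steps_piF sA sB, cA.map₂ .pi cB, .piF rA (pA ▸ rB), ?_, ?_⟩
    · simp only [phi, pA, pB]
    · rw [encType_piF, encType_piF, piPred_subst, pA, pB]
      exact eA.piPred eB
  | @base S P hP ih =>
    intro S' s r e q h
    obtain ⟨P', sP, cP, rP | ⟨rP, -⟩, eP⟩ := ih h
    · refine ⟨P', sP, cP, .base rP, ?_, ?_⟩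
      · rw [hP.encType_base.2, rP.encType_base.2]
      · rw [hP.encType_base.1, hP.encType_base.2, rP.encType_base.1, basePred_subst]
        exact eP.basePred
    · cases rP
  | @fvar S u a hu ha =>
    intro S' s r e q h
    obtain ⟨h₁, h₂, h₃⟩ := h.fam u a hu ha
    refine ⟨.fvar (r u), .refl, ?_, .inl (.fvar h₁ ha), ?_⟩
    · simp only [Exp.raw, Raw.subst, h₃]; exact .refl _
    · simp only [encTerm, Tm.subst, h₂]; exact .refl (.var h₁)
  | @appF S P M a b hP hM ihP ihM =>
    intro S' s r e q h
    obtain ⟨P', sP, cP, rP | ⟨rP, -⟩, eP⟩ := ihP h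
    · obtain ⟨M', sM, cM, rM, eM⟩ := ihM h
      exact ⟨.appF P' M', Exp.steps_appF sP sM, cP.map₂ .app cM, .inl (.appF rP rM),
        eP.app eM⟩
    · cases rP
  | @var S x a hx ha =>
    intro S' s r e q h
    obtain ⟨h₁, h₂, h₃⟩ := h.obj x a hx ha
    refine ⟨s x, .refl, ?_, ?_, ?_⟩
    · simp only [Exp.raw, Raw.subst, h₃]; exact .refl _
    · rcases h₁ with ⟨y, hy, hS⟩ | h₁
      · rw [hy]; exact .inl (.var hS ha)
      · exact .inr h₁
    · have := h.hasType_enc hx (.inl ha)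
      rw [h₂] at this
      simp only [encTerm, Tm.subst, h₂]; exact .refl this
  | @app S R N a b hR hN ihR ihN =>
    intro S' s r e q h
    obtain ⟨R', sR, cR, rR, eR⟩ := ihR h
    obtain ⟨N', sN, cN, rN, eN⟩ := ihN h
    have key : Raw.Conv (Raw.app R'.raw N'.raw) ((Exp.app R N).raw.subst q) := cR.map₂ .app cN
    -- The head of `R` stays a variable, or `R` becomes an abstraction of bounded simple type.
    rcases rR with rR | ⟨rR, hn⟩
    · exact ⟨.app R' N', Exp.steps_app sR sN, key, .inl (.app rR rN), eR.app eN⟩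
    · cases rR with
      | @lam _ A M _ hA hM =>
        simp only [Ty.size] at hn
        obtain ⟨P', sP, cP, rP, eP⟩ := ihn (phi A).size (by omega) hM
          (SimpleSub.inst (target_phi_fam A) rN)
        refine ⟨P', ?_, ?_, .inr ⟨rP, by omega⟩, ?_⟩
        · exact ((Exp.steps_app sR sN).tail (.beta A M N')).trans sP
        · exact cP.trans ((Raw.Conv.beta _ _ _).symm.trans key)
        · exact (eR.app eN).trans ((Eqv.beta hM.hasType_chk rN.hasType_chk).trans eP)
  | @lam S A M b hA hM ihA ihM =>
    intro S' s r e q h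
    obtain ⟨A', sA, cA, rA, pA, -⟩ := ihA h
    obtain ⟨M', sM, cM, rM, eM⟩ := ihM (h.lift (target_phi_fam A))
    have := Simple.lam rA (pA ▸ rM)
    rw [pA] at this
    refine ⟨.lam A' M', Exp.steps_lam sA sM, cA.map₂ .lam cM, this, ?_⟩
    simp only [encTerm, pA]
    exact .lam eM
  | @atom S M hM ih =>
    intro S' s r e q h
    obtain ⟨M', sM, cM, rM, eM⟩ := ih h
    exact ⟨M', sM, cM, rM.elim .atom And.left, eM⟩

/-- No free type variable of a canonical form is an object variable of `S`. -/
theorem Simple.clean_target {c : Cat} {S : Sig} {P : Exp c} {m : Mode} (h : Simple S P m) :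
    P.Clean fun u => ∃ a, S[u]? = some a ∧ a.target = .lfType :=
  h.clean fun _ a hu ha => ⟨a, hu, ha⟩

theorem Simple.conv_inst_of_steps {c : Cat} {S : Sig} {P P' : Exp c} {N : Exp .obj} {m m' : Mode}
    {a : Ty} (h : Simple (a :: S) P m) (ha : a.target = .lfObj) (hN : Simple S N m')
    (hs : ReflTransGen Exp.Step (P.inst N) P') : P'.raw.Conv (P.raw.inst N.raw) := by
  have hP : P.Clean (Exp.liftSet fun u => ∃ a, S[u]? = some a ∧ a.target = .lfType) := by
    refine h.clean ?_
    rintro (_ | u) b hb ht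
    · obtain rfl : a = b := by simpa using hb
      rw [ha] at ht; cases ht
    · exact ⟨b, by simpa using hb, ht⟩
  rw [← hP.raw_inst]
  exact ((hP.inst hN.clean_target).conv_of_steps hs).symm

/-- The normal form of `P[N/x]` exists, is unique and is canonical. -/
theorem Simple.exists_inst {c : Cat} {S : Sig} {P : Exp c} {N : Exp .obj} {a : Ty}
    (h : Simple (a :: S) P .wf) (ha : a.target = .lfObj) (hN : Simple S N (.chk a)) :
    ∃ P' : Exp c, Exp.NF (P.inst N) P' ∧ (∀ Q, Exp.NF (P.inst N) Q → Q = P') ∧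
      P'.raw.Conv (P.raw.inst N.raw) ∧
      Result a.size S (Tm.instSub (encTerm N)) P P' .wf := by
  obtain ⟨P', sP, cP, rP⟩ := h.exists_subst a.size (SimpleSub.inst ha hN)
  have hP' : P'.Normal := by
    cases c with
    | kind => exact rP.1.normal
    | fam => exact rP.1.normal
    | obj => cases h
  exact ⟨P', ⟨sP, hP'⟩, fun Q hQ => hQ.2.eq_of_conv hP'
    ((h.conv_inst_of_steps ha hN hQ.1).trans cP.symm), cP, rP⟩

end LF

/-! ### Canonical derivations are simply typed -/

namespace LF

open Relation HH Translation

/-- Every assignment of the context is canonical in the simply typed sense. -/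
def SimpleCtx : Ctx → Prop
  | [] => True
  | .kd K :: Γ => Simple (sigOf Γ) K .wf ∧ SimpleCtx Γ
  | .ty A :: Γ => Simple (sigOf Γ) A .wf ∧ SimpleCtx Γ

theorem sigOf_of_ty {Γ : Ctx} {x : ℕ} {A : Exp .fam} (h : Γ[x]? = some (.ty A)) :
    (sigOf Γ)[x]? = some (phi A) := by
  induction Γ generalizing x with
  | nil => simp at h
  | cons D Γ ih =>
    cases x with
    | zero => obtain rfl : D = .ty A := by simpa using h
              rfl
    | succ x => cases D <;> exact ih (by simpa using h)

theorem sigOf_of_kd {Γ : Ctx} {u : ℕ} {K : Exp .kind} (h : Γ[u]? = some (.kd K)) :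
    (sigOf Γ)[u]? = some (phi K) := by
  induction Γ generalizing u with
  | nil => simp at h
  | cons D Γ ih =>
    cases u with
    | zero => obtain rfl : D = .kd K := by simpa using h
              rfl
    | succ x => cases D <;> exact ih (by simpa using h)

theorem exists_decl_of_sigOf {Γ : Ctx} {x : ℕ} {a : Ty} (h : (sigOf Γ)[x]? = some a) :
    (∃ A, Γ[x]? = some (.ty A) ∧ phi A = a) ∨ ∃ K, Γ[x]? = some (.kd K) ∧ phi K = a := by
  induction Γ generalizing x with
  | nil => simp [sigOf] at h
  | cons D Γ ih =>
    cases x with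
    | zero =>
      cases D with
      | kd K => exact .inr ⟨K, rfl, by simpa [sigOf] using h⟩
      | ty A => exact .inl ⟨A, rfl, by simpa [sigOf] using h⟩
    | succ x => cases D <;> exact ih (by simpa [sigOf] using h)

theorem exists_ty_of_sigOf {Γ : Ctx} {x : ℕ} {a : Ty} (h : (sigOf Γ)[x]? = some a)
    (ha : a.target = .lfObj) : ∃ A, Γ[x]? = some (.ty A) ∧ phi A = a := by
  rcases exists_decl_of_sigOf h with h | ⟨K, -, rfl⟩
  · exact h
  · rw [target_phi_kind] at ha; cases ha

theorem exists_kd_of_sigOf {Γ : Ctx} {x : ℕ} {a : Ty} (h : (sigOf Γ)[x]? = some a)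
    (ha : a.target = .lfType) : ∃ K, Γ[x]? = some (.kd K) ∧ phi K = a := by
  rcases exists_decl_of_sigOf h with ⟨A, -, rfl⟩ | h
  · rw [target_phi_fam] at ha; cases ha
  · exact h

theorem SimpleCtx.tail {D : Decl} {Γ : Ctx} (h : SimpleCtx (D :: Γ)) : SimpleCtx Γ := by
  cases D <;> exact h.2

theorem sigOf_cons (D : Decl) (Γ : Ctx) : ∃ a, sigOf (D :: Γ) = a :: sigOf Γ := by
  cases D <;> exact ⟨_, rfl⟩

theorem Simple.shift_cons {c : Cat} {Γ : Ctx} {P : Exp c} {m : Mode} (D : Decl)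
    (h : Simple (sigOf Γ) P m) : Simple (sigOf (D :: Γ)) (P.shift 1) m := by
  obtain ⟨a, ha⟩ := sigOf_cons D Γ
  rw [ha]; exact h.shift_one a

theorem SimpleCtx.ty {Γ : Ctx} (h : SimpleCtx Γ) {x : ℕ} {A : Exp .fam}
    (hx : Γ[x]? = some (.ty A)) : Simple (sigOf Γ) (A.shift (x + 1)) .wf ∧ A.Normal := by
  induction Γ generalizing x with
  | nil => simp at hx
  | cons D Γ ih =>
    cases x with
    | zero =>
      obtain rfl : D = .ty A := by simpa using hx
      exact ⟨h.1.shift_one _, h.1.normal⟩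
    | succ x =>
      have := ih h.tail (by simpa using hx)
      rw [← Exp.shift_shift A (x + 1) 1]
      exact ⟨this.1.shift_cons D, this.2⟩

theorem SimpleCtx.kd {Γ : Ctx} (h : SimpleCtx Γ) {x : ℕ} {K : Exp .kind}
    (hx : Γ[x]? = some (.kd K)) : Simple (sigOf Γ) (K.shift (x + 1)) .wf ∧ K.Normal := by
  induction Γ generalizing x with
  | nil => simp at hx
  | cons D Γ ih =>
    cases x with
    | zero =>
      obtain rfl : D = .kd K := by simpa using hx
      exact ⟨h.1.shift_one _, h.1.normal⟩
    | succ x =>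
      have := ih h.tail (by simpa using hx)
      rw [← Exp.shift_shift K (x + 1) 1]
      exact ⟨this.1.shift_cons D, this.2⟩

/-- The number of arguments that a simple type takes. -/
def arity : Ty → ℕ
  | .arr _ b => arity b + 1
  | _ => 0

theorem arity_phi {c : Cat} (P : Exp c) : arity (phi P) = P.piLength := by
  induction P <;> simp_all [phi, arity, Exp.piLength]

theorem phi_eq_lfObj : {A : Exp .fam} → A.piLength = 0 → phi A = .lfObj
  | .fvar _, _ => rfl
  | .lamF _ _, _ => rfl
  | .appF _ _, _ => rfl

/-- In a derivation of a canonical expression, the expression and its kind or type are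
canonical in the simply typed sense. -/
theorem Derives.simple {Γ : Ctx} {J : Assertion} (h : Derives Γ J) (hΓ : SimpleCtx Γ) :
    match J with
    | .ctx => True
    | .kind K => K.Normal → FullyApplied Γ 0 K → Simple (sigOf Γ) K .wf
    | .fam A K => A.Normal → ∀ k, FullyApplied Γ k A → (∃ B C, A = .lamF B C) ∨
        (Simple (sigOf Γ) K .wf ∧ ((K.piLength = k ∧ Simple (sigOf Γ) A (.neu (phi K))) ∨
          (K = .typ ∧ Simple (sigOf Γ) A .wf)))
    | .obj M A => M.Normal → ∀ k, FullyApplied Γ k M → Simple (sigOf Γ) A .wf ∧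
        ((A.piLength = k ∧ Simple (sigOf Γ) M (.neu (phi A))) ∨
          ((∃ B N, M = .lam B N) ∧ Simple (sigOf Γ) M (.chk (phi A)))) := by
  have famTyp : ∀ {Γ : Ctx} {A : Exp .fam}, Derives Γ (.fam A .typ) →
      ((∃ B C, A = .lamF B C) ∨ (Simple (sigOf Γ) Exp.typ .wf ∧
        ((Exp.typ.piLength = 0 ∧ Simple (sigOf Γ) A (.neu (phi Exp.typ))) ∨
          (Exp.typ = .typ ∧ Simple (sigOf Γ) A .wf)))) → Simple (sigOf Γ) A .wf := by
    rintro Γ A hA (⟨B, C, rfl⟩ | ⟨-, ⟨-, h⟩ | ⟨-, h⟩⟩)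
    · cases hA
    · exact .base h
    · exact h
  have objChk : ∀ {Γ : Ctx} {A : Exp .fam} {M : Exp .obj}, (Simple (sigOf Γ) A .wf ∧
        ((A.piLength = 0 ∧ Simple (sigOf Γ) M (.neu (phi A))) ∨
          ((∃ B N, M = .lam B N) ∧ Simple (sigOf Γ) M (.chk (phi A))))) →
      Simple (sigOf Γ) M (.chk (phi A)) := by
    rintro Γ A M ⟨-, ⟨h₁, h₂⟩ | ⟨-, h⟩⟩
    · rw [phi_eq_lfObj h₁] at h₂ ⊢; exact .atom h₂
    · exact h
  induction h with
  | nullCtx | kindCtx | typeCtx => trivial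
  | typeKind => exact fun _ _ => .typ
  | piKind hA hK ihA ihK =>
    intro hn hf
    have := famTyp hA (ihA hΓ (fun Q hQ => hn _ (.piK_left hQ)) 0 hf.1)
    exact .piK this (ihK ⟨this, hΓ⟩ (fun Q hQ => hn _ (.piK_right hQ)) hf.2)
  | @varFam Γ u K K' _ hu hK _ =>
    intro hn k hf
    obtain ⟨K₁, K₂, h₁, h₂, h₃⟩ := hf
    obtain rfl : K = K₁ := by simpa [hu] using h₁
    obtain ⟨hs, hK'⟩ := hΓ.kd hu
    obtain rfl := hs.normal.eq_of_nf hK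
    obtain rfl := hK'.eq_of_nf h₂
    refine .inr ⟨hs, .inl ⟨?_, ?_⟩⟩
    · rw [← h₃, ← arity_phi, ← arity_phi, phi_shift]
    · rw [phi_shift]; exact .fvar (sigOf_of_kd hu) (target_phi_kind _)
  | @varObj Γ x A A' _ hx hA _ =>
    intro hn k hf
    obtain ⟨A₁, A₂, h₁, h₂, h₃⟩ := hf
    obtain rfl : A = A₁ := by simpa [hx] using h₁
    obtain ⟨hs, hA'⟩ := hΓ.ty hx
    obtain rfl := hs.normal.eq_of_nf hA
    obtain rfl := hA'.eq_of_nf h₂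
    refine ⟨hs, .inl ⟨?_, ?_⟩⟩
    · rw [← h₃, ← arity_phi, ← arity_phi, phi_shift]
    · rw [phi_shift]; exact .var (sigOf_of_ty hx) (target_phi_fam _)
  | piFam hA hB ihA ihB =>
    intro hn k hf
    have := famTyp hA (ihA hΓ (fun Q hQ => hn _ (.piF_left hQ)) 0 hf.1)
    exact .inr ⟨.typ, .inr ⟨rfl, .piF this
      (famTyp hB (ihB ⟨this, hΓ⟩ (fun Q hQ => hn _ (.piF_right hQ)) 0 hf.2))⟩⟩
  | absFam => exact fun _ _ _ => .inl ⟨_, _, rfl⟩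
  | @appFam Γ A B K K' M hA hM hK ihA ihM =>
    intro hn k hf
    have sM := ihM hΓ (fun Q hQ => hn _ (.appF_right hQ)) 0 hf.2
    rcases ihA hΓ (fun Q hQ => hn _ (.appF_left hQ)) (k + 1) hf.1 with
      ⟨B, C, rfl⟩ | ⟨hs, ⟨hl, hA⟩ | ⟨h, -⟩⟩
    · exact (hn _ (.betaF _ _ _)).elim
    · cases hs with
      | piK hB hs =>
        obtain ⟨K₁, -, hu, -, hK₁, hp⟩ := hs.exists_inst (target_phi_fam B) (objChk sM)
        obtain rfl := hu _ hK
        refine .inr ⟨hK₁, .inl ⟨?_, ?_⟩⟩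
        · rw [← arity_phi, hp, arity_phi]; simpa [Exp.piLength] using hl
        · rw [hp]; exact .appF hA (objChk sM)
    · cases h
  | @absObj Γ A A' B M hA hM hA' ihA ihM =>
    intro hn k hf
    have sA := famTyp hA (ihA hΓ (fun Q hQ => hn _ (.lam_left hQ)) 0 hf.1)
    have sM := ihM ⟨sA, hΓ⟩ (fun Q hQ => hn _ (.lam_right hQ)) 0 hf.2
    obtain rfl := sA.normal.eq_of_nf hA'
    exact ⟨.piF sA sM.1, .inr ⟨⟨_, _, rfl⟩, .lam sA (objChk sM)⟩⟩
  | @appObj Γ A B B' M N hM hN hB ihM ihN =>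
    intro hn k hf
    have sN := ihN hΓ (fun Q hQ => hn _ (.app_right hQ)) 0 hf.2
    obtain ⟨hs, ⟨hl, hM⟩ | ⟨⟨C, P, rfl⟩, -⟩⟩ :=
      ihM hΓ (fun Q hQ => hn _ (.app_left hQ)) (k + 1) hf.1
    · cases hs with
      | base h => cases h
      | piF hA hs =>
        obtain ⟨B₁, -, hu, -, hB₁, hp, -⟩ := hs.exists_inst (target_phi_fam A) (objChk sN)
        obtain rfl := hu _ hB
        refine ⟨hB₁, .inl ⟨?_, ?_⟩⟩
        · rw [← arity_phi, hp, arity_phi]; simpa [Exp.piLength] using hl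
        · rw [hp]; exact .app hM (objChk sN)
    · exact (hn _ (.beta _ _ _)).elim

theorem Derives.simple_fam {Γ : Ctx} {A : Exp .fam} (h : Derives Γ (.fam A .typ))
    (hΓ : SimpleCtx Γ) (hA : Canonical Γ A) : Simple (sigOf Γ) A .wf := by
  rcases h.simple hΓ hA.1 0 hA.2 with ⟨B, C, rfl⟩ | ⟨-, ⟨-, h⟩ | ⟨-, h⟩⟩
  · cases h
  · exact .base h
  · exact h

theorem Derives.simple_obj {Γ : Ctx} {M : Exp .obj} {A : Exp .fam}
    (h : Derives Γ (.obj M A)) (hΓ : SimpleCtx Γ) (hM : Canonical Γ M) :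
    Simple (sigOf Γ) A .wf ∧ Simple (sigOf Γ) M (.chk (phi A)) := by
  obtain ⟨hA, ⟨h₁, h₂⟩ | ⟨-, h⟩⟩ := h.simple hΓ hM.1 0 hM.2
  · refine ⟨hA, ?_⟩
    rw [phi_eq_lfObj h₁] at h₂ ⊢; exact .atom h₂
  · exact ⟨hA, h⟩

theorem SimpleCtx.of_canonicalCtx : {Γ : Ctx} → Derives Γ .ctx → CanonicalCtx Γ → SimpleCtx Γ
  | [], _, _ => trivial
  | .kd K :: Γ, h, hc => by
    cases h with
    | kindCtx hK h =>
      have := SimpleCtx.of_canonicalCtx h hc.2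
      exact ⟨hK.simple this hc.1.1 hc.1.2, this⟩
  | .ty A :: Γ, h, hc => by
    cases h with
    | typeCtx hA h =>
      have := SimpleCtx.of_canonicalCtx h hc.2
      exact ⟨hA.simple_fam this hc.1, this⟩

theorem Simple.fullyApplied {Γ : Ctx} {c : Cat} {P : Exp c} {m : Mode}
    (h : Simple (sigOf Γ) P m) (hΓ : SimpleCtx Γ) : match (generalizing := false) m with
    | .neu a => FullyApplied Γ (arity a) P
    | _ => FullyApplied Γ 0 P := by
  generalize hS : sigOf Γ = S at h
  induction h generalizing Γ with
  | typ => trivial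
  | piK hA _ ihA ihK => subst hS; exact ⟨ihA hΓ rfl, ihK (Γ := .ty _ :: Γ) ⟨hA, hΓ⟩ rfl⟩
  | piF hA _ ihA ihB => subst hS; exact ⟨ihA hΓ rfl, ihB (Γ := .ty _ :: Γ) ⟨hA, hΓ⟩ rfl⟩
  | base _ ih => exact ih hΓ hS
  | fvar hu ha =>
    subst hS
    obtain ⟨K, hK, rfl⟩ := exists_kd_of_sigOf hu ha
    exact ⟨K, K, hK, (hΓ.kd hK).2.nf_self, (arity_phi K).symm⟩
  | appF _ _ ihA ihM => exact ⟨ihA hΓ hS, ihM hΓ hS⟩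
  | var hx ha =>
    subst hS
    obtain ⟨A, hA, rfl⟩ := exists_ty_of_sigOf hx ha
    exact ⟨A, A, hA, (hΓ.ty hA).2.nf_self, (arity_phi A).symm⟩
  | app _ _ ihM ihN => exact ⟨ihM hΓ hS, ihN hΓ hS⟩
  | lam hA _ ihA ihM => subst hS; exact ⟨ihA hΓ rfl, ihM (Γ := .ty _ :: Γ) ⟨hA, hΓ⟩ rfl⟩
  | atom _ ih => exact ih hΓ hS

theorem Simple.canonical {Γ : Ctx} {M : Exp .obj} {a : Ty} (h : Simple (sigOf Γ) M (.chk a))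
    (hΓ : SimpleCtx Γ) : Canonical Γ M := ⟨h.normal, h.fullyApplied hΓ⟩

theorem Derives.type_of_chk {Γ : Ctx} {M : Exp .obj} {A : Exp .fam} {a : Ty}
    (h : Derives Γ (.obj M A)) (hΓ : SimpleCtx Γ) (hM : Simple (sigOf Γ) M (.chk a)) :
    Simple (sigOf Γ) A .wf ∧ phi A = a := by
  obtain ⟨h₁, h₂⟩ := h.simple_obj hΓ (hM.canonical hΓ)
  exact ⟨h₁, h₂.hasType_chk.unique hM.hasType_chk⟩

theorem Derives.type_of_neu {Γ : Ctx} {M : Exp .obj} {A : Exp .fam} {a : Ty}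
    (h : Derives Γ (.obj M A)) (hΓ : SimpleCtx Γ) (hM : Simple (sigOf Γ) M (.neu a)) :
    Simple (sigOf Γ) A .wf ∧ phi A = a := by
  obtain ⟨h₁, ⟨-, h₂⟩ | ⟨⟨B, N, rfl⟩, -⟩⟩ := h.simple hΓ hM.normal _ (hM.fullyApplied hΓ)
  · exact ⟨h₁, h₂.hasType_neu.unique hM.hasType_neu⟩
  · cases hM

theorem Derives.kind_of_neu {Γ : Ctx} {A : Exp .fam} {K : Exp .kind} {a : Ty}
    (h : Derives Γ (.fam A K)) (hΓ : SimpleCtx Γ) (hA : Simple (sigOf Γ) A (.neu a)) :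
    Simple (sigOf Γ) K .wf ∧ phi K = a := by
  rcases h.simple hΓ hA.normal _ (hA.fullyApplied hΓ) with
    ⟨B, C, rfl⟩ | ⟨h₁, ⟨-, h₂⟩ | ⟨rfl, h₂⟩⟩
  · cases hA
  · exact ⟨h₁, h₂.hasType_neu.unique hA.hasType_neu⟩
  · refine ⟨.typ, ?_⟩
    cases h₂ with
    | base h₂ => exact h₂.hasType_neu.unique hA.hasType_neu
    | piF => cases hA

end LF

/-! ### Substitution in derivations -/

namespace LF

open Relation HH Translation

namespace Simple

variable {S : Sig} {m : Mode}

theorem fvar_inv {u : ℕ} (h : Simple S (.fvar u) m) :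
    ∃ a, S[u]? = some a ∧ a.target = .lfType := by
  cases h with
  | base h => cases h with
    | fvar h ha => exact ⟨_, h, ha⟩
  | fvar h ha => exact ⟨_, h, ha⟩

theorem var_inv {x : ℕ} (h : Simple S (.var x) m) :
    ∃ a, S[x]? = some a ∧ a.target = .lfObj := by
  cases h with
  | atom h => cases h with
    | var h ha => exact ⟨_, h, ha⟩
  | var h ha => exact ⟨_, h, ha⟩

theorem appF_inv {A : Exp .fam} {M : Exp .obj} (h : Simple S (.appF A M) m) :
    ∃ a b, Simple S A (.neu (.arr a b)) ∧ Simple S M (.chk a) := by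
  cases h with
  | base h => cases h with
    | appF h h' => exact ⟨_, _, h, h'⟩
  | appF h h' => exact ⟨_, _, h, h'⟩

theorem app_inv {M N : Exp .obj} (h : Simple S (.app M N) m) :
    ∃ a b, Simple S M (.neu (.arr a b)) ∧ Simple S N (.chk a) := by
  cases h with
  | atom h => cases h with
    | app h h' => exact ⟨_, _, h, h'⟩
  | app h h' => exact ⟨_, _, h, h'⟩

theorem lam_inv {A : Exp .fam} {M : Exp .obj} (h : Simple S (.lam A M) m) :
    Simple S A .wf ∧ ∃ b, Simple (phi A :: S) M (.chk b) := by
  cases h with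
  | atom h => cases h
  | lam h h' => exact ⟨h, _, h'⟩

theorem piF_inv {A B : Exp .fam} (h : Simple S (.piF A B) m) :
    Simple S A .wf ∧ Simple (phi A :: S) B .wf := by
  cases h with
  | base h => cases h
  | piF h h' => exact ⟨h, h'⟩

theorem not_lamF {A B : Exp .fam} : ¬ Simple S (.lamF A B) m := fun h => by
  cases h with
  | base h => cases h

end Simple

/-- A substitution from `Γ` to `Γ'` under which the variables of `Γ` have the types and kinds
that `Γ` assigns to them. -/
structure TypedSub (n : ℕ) (Γ' Γ : Ctx) (s : ℕ → Exp .obj) (r : ℕ → ℕ) (e : ℕ → Tm)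
    (q : ℕ → Raw) : Prop where
  simple : SimpleSub n (sigOf Γ') (sigOf Γ) s r e q
  ctx : Derives Γ' .ctx
  simpleCtx : SimpleCtx Γ'
  obj : ∀ x A A', Γ[x]? = some (.ty A) → A'.Normal →
    A'.raw.Conv ((A.shift (x + 1)).raw.subst q) → Derives Γ' (.obj (s x) A')
  fam : ∀ u K K', Γ[u]? = some (.kd K) → K'.Normal →
    K'.raw.Conv ((K.shift (u + 1)).raw.subst q) → Derives Γ' (.fam (.fvar (r u)) K')

/-- Derivations of canonical expressions are closed under a class `Adm` of substitutions that
can be extended under binders, provided that the substitutions of an object whose simple type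
has size less than `n` are already available for the redexes that arise. -/
theorem Derives.subst_of_lift {n : ℕ}
    (Adm : Ctx → Ctx → (ℕ → Exp .obj) → (ℕ → ℕ) → (ℕ → Tm) → (ℕ → Raw) → Prop)
    (hAdm : ∀ {Γ' Γ s r e q}, Adm Γ' Γ s r e q → TypedSub n Γ' Γ s r e q)
    (hlift : ∀ {Γ' Γ s r e q} {A A' : Exp .fam}, Adm Γ' Γ s r e q → SimpleCtx Γ →
      Simple (sigOf Γ) A .wf → Derives Γ' (.fam A' .typ) → Simple (sigOf Γ') A' .wf →
      phi A' = phi A → A'.raw.Conv (A.raw.subst q) →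
      Adm (.ty A' :: Γ') (.ty A :: Γ) (Exp.liftSub s) (liftRen r) (Tm.liftSub e)
        (Raw.liftSub q))
    (hlow : ∀ {Γ : Ctx} {A B B' : Exp .fam} {M N P : Exp .obj} {b : Ty}, (phi A).size < n →
      Derives Γ .ctx → SimpleCtx Γ → Simple (sigOf Γ) A .wf →
      Derives (.ty A :: Γ) (.obj M B) → Simple (phi A :: sigOf Γ) M (.chk b) →
      Derives Γ (.obj N A) → Simple (sigOf Γ) N (.chk (phi A)) → P.Normal → B'.Normal →
      P.raw.Conv (M.raw.inst N.raw) → B'.raw.Conv (B.raw.inst N.raw) → Derives Γ (.obj P B'))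
    {Γ : Ctx} {J : Assertion} (h : Derives Γ J) (hΓ : SimpleCtx Γ) :
    ∀ {Γ' s r e q}, Adm Γ' Γ s r e q → match (generalizing := false) J with
    | .fam A K => ∀ m A' K', Simple (sigOf Γ) A m → A'.Normal → K'.Normal →
        A'.raw.Conv (A.raw.subst q) → K'.raw.Conv (K.raw.subst q) → Derives Γ' (.fam A' K')
    | .obj M A => ∀ m M' A', Simple (sigOf Γ) M m → M'.Normal → A'.Normal →
        M'.raw.Conv (M.raw.subst q) → A'.raw.Conv (A.raw.subst q) → Derives Γ' (.obj M' A')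
    | _ => True := by
  induction h with
  | nullCtx | kindCtx | typeCtx | typeKind | piKind => exact fun _ => trivial
  | @varFam Γ u K K' _ hu hK _ =>
    intro Γ' s r e q ha m A₁ K₁ hm hA₁ hK₁ cA cK
    have ht := hAdm ha
    obtain ⟨a, h₁, h₂⟩ := hm.fvar_inv
    obtain ⟨h₃, -, h₄⟩ := ht.simple.fam u a h₁ h₂
    obtain rfl := (hΓ.kd hu).1.normal.eq_of_nf hK
    obtain rfl : A₁ = .fvar (r u) := by
      refine hA₁.eq_of_conv (Simple.fvar h₃ h₂).normal ?_
      simpa only [Exp.raw, Raw.subst, h₄] using cA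
    exact ht.fam u K K₁ hu hK₁ cK
  | @varObj Γ x A A' _ hx hA _ =>
    intro Γ' s r e q ha m M₁ A₁ hm hM₁ hA₁ cM cA
    have ht := hAdm ha
    obtain ⟨a, h₁, h₂⟩ := hm.var_inv
    obtain ⟨h₃, -, h₄⟩ := ht.simple.obj x a h₁ h₂
    obtain rfl := (hΓ.ty hx).1.normal.eq_of_nf hA
    have hs : (s x).Normal := by
      rcases h₃ with ⟨y, hy, hS⟩ | ⟨h₃, -⟩
      · rw [hy]; exact (Simple.var hS h₂).normal
      · exact h₃.normal
    obtain rfl : M₁ = s x := by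
      refine hM₁.eq_of_conv hs ?_
      simpa only [Exp.raw, Raw.subst, h₄] using cM
    exact ht.obj x A A₁ hx hA₁ cA
  | @piFam Γ A B hA hB ihA ihB =>
    intro Γ' s r e q ha m P K₁ hm hP hK₁ cP cK
    have ht := hAdm ha
    obtain ⟨sA, sB⟩ := hm.piF_inv
    obtain ⟨A₁, -, cA, rA, pA, -⟩ := sA.exists_subst n ht.simple
    obtain ⟨B₁, -, cB, rB, pB, -⟩ := sB.exists_subst n (ht.simple.lift (target_phi_fam A))
    obtain rfl : P = .piF A₁ B₁ :=
      hP.eq_of_conv (Simple.piF rA (pA ▸ rB)).normal (cP.trans (cA.map₂ .pi cB).symm)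
    obtain rfl : K₁ = .typ := hK₁.eq_of_conv (Simple.typ (S := [])).normal cK
    have dA := ihA hΓ ha _ A₁ .typ sA rA.normal (Simple.typ (S := [])).normal cA (.refl _)
    exact .piFam dA (ihB ⟨sA, hΓ⟩ (hlift ha hΓ sA dA rA pA cA) _ B₁ .typ sB rB.normal
      (Simple.typ (S := [])).normal cB (.refl _))
  | absFam => exact fun _ _ _ _ h => (h.not_lamF).elim
  | @appFam Γ A B K K' M hA hM hK ihA ihM =>
    intro Γ' s r e q ha m P K₁ hm hP hK₁ cP cK
    have ht := hAdm ha
    obtain ⟨a, b, sA, sM⟩ := hm.appF_inv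
    obtain ⟨sK, pK⟩ := hA.kind_of_neu hΓ sA
    cases sK with
    | piK sB sK =>
      simp only [phi, Ty.arr.injEq] at pK
      obtain ⟨rfl, rfl⟩ := pK
      obtain ⟨A₁, -, cA, rA | ⟨rA, -⟩, -⟩ := sA.exists_subst n ht.simple
      swap
      · cases rA
      obtain ⟨M₁, -, cM, rM, -⟩ := sM.exists_subst n ht.simple
      obtain ⟨B₁, -, cB, rB, pB, -⟩ := sB.exists_subst n ht.simple
      obtain ⟨K₂, -, cK₂, rK, -⟩ := sK.exists_subst n (ht.simple.lift (target_phi_fam B))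
      obtain rfl : P = .appF A₁ M₁ :=
        hP.eq_of_conv (Simple.appF rA rM).normal (cP.trans (cA.map₂ .app cM).symm)
      refine .appFam (ihA hΓ ha _ A₁ (.piK B₁ K₂) sA rA.normal
        (Simple.piK rB (pB ▸ rK)).normal cA (cB.map₂ .pi cK₂))
        (ihM hΓ ha _ M₁ B₁ sM rM.normal rB.normal cM cB) ?_
      obtain ⟨K₃, hK₃, -, cK₃, -⟩ := rK.exists_inst (target_phi_fam B) rM
      obtain rfl : K₁ = K₃ := by
        refine hK₁.eq_of_conv hK₃.2 (cK.trans ?_)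
        refine ((sK.conv_inst_of_steps (target_phi_fam B) sM hK.1).subst q).trans ?_
        rw [Raw.inst_subst]
        exact (cK₂.symm.inst cM.symm).trans cK₃.symm
      exact hK₃
  | @absObj Γ A A' B M hA hM hA' ihA ihM =>
    intro Γ' s r e q ha m P A₂ hm hP hA₂ cP cA₂
    have ht := hAdm ha
    obtain ⟨sA, b, sM⟩ := hm.lam_inv
    obtain rfl := sA.normal.eq_of_nf hA'
    obtain ⟨sB, -⟩ := hM.type_of_chk (Γ := .ty A' :: Γ) ⟨sA, hΓ⟩ sM
    obtain ⟨A₁, -, cA, rA, pA, -⟩ := sA.exists_subst n ht.simple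
    obtain ⟨B₁, -, cB, rB, pB, -⟩ := sB.exists_subst n (ht.simple.lift (target_phi_fam A'))
    obtain ⟨M₁, -, cM, rM, -⟩ := sM.exists_subst n (ht.simple.lift (target_phi_fam A'))
    obtain rfl : P = .lam A₁ M₁ :=
      hP.eq_of_conv (Simple.lam rA (pA ▸ rM)).normal (cP.trans (cA.map₂ .lam cM).symm)
    obtain rfl : A₂ = .piF A₁ B₁ :=
      hA₂.eq_of_conv (Simple.piF rA (pA ▸ rB)).normal (cA₂.trans (cA.map₂ .pi cB).symm)
    have dA := ihA hΓ ha _ A₁ .typ sA rA.normal (Simple.typ (S := [])).normal cA (.refl _)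
    exact .absObj dA (ihM ⟨sA, hΓ⟩ (hlift ha hΓ sA dA rA pA cA) _ M₁ B₁ sM rM.normal
      rB.normal cM cB) rA.normal.nf_self
  | @appObj Γ A B B' M N hM hN hB ihM ihN =>
    intro Γ' s r e q ha m P B₂ hm hP hB₂ cP cB₂
    have ht := hAdm ha
    obtain ⟨a, b, sM, sN⟩ := hm.app_inv
    obtain ⟨sAB, pAB⟩ := hM.type_of_neu hΓ sM
    obtain ⟨sA, sB⟩ := sAB.piF_inv
    simp only [phi, Ty.arr.injEq] at pAB
    obtain ⟨rfl, rfl⟩ := pAB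
    obtain ⟨M₁, -, cM, rM, -⟩ := sM.exists_subst n ht.simple
    obtain ⟨N₁, -, cN, rN, -⟩ := sN.exists_subst n ht.simple
    obtain ⟨A₁, -, cA, rA, pA, -⟩ := sA.exists_subst n ht.simple
    obtain ⟨B₁, -, cB, rB, pB, -⟩ := sB.exists_subst n (ht.simple.lift (target_phi_fam A))
    have hM₁ : M₁.Normal := rM.elim Simple.normal fun h => h.1.normal
    have dM := ihM hΓ ha _ M₁ (.piF A₁ B₁) sM hM₁ (Simple.piF rA (pA ▸ rB)).normal cM
      (cA.map₂ .pi cB)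
    have dN := ihN hΓ ha _ N₁ A₁ sN rN.normal rA.normal cN cA
    have cB' : B₂.raw.Conv (B₁.raw.inst N₁.raw) := by
      refine cB₂.trans (((sB.conv_inst_of_steps (target_phi_fam A) sN hB.1).subst q).trans ?_)
      rw [Raw.inst_subst]
      exact cB.symm.inst cN.symm
    have cP' : P.raw.Conv (.app M₁.raw N₁.raw) := cP.trans (cM.map₂ .app cN).symm
    -- Either `M₁ N₁` is already normal, or the head of `M` was replaced by an abstraction and
    -- the redex is contracted by a substitution at the smaller simple type of `A`.
    rcases rM with rM | ⟨rM, hn⟩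
    · obtain rfl : P = .app M₁ N₁ := hP.eq_of_conv (Simple.app rM rN).normal cP'
      refine .appObj dM dN ?_
      obtain ⟨B₃, hB₃, -, cB₃, -⟩ := rB.exists_inst (target_phi_fam A) rN
      obtain rfl : B₂ = B₃ := hB₂.eq_of_conv hB₃.2 (cB'.trans cB₃.symm)
      exact hB₃
    · simp only [Ty.size] at hn
      generalize hab : Ty.arr (phi A) (phi B) = ab at rM
      cases rM with
      | atom => cases hab
      | @lam _ A₂ M₂ b rA₂ rM₂ =>
        simp only [Ty.arr.injEq] at hab
        obtain ⟨hA₂, rfl⟩ := hab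
        cases dM with
        | absObj dA₂ dM₂ hA₂' =>
          obtain rfl := rA₂.normal.eq_of_nf hA₂'
          exact hlow (by rw [← hA₂]; omega) ht.ctx ht.simpleCtx rA₂ dM₂ rM₂ dN (hA₂ ▸ rN) hP hB₂
            (cP'.trans (.beta _ _ _)) cB'

theorem Derives.varObj_simple {Γ : Ctx} {x : ℕ} {A : Exp .fam} (h : Derives Γ .ctx)
    (hΓ : SimpleCtx Γ) (hx : Γ[x]? = some (.ty A)) :
    Derives Γ (.obj (.var x) (A.shift (x + 1))) :=
  .varObj h hx (hΓ.ty hx).1.normal.nf_self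

theorem Derives.varFam_simple {Γ : Ctx} {x : ℕ} {K : Exp .kind} (h : Derives Γ .ctx)
    (hΓ : SimpleCtx Γ) (hx : Γ[x]? = some (.kd K)) :
    Derives Γ (.fam (.fvar x) (K.shift (x + 1))) :=
  .varFam h hx (hΓ.kd hx).1.normal.nf_self

/-- The renaming `r` takes each assignment of `Γ` to an assignment of `Γ'`. -/
structure TypedRen (Γ' Γ : Ctx) (r : ℕ → ℕ) : Prop where
  ctx : Derives Γ' .ctx
  simpleCtx : SimpleCtx Γ'
  ty : ∀ x A, Γ[x]? = some (.ty A) → ∃ A', Γ'[r x]? = some (.ty A') ∧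
    A'.shift (r x + 1) = (A.shift (x + 1)).rename r
  kd : ∀ x K, Γ[x]? = some (.kd K) → ∃ K', Γ'[r x]? = some (.kd K') ∧
    K'.shift (r x + 1) = (K.shift (x + 1)).rename r

theorem Exp.raw_rename_eq {c : Cat} (P : Exp c) (r : ℕ → ℕ) :
    (P.rename r).raw = P.raw.subst fun i => .var (r i) := by
  rw [Exp.raw_rename, Raw.rename_eq_subst]

theorem TypedRen.sigOf_get {Γ' Γ : Ctx} {r : ℕ → ℕ} (h : TypedRen Γ' Γ r) (x : ℕ) (a : Ty)
    (hx : (sigOf Γ)[x]? = some a) : (sigOf Γ')[r x]? = some a := by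
  rcases exists_decl_of_sigOf hx with ⟨A, hA, rfl⟩ | ⟨A, hA, rfl⟩
  · obtain ⟨A', hA', e⟩ := h.ty x A hA
    have := congrArg phi e
    simp only [phi_shift, phi_rename] at this
    rw [← this]; exact sigOf_of_ty hA'
  · obtain ⟨A', hA', e⟩ := h.kd x A hA
    have := congrArg phi e
    simp only [phi_shift, phi_rename] at this
    rw [← this]; exact sigOf_of_kd hA'

theorem TypedRen.typedSub {Γ' Γ : Ctx} {r : ℕ → ℕ} (h : TypedRen Γ' Γ r) :
    TypedSub 0 Γ' Γ (fun i => .var (r i)) r (fun i => .var (r i)) (fun i => .var (r i)) where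
  simple :=
    { obj := fun x a hx _ => ⟨.inl ⟨_, rfl, h.sigOf_get x a hx⟩, rfl, rfl⟩
      fam := fun x a hx _ => ⟨h.sigOf_get x a hx, rfl, rfl⟩ }
  ctx := h.ctx
  simpleCtx := h.simpleCtx
  obj := fun x A A₁ hx hA₁ c => by
    obtain ⟨A', hA', e⟩ := h.ty x A hx
    rw [← Exp.raw_rename_eq, ← e] at c
    obtain rfl := hA₁.eq_of_conv (h.simpleCtx.ty hA').1.normal c
    exact h.ctx.varObj_simple h.simpleCtx hA'
  fam := fun x A A₁ hx hA₁ c => by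
    obtain ⟨A', hA', e⟩ := h.kd x A hx
    rw [← Exp.raw_rename_eq, ← e] at c
    obtain rfl := hA₁.eq_of_conv (h.simpleCtx.kd hA').1.normal c
    exact h.ctx.varFam_simple h.simpleCtx hA'

theorem Exp.shift_rename_lift {c : Cat} (P : Exp c) (r : ℕ → ℕ) :
    (P.shift 1).rename (liftRen r) = (P.rename r).shift 1 := by
  apply Exp.raw_injective
  simp only [Exp.raw_rename, Exp.raw_shift, Raw.rename_rename]; rfl

theorem TypedRen.lift {Γ' Γ : Ctx} {r : ℕ → ℕ} {A : Exp .fam} (h : TypedRen Γ' Γ r)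
    (hA : Derives Γ' (.fam (A.rename r) .typ)) (sA : Simple (sigOf Γ') (A.rename r) .wf) :
    TypedRen (.ty (A.rename r) :: Γ') (.ty A :: Γ) (liftRen r) where
  ctx := .typeCtx hA h.ctx
  simpleCtx := ⟨sA, h.simpleCtx⟩
  ty := by
    rintro (_ | x) B hB
    · obtain rfl : A = B := by simpa using hB
      exact ⟨_, rfl, (Exp.shift_rename_lift _ _).symm⟩
    · obtain ⟨B', hB', e⟩ := h.ty x B (by simpa using hB)
      refine ⟨B', by simpa [liftRen] using hB', ?_⟩
      rw [liftRen, ← Exp.shift_shift, e, ← Exp.shift_shift B (x + 1) 1,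
        Exp.shift_rename_lift]
  kd := by
    rintro (_ | x) B hB
    · simp at hB
    · obtain ⟨B', hB', e⟩ := h.kd x B (by simpa using hB)
      refine ⟨B', by simpa [liftRen] using hB', ?_⟩
      rw [liftRen, ← Exp.shift_shift, e, ← Exp.shift_shift B (x + 1) 1,
        Exp.shift_rename_lift]

theorem typedRen_shift {Γ : Ctx} {D : Decl} (h : Derives (D :: Γ) .ctx)
    (hΓ : SimpleCtx (D :: Γ)) : TypedRen (D :: Γ) Γ (· + 1) where
  ctx := h
  simpleCtx := hΓ
  ty := fun x A hx => ⟨A, by simpa using hx, (Exp.shift_shift A (x + 1) 1).symm⟩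
  kd := fun x A hx => ⟨A, by simpa using hx, (Exp.shift_shift A (x + 1) 1).symm⟩

theorem TypedRen.derives {Γ' Γ : Ctx} {r : ℕ → ℕ} {J : Assertion} (h : TypedRen Γ' Γ r)
    (hJ : Derives Γ J) (hΓ : SimpleCtx Γ) : match (generalizing := false) J with
    | .fam A K => ∀ m, Simple (sigOf Γ) A m → (A.rename r).Normal → (K.rename r).Normal →
        Derives Γ' (.fam (A.rename r) (K.rename r))
    | .obj M A => ∀ m, Simple (sigOf Γ) M m → (M.rename r).Normal → (A.rename r).Normal →
        Derives Γ' (.obj (M.rename r) (A.rename r))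
    | _ => True := by
  have hlift : ∀ r : ℕ → ℕ,
      (Exp.liftSub fun i => .var (r i)) = (fun i => .var (liftRen r i)) ∧
      (Tm.liftSub fun i => .var (r i)) = (fun i => .var (liftRen r i)) ∧
      (Raw.liftSub fun i => .var (r i)) = (fun i => .var (liftRen r i)) := fun r =>
    ⟨by funext i; cases i <;> rfl, by funext i; cases i <;> rfl, by funext i; cases i <;> rfl⟩
  have key := Derives.subst_of_lift (n := 0) (fun Γ' Γ s r e q => TypedRen Γ' Γ r ∧
      s = (fun i => .var (r i)) ∧ e = (fun i => .var (r i)) ∧ q = fun i => .var (r i))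
    (by rintro Γ' Γ s r e q ⟨h, rfl, rfl, rfl⟩; exact h.typedSub)
    (by
      rintro Γ' Γ s r e q A A' ⟨h, rfl, rfl, rfl⟩ hΓ sA dA sA' - c
      refine ⟨?_, hlift r⟩
      rw [← Exp.raw_rename_eq] at c
      obtain rfl := sA'.normal.eq_of_conv (sA.rename h.sigOf_get).normal c
      exact h.lift dA sA')
    (fun h => (Nat.not_lt_zero _ h).elim) hJ hΓ
    (q := fun i => .var (r i)) ⟨h, rfl, rfl, rfl⟩
  cases J with
  | fam A K =>
    exact fun m hA h₁ h₂ => key m _ _ hA h₁ h₂ (by rw [Exp.raw_rename_eq]; exact .refl _)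
      (by rw [Exp.raw_rename_eq]; exact .refl _)
  | obj A K =>
    exact fun m hA h₁ h₂ => key m _ _ hA h₁ h₂ (by rw [Exp.raw_rename_eq]; exact .refl _)
      (by rw [Exp.raw_rename_eq]; exact .refl _)
  | _ => trivial

theorem Derives.shift_obj {Γ : Ctx} {D : Decl} {M : Exp .obj} {A : Exp .fam} {m : Mode}
    (h : Derives Γ (.obj M A)) (hD : Derives (D :: Γ) .ctx) (hΓ : SimpleCtx (D :: Γ))
    (sM : Simple (sigOf Γ) M m) (sA : Simple (sigOf Γ) A .wf) :
    Derives (D :: Γ) (.obj (M.shift 1) (A.shift 1)) :=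
  (typedRen_shift hD hΓ).derives h hΓ.tail m sM (sM.shift_cons D).normal (sA.shift_cons D).normal

theorem Derives.shift_fam {Γ : Ctx} {D : Decl} {A : Exp .fam} {K : Exp .kind} {m : Mode}
    (h : Derives Γ (.fam A K)) (hD : Derives (D :: Γ) .ctx) (hΓ : SimpleCtx (D :: Γ))
    (sA : Simple (sigOf Γ) A m) (sK : Simple (sigOf Γ) K .wf) :
    Derives (D :: Γ) (.fam (A.shift 1) (K.shift 1)) :=
  (typedRen_shift hD hΓ).derives h hΓ.tail m sA (sA.shift_cons D).normal (sK.shift_cons D).normal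

theorem TypedSub.lift {n : ℕ} {Γ' Γ : Ctx} {s : ℕ → Exp .obj} {r : ℕ → ℕ} {e : ℕ → Tm}
    {q : ℕ → Raw} {A A' : Exp .fam} (h : TypedSub n Γ' Γ s r e q) (hΓ : SimpleCtx Γ)
    (dA : Derives Γ' (.fam A' .typ)) (sA : Simple (sigOf Γ') A' .wf) (pA : phi A' = phi A)
    (c : A'.raw.Conv (A.raw.subst q)) :
    TypedSub n (.ty A' :: Γ') (.ty A :: Γ) (Exp.liftSub s) (liftRen r) (Tm.liftSub e)
      (Raw.liftSub q) where
  simple := by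
    have := h.simple.lift (target_phi_fam A)
    simp only [sigOf, pA]
    exact this
  ctx := .typeCtx dA h.ctx
  simpleCtx := ⟨sA, h.simpleCtx⟩
  obj := by
    rintro (_ | x) B B' hB hB' cB
    · obtain rfl : A = B := by simpa using hB
      rw [Exp.raw_shift, zero_add, Raw.shift_subst_lift] at cB
      obtain rfl : B' = A'.shift 1 := by
        refine hB'.eq_of_conv (sA.shift_cons (.ty A')).normal (cB.trans ?_)
        rw [Exp.raw_shift]; exact c.symm.rename _
      exact Derives.varObj_simple (x := 0) (.typeCtx dA h.ctx) ⟨sA, h.simpleCtx⟩ rfl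
    · have hB : Γ[x]? = some (.ty B) := by simpa using hB
      rw [← Exp.shift_shift, Exp.raw_shift, Raw.shift_subst_lift] at cB
      have sB := (hΓ.ty hB).1
      obtain ⟨B₁, -, cB₁, rB, -⟩ := sB.exists_subst n h.simple
      obtain rfl : B' = B₁.shift 1 := by
        refine hB'.eq_of_conv (rB.shift_cons (.ty A')).normal (cB.trans ?_)
        rw [Exp.raw_shift B₁]; exact cB₁.symm.rename _
      have dx := h.obj x B B₁ hB rB.normal cB₁
      rcases (h.simple.obj x _ (sigOf_of_ty hB) (target_phi_fam B)).1 with ⟨y, hy, hS⟩ | ⟨hs, -⟩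
      · refine dx.shift_obj (.typeCtx dA h.ctx) ⟨sA, h.simpleCtx⟩ (m := .neu (phi B)) ?_ rB
        rw [hy]; exact .var hS (target_phi_fam B)
      · exact dx.shift_obj (.typeCtx dA h.ctx) ⟨sA, h.simpleCtx⟩ hs rB
  fam := by
    rintro (_ | x) B B' hB hB' cB
    · simp at hB
    · have hB : Γ[x]? = some (.kd B) := by simpa using hB
      rw [← Exp.shift_shift, Exp.raw_shift, Raw.shift_subst_lift] at cB
      have sB := (hΓ.kd hB).1
      obtain ⟨B₁, -, cB₁, rB, -⟩ := sB.exists_subst n h.simple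
      obtain rfl : B' = B₁.shift 1 := by
        refine hB'.eq_of_conv (rB.shift_cons (.ty A')).normal (cB.trans ?_)
        rw [Exp.raw_shift B₁]; exact cB₁.symm.rename _
      obtain ⟨hS, -⟩ := h.simple.fam x _ (sigOf_of_kd hB) (target_phi_kind B)
      exact (h.fam x B B₁ hB rB.normal cB₁).shift_fam (.typeCtx dA h.ctx) ⟨sA, h.simpleCtx⟩
        (.fvar hS (target_phi_kind B)) rB

theorem TypedSub.inst {Γ : Ctx} {A : Exp .fam} {N : Exp .obj} (h : Derives Γ .ctx)
    (hΓ : SimpleCtx Γ) (sA : Simple (sigOf Γ) A .wf) (dN : Derives Γ (.obj N A))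
    (sN : Simple (sigOf Γ) N (.chk (phi A))) :
    TypedSub (phi A).size Γ (.ty A :: Γ) (Exp.instSub N) (· - 1) (Tm.instSub (encTerm N))
      (Raw.instSub N.raw) where
  simple := SimpleSub.inst (target_phi_fam A) sN
  ctx := h
  simpleCtx := hΓ
  obj := by
    rintro (_ | x) B B' hB hB' cB
    · obtain rfl : A = B := by simpa using hB
      rw [Exp.raw_shift, zero_add, ← Raw.inst, Raw.shift_inst] at cB
      obtain rfl := hB'.eq_of_conv sA.normal cB
      exact dN
    · have hB : Γ[x]? = some (.ty B) := by simpa using hB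
      rw [← Exp.shift_shift, Exp.raw_shift, ← Raw.inst, Raw.shift_inst] at cB
      obtain rfl := hB'.eq_of_conv (hΓ.ty hB).1.normal cB
      exact h.varObj_simple hΓ hB
  fam := by
    rintro (_ | x) B B' hB hB' cB
    · simp at hB
    · have hB : Γ[x]? = some (.kd B) := by simpa using hB
      rw [← Exp.shift_shift, Exp.raw_shift, ← Raw.inst, Raw.shift_inst] at cB
      obtain rfl := hB'.eq_of_conv (hΓ.kd hB).1.normal cB
      exact h.varFam_simple hΓ hB

/-- Derivations of canonical expressions are closed under hereditary substitution. -/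
theorem TypedSub.derives {n : ℕ} {Γ' Γ : Ctx} {s : ℕ → Exp .obj} {r : ℕ → ℕ} {e : ℕ → Tm}
    {q : ℕ → Raw} {J : Assertion} (h : TypedSub n Γ' Γ s r e q) (hJ : Derives Γ J)
    (hΓ : SimpleCtx Γ) : match (generalizing := false) J with
    | .fam A K => ∀ m A' K', Simple (sigOf Γ) A m → A'.Normal → K'.Normal →
        A'.raw.Conv (A.raw.subst q) → K'.raw.Conv (K.raw.subst q) → Derives Γ' (.fam A' K')
    | .obj M A => ∀ m M' A', Simple (sigOf Γ) M m → M'.Normal → A'.Normal →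
        M'.raw.Conv (M.raw.subst q) → A'.raw.Conv (A.raw.subst q) → Derives Γ' (.obj M' A')
    | _ => True := by
  induction n using Nat.strong_induction_on generalizing Γ' Γ s r e q J with | _ n ih => ?_
  refine Derives.subst_of_lift (TypedSub n) id
    (fun h hΓ _ dA sA pA c => h.lift hΓ dA sA pA c) ?_ hJ hΓ h
  intro Γ A B B' M N P b hn hc hΓ sA dM sM dN sN hP hB' cP cB
  exact ih _ hn (TypedSub.inst hc hΓ sA dN sN) dM ⟨sA, hΓ⟩ _ P B' sM hP hB' cP cB

theorem Derives.inst_fam {Γ : Ctx} {A B B' : Exp .fam} {N : Exp .obj}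
    (h : Derives (.ty A :: Γ) (.fam B .typ)) (hc : Derives Γ .ctx) (hΓ : SimpleCtx Γ)
    (sA : Simple (sigOf Γ) A .wf) (sB : Simple (phi A :: sigOf Γ) B .wf)
    (dN : Derives Γ (.obj N A)) (sN : Simple (sigOf Γ) N (.chk (phi A)))
    (hB' : B'.Normal) (cB : B'.raw.Conv (B.raw.inst N.raw)) : Derives Γ (.fam B' .typ) :=
  (TypedSub.inst hc hΓ sA dN sN).derives h ⟨sA, hΓ⟩ _ B' .typ sB hB'
    (Simple.typ (S := [])).normal cB (.refl _)

end LF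

/-! ### Injectivity of the encoding -/

namespace LF

open Relation HH Translation

/-- Encodings of canonical forms are βη-long normal forms. -/
theorem Simple.nf_encTerm {c : Cat} {S : Sig} {P : Exp c} {m : Mode} (h : Simple S P m) :
    match (generalizing := false) m with
    | .wf => True
    | .chk a => nf S a (encTerm P) = encTerm P
    | .neu a => ∃ u, eval (encTerm P) a (idEnv S) = reflect a u ∧ u S.length = encTerm P := by
  have var : ∀ {S : Sig} {x : ℕ} {a : Ty}, S[x]? = some a →
      ∃ u, eval (.var x) a (idEnv S) = reflect a u ∧ u S.length = .var x := fun {S x a} h => by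
    refine ⟨_, eval_var_idEnv h, ?_⟩
    have := (List.getElem?_eq_some_iff.1 h).1
    simp only [level]; congr 1; omega
  have app : ∀ {S : Sig} {t u : Tm} {a b : Ty}, HasType S u a →
      (∃ v, eval t (.arr a b) (idEnv S) = reflect (.arr a b) v ∧ v S.length = t) →
      nf S a u = u →
      ∃ v, eval (.app t u) b (idEnv S) = reflect b v ∧ v S.length = .app t u := by
    rintro S t u a b hu ⟨v, hv, hl⟩ hn
    rw [eval_app hu (idEnv_models S), hv]
    refine ⟨_, rfl, ?_⟩
    change Tm.app (v S.length) (nf S a u) = _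
    rw [hl, hn]
  induction h with
  | typ | piK | piF | base => trivial
  | fvar h _ | var h _ => exact var h
  | appF _ h ih₁ ih₂ | app _ h ih₁ ih₂ => exact app h.hasType_chk ih₁ ih₂
  | lam _ _ _ ih => exact nf_lam.trans (congrArg _ ih)
  | atom _ ih =>
    obtain ⟨u, hu, hl⟩ := ih
    exact (congrArg (fun d => reify .lfObj d _) hu).trans hl

/-- Two canonical objects with the same encoding are equal if they have the same type, and so
are two neutral objects or types in any case: a neutral expression determines its type. -/
theorem Derives.encTerm_inj {Γ : Ctx} {J : Assertion} (h : Derives Γ J) (hΓ : SimpleCtx Γ) :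
    match (generalizing := false) J with
    | .fam A K => ∀ B K' m m', Simple (sigOf Γ) A (.neu m) → Simple (sigOf Γ) B (.neu m') →
        Derives Γ (.fam B K') → encTerm A = encTerm B → A = B ∧ K = K'
    | .obj M A => ∀ N A' m m', Simple (sigOf Γ) M m → Simple (sigOf Γ) N m' →
        Derives Γ (.obj N A') → encTerm M = encTerm N →
        ((∃ B L, M = .lam B L) → A = A') → M = N ∧ A = A'
    | _ => True := by
  induction h with
  | nullCtx | kindCtx | typeCtx | typeKind | piKind => trivial
  | @varFam Γ u K K' _ hu hK _ =>
    intro B K₁ m m' hm hm' hB e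
    cases hm' with
    | fvar hu' _ =>
      simp only [encTerm, Tm.var.injEq] at e
      subst e
      cases hB with
      | varFam _ hu' hK' =>
        obtain rfl := by simpa [hu] using hu'
        have hn := (hΓ.kd hu).1.normal
        exact ⟨rfl, (hn.eq_of_nf hK).trans (hn.eq_of_nf hK').symm⟩
    | appF => cases e
  | @varObj Γ x A A' _ hx hA _ =>
    intro N A₁ m m' hm hm' hN e _
    cases N with
    | lam | app => cases e
    | var y =>
      simp only [encTerm, Tm.var.injEq] at e
      subst e
      cases hN with
      | varObj _ hx' hA' =>
        obtain rfl := by simpa [hx] using hx'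
        have hn := (hΓ.ty hx).1.normal
        exact ⟨rfl, (hn.eq_of_nf hA).trans (hn.eq_of_nf hA').symm⟩
  | piFam => intro _ _ _ _ hm; cases hm
  | absFam => intro _ _ _ _ hm; cases hm
  | @appFam Γ A B K K' M hA hM hK ihA ihM =>
    intro B₁ K₁ m m' hm hm' hB e
    cases hm with
    | appF sA sM =>
      cases hm' with
      | fvar => cases e
      | appF sA' sM' =>
        simp only [encTerm, Tm.app.injEq] at e
        cases hB with
        | appFam hA' hM' hK' =>
          obtain ⟨rfl, h⟩ := ihA hΓ _ _ _ _ sA sA' hA' e.1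
          cases h
          obtain ⟨rfl, -⟩ := ihM hΓ _ _ _ _ sM sM' hM' e.2 fun _ => rfl
          obtain ⟨sBK, p⟩ := hA.kind_of_neu hΓ sA
          cases sBK with
          | piK sB sK =>
            simp only [phi, Ty.arr.injEq] at p
            obtain ⟨_, -, hu, -⟩ := sK.exists_inst (target_phi_fam B) (p.1 ▸ sM)
            exact ⟨rfl, (hu _ hK).trans (hu _ hK').symm⟩
  | @absObj Γ A A' B M hA hM hA' ihA ihM =>
    intro N A₁ m m' hm hm' hN e h
    cases N with
    | var | app => cases e
    | lam A₂ M₂ =>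
      obtain rfl := h ⟨_, _, rfl⟩
      obtain ⟨sA, b, sM⟩ := hm.lam_inv
      obtain ⟨sA₂, b₂, sM₂⟩ := hm'.lam_inv
      obtain rfl := sA.normal.eq_of_nf hA'
      cases hN with
      | absObj _ hM₂ hA₂ =>
        obtain rfl := sA₂.normal.eq_of_nf hA₂
        simp only [encTerm, Tm.lam.injEq, true_and] at e
        obtain ⟨rfl, -⟩ := ihM ⟨sA, hΓ⟩ _ _ _ _ sM sM₂ hM₂ e fun _ => rfl
        exact ⟨rfl, rfl⟩
  | @appObj Γ A B B' M N hM hN hB ihM ihN =>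
    intro N₁ A₁ m m' hm hm' hN₁ e _
    cases N₁ with
    | var | lam => cases e
    | app M₂ N₂ =>
      simp only [encTerm, Tm.app.injEq] at e
      obtain ⟨a, b, sM, sN⟩ := hm.app_inv
      obtain ⟨a', b', sM', sN'⟩ := hm'.app_inv
      cases hN₁ with
      | appObj hM' hN' hB' =>
        obtain ⟨rfl, h⟩ := ihM hΓ _ _ _ _ sM sM' hM' e.1 (by rintro ⟨_, _, rfl⟩; cases sM)
        cases h
        obtain ⟨rfl, -⟩ := ihN hΓ _ _ _ _ sN sN' hN' e.2 fun _ => rfl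
        obtain ⟨sAB, p⟩ := hM.type_of_neu hΓ sM
        obtain ⟨sA, sB⟩ := sAB.piF_inv
        simp only [phi, Ty.arr.injEq] at p
        obtain ⟨_, -, hu, -⟩ := sB.exists_inst (target_phi_fam A) (p.1 ▸ sN)
        exact ⟨rfl, (hu _ hB).trans (hu _ hB').symm⟩

theorem Derives.base_type_eq {Γ : Ctx} {A B : Exp .fam} (hΓ : SimpleCtx Γ)
    (hA : Derives Γ (.fam A .typ)) (hB : Derives Γ (.fam B .typ))
    (sA : Simple (sigOf Γ) A (.neu .lfType)) (sB : Simple (sigOf Γ) B (.neu .lfType))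
    (e : Eqv (sigOf Γ) (encTerm A) (encTerm B) .lfType) : A = B := by
  have key : ∀ {P : Exp .fam}, Simple (sigOf Γ) P (.neu .lfType) →
      nf (sigOf Γ) .lfType (encTerm P) = encTerm P := fun h => by
    obtain ⟨u, hu, hl⟩ := h.nf_encTerm
    rw [nf, hu]; exact hl
  exact (hA.encTerm_inj hΓ _ _ _ _ sA sB hB ((key sA).symm.trans (e.nf_eq.trans (key sB)))).1

/-! ### The translation of contexts -/

theorem encCtx_hasType {Γ : Ctx} (hΓ : SimpleCtx Γ) :
    ∀ D ∈ encCtx Γ, HasType (sigOf Γ) D .o := by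
  induction Γ with
  | nil => simp [encCtx]
  | cons D Γ ih =>
    intro F hF
    cases D with
    | kd K =>
      obtain ⟨F, hF', rfl⟩ := List.mem_map.1 hF
      exact (ih hΓ.2 F hF').shift_one _
    | ty A =>
      rcases List.mem_cons.1 hF with rfl | hF
      · refine .app (hΓ.1.shift_cons (.ty A)).hasType_encType ?_
        rw [phi_shift]; exact .zero
      · obtain ⟨F, hF', rfl⟩ := List.mem_map.1 hF
        exact (ih hΓ.2 F hF').shift_one _

theorem encOf_mem_encCtx {Γ : Ctx} {x : ℕ} {A : Exp .fam} (h : Γ[x]? = some (.ty A)) :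
    encOf (.var x) (A.shift (x + 1)) ∈ encCtx Γ := by
  induction Γ generalizing x with
  | nil => simp at h
  | cons D Γ ih =>
    cases x with
    | zero =>
      obtain rfl : D = .ty A := by simpa using h
      exact List.mem_cons_self
    | succ x =>
      have key : encOf (.var (x + 1)) (A.shift (x + 1 + 1)) ∈ (encCtx Γ).map (Tm.shift 1) :=
        List.mem_map.2 ⟨_, ih (by simpa using h), by rw [encOf_shift, Exp.shift_shift]; rfl⟩
      cases D with
      | kd K => exact key
      | ty A => exact List.mem_cons_of_mem _ key

theorem exists_of_mem_encCtx {Γ : Ctx} {D : Tm} (h : D ∈ encCtx Γ) :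
    ∃ x A, Γ[x]? = some (.ty A) ∧ D = encOf (.var x) (A.shift (x + 1)) := by
  induction Γ generalizing D with
  | nil => simp [encCtx] at h
  | cons E Γ ih =>
    have key : D ∈ (encCtx Γ).map (Tm.shift 1) →
        ∃ x A, (E :: Γ)[x]? = some (.ty A) ∧ D = encOf (.var x) (A.shift (x + 1)) := fun h => by
      obtain ⟨F, hF, rfl⟩ := List.mem_map.1 h
      obtain ⟨x, A, hx, rfl⟩ := ih hF
      exact ⟨x + 1, A, by simpa using hx, by rw [encOf_shift, Exp.shift_shift]; rfl⟩
    cases E with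
    | kd K => exact key h
    | ty A =>
      rcases List.mem_cons.1 h with rfl | h
      · exact ⟨0, A, rfl, rfl⟩
      · exact key h

theorem encCtx_eqv_refl {S : Sig} {P : List Tm} (h : ∀ D ∈ P, HasType S D .o) :
    List.Forall₂ (fun D D' => Eqv S D D' .o) P P :=
  List.forall₂_same.2 fun D hD => .refl (h D hD)

theorem Derives.ty_fam {Γ : Ctx} {x : ℕ} {A : Exp .fam} (h : Derives Γ .ctx)
    (hΓ : SimpleCtx Γ) (hx : Γ[x]? = some (.ty A)) :
    Derives Γ (.fam (A.shift (x + 1)) .typ) := by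
  induction Γ generalizing x with
  | nil => simp at hx
  | cons D Γ ih =>
    have h' := h
    cases x with
    | zero =>
      obtain rfl : D = .ty A := by simpa using hx
      cases h with
      | typeCtx hA _ => exact hA.shift_fam h' hΓ hΓ.1 .typ
    | succ x =>
      have hx : Γ[x]? = some (.ty A) := by simpa using hx
      have hc : Derives Γ .ctx := by cases h <;> assumption
      rw [← Exp.shift_shift A (x + 1) 1]
      exact (ih hc hΓ.tail hx).shift_fam h' hΓ (hΓ.tail.ty hx).1 .typ

theorem Simple.encType_pi_app {S : Sig} {A B : Exp .fam} {M : Tm} (hA : Simple S A .wf)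
    (hB : Simple (phi A :: S) B .wf) (hM : HasType S M (.arr (phi A) (phi B))) :
    Eqv S (.app (encType (.piF A B)) M)
      (Tm.forAll (phi A) (piBody (encType A) (encType B) M)) .o :=
  piPred_app_eqv hA.hasType_encType hB.hasType_encType hM

theorem Simple.encType_base_app {S : Sig} {P : Exp .fam} {M : Tm}
    (hP : Simple S P (.neu .lfType)) (hM : HasType S M .lfObj) :
    Eqv S (.app (encType P) M) (.app (.app .hastype M) (encTerm P)) .o := by
  rw [hP.encType_base.1]
  exact basePred_app_eqv hP.hasType_neu hM

/-- The formula left of `⟦Πx:A.B⟧ R` once the quantifier is instantiated by `⟨N⟩` and the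
implication is discharged is that of the normal form of `B[N/x]`. -/
theorem Simple.encType_inst_app {S : Sig} {A B : Exp .fam} {N : Exp .obj} {R : Tm}
    (hB : Simple (phi A :: S) B .wf) (hN : Simple S N (.chk (phi A)))
    (hR : HasType S R (.arr (phi A) (phi B))) {B' : Exp .fam} (h : Exp.NF (B.inst N) B') :
    Eqv S (.app ((encType B).inst (encTerm N)) (.app R (encTerm N)))
      (.app (encType B') (.app R (encTerm N))) .o := by
  obtain ⟨B₁, -, hu, -, -, -, e⟩ := hB.exists_inst (target_phi_fam A) hN
  obtain rfl := hu _ h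
  exact e.app (.refl (.app hR hN.hasType_chk))

/-! ### From derivations in LF to derivations in the logic -/

theorem Simple.eq_piF_or_base {S : Sig} {A : Exp .fam} (h : Simple S A .wf) :
    (∃ B C, A = .piF B C ∧ Simple S B .wf ∧ Simple (phi B :: S) C .wf) ∨
      Simple S A (.neu .lfType) := by
  cases h with
  | piF hB hC => exact .inl ⟨_, _, rfl, hB, hC⟩
  | base h => exact .inr h

theorem prov_goal_of_neu {Γ : Ctx} {M : Exp .obj} {A : Exp .fam} (hΓ : SimpleCtx Γ)
    (dM : Derives Γ (.obj M A)) (sM : Simple (sigOf Γ) M (.neu .lfObj))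
    (h : ∀ F : Tm, F.IsAtomic → HasType (sigOf Γ) F .o →
      Prov (sigOf Γ) (encCtx Γ) (.focus F (encOf M A)) →
      Prov (sigOf Γ) (encCtx Γ) (.goal F)) :
    Prov (sigOf Γ) (encCtx Γ) (.goal (encOf M A)) := by
  obtain ⟨sA, pA⟩ := dM.type_of_neu hΓ sM
  rcases sA.eq_piF_or_base with ⟨B, C, rfl, -, -⟩ | sA
  · cases pA
  · have e := sA.encType_base_app sM.hasType_neu
    have hr := encCtx_eqv_refl (encCtx_hasType hΓ)
    have ha : (Tm.app (.app .hastype (encTerm M)) (encTerm A)).IsAtomic := trivial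
    exact .convGoal hr e.symm (h _ ha e.hasType.2
      (.convFocus hr (.refl e.hasType.2) e.symm (.init ha)))

/-- A canonical object of type `A` proves `⟦M : A⟧`; for a neutral `M`, focusing on the
assumption for its head variable amounts to focusing on `⟦M : A⟧`. -/
theorem Derives.prov {Γ : Ctx} {J : Assertion} (h : Derives Γ J) (hΓ : SimpleCtx Γ) :
    match (generalizing := false) J with
    | .obj M A =>
      (∀ a, Simple (sigOf Γ) M (.neu a) → ∀ F : Tm, F.IsAtomic → HasType (sigOf Γ) F .o →
        Prov (sigOf Γ) (encCtx Γ) (.focus F (encOf M A)) →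
        Prov (sigOf Γ) (encCtx Γ) (.goal F)) ∧
      (∀ a, Simple (sigOf Γ) M (.chk a) → Prov (sigOf Γ) (encCtx Γ) (.goal (encOf M A)))
    | _ => True := by
  induction h with
  | @varObj Γ x A A' hc hx hA _ =>
    obtain rfl := (hΓ.ty hx).1.normal.eq_of_nf hA
    have key : ∀ F : Tm, F.IsAtomic → HasType (sigOf Γ) F .o →
        Prov (sigOf Γ) (encCtx Γ) (.focus F (encOf (.var x) (A.shift (x + 1)))) →
        Prov (sigOf Γ) (encCtx Γ) (.goal F) := fun F hF _ h =>
      .decide hF (encOf_mem_encCtx hx) h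
    refine ⟨fun _ _ => key, fun a h => ?_⟩
    cases h with
    | atom h => exact prov_goal_of_neu hΓ (.varObj hc hx hA) h key
  | @absObj Γ A A' B M hA hM hA' _ ihM =>
    refine ⟨fun a h => (by cases h), fun a h => ?_⟩
    obtain ⟨sA, b, sM⟩ := h.lam_inv
    obtain rfl := sA.normal.eq_of_nf hA'
    obtain ⟨sB, rfl⟩ := hM.type_of_chk (Γ := .ty A' :: Γ) ⟨sA, hΓ⟩ sM
    have hlam : HasType (sigOf Γ) (encTerm (.lam A' M)) (.arr (phi A') (phi B)) :=
      .lam sM.hasType_chk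
    refine .convGoal (encCtx_eqv_refl (encCtx_hasType hΓ))
      (sA.encType_pi_app sB hlam).symm (.allR (.impR ?_))
    have hctx : .app ((encType A').shift 1) (.var 0) :: (encCtx Γ).map (Tm.shift 1) =
        encCtx (.ty A' :: Γ) := by
      rw [encCtx, encOf, Exp.shift, encType_rename]; rfl
    rw [hctx]
    refine .convGoal (encCtx_eqv_refl (encCtx_hasType (Γ := .ty A' :: Γ) ⟨sA, hΓ⟩)) ?_
      ((ihM ⟨sA, hΓ⟩).2 _ sM)
    have e := Eqv.beta (S := phi A' :: sigOf Γ) (a := phi A')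
      (HasType.rename (S' := phi A' :: phi A' :: sigOf Γ) (r := liftRen (· + 1)) sM.hasType_chk
        fun i d hd => by cases i <;> simpa [liftRen, sigOf] using hd) .zero
    rw [Tm.rename_lift_inst_var] at e
    exact .app (.refl sB.hasType_encType) e.symm
  | @appObj Γ A B B' M N hM hN hB ihM ihN =>
    have key : ∀ m, Simple (sigOf Γ) (.app M N) m → ∀ F : Tm, F.IsAtomic →
        HasType (sigOf Γ) F .o →
        Prov (sigOf Γ) (encCtx Γ) (.focus F (encOf (.app M N) B')) →
        Prov (sigOf Γ) (encCtx Γ) (.goal F) := fun m hm F hF tF h => by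
      obtain ⟨a, b, sM, sN⟩ := hm.app_inv
      obtain ⟨sAB, p⟩ := hM.type_of_neu hΓ sM
      obtain ⟨sA, sB⟩ := sAB.piF_inv
      simp only [phi, Ty.arr.injEq] at p
      obtain ⟨rfl, rfl⟩ := p
      have hr := encCtx_eqv_refl (encCtx_hasType hΓ)
      refine (ihM hΓ).1 _ sM F hF tF (.convFocus hr (.refl tF)
        (sA.encType_pi_app sB sM.hasType_neu).symm (.allL sN.hasType_chk ?_))
      rw [piBody_inst]
      exact .impL ((ihN hΓ).2 _ sN) (.convFocus hr (.refl tF)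
        (sB.encType_inst_app sN sM.hasType_neu hB).symm h)
    refine ⟨fun a h => key _ h, fun a h => ?_⟩
    cases h with
    | atom h => exact prov_goal_of_neu hΓ (.appObj hM hN hB) h (key _ h)
  | _ => trivial

end LF

/-! ### From derivations in the logic to derivations in LF -/

namespace LF

open Relation HH Translation

/-- The term `M` encodes a canonical object of type `A` in `Γ`. -/
def Inhabits (Γ : Ctx) (A : Exp .fam) (M : Tm) : Prop :=
  ∃ M' : Exp .obj, Simple (sigOf Γ) M' (.chk (phi A)) ∧
    Eqv (sigOf Γ) M (encTerm M') (phi A) ∧ Derives Γ (.obj M' A)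

/-- `A` is a canonical type over the canonical context `Γ`. -/
structure CanType (Γ : Ctx) (A : Exp .fam) : Prop where
  ctx : Derives Γ .ctx
  simpleCtx : SimpleCtx Γ
  fam : Derives Γ (.fam A .typ)
  simple : Simple (sigOf Γ) A .wf

theorem CanType.pi {Γ : Ctx} {A B : Exp .fam} (h : CanType Γ (.piF A B)) :
    CanType Γ A ∧ CanType (.ty A :: Γ) B := by
  obtain ⟨sA, sB⟩ := h.simple.piF_inv
  have h' := h.fam
  cases h' with
  | piFam dA dB =>
    exact ⟨⟨h.ctx, h.simpleCtx, dA, sA⟩, ⟨.typeCtx dA h.ctx, ⟨sA, h.simpleCtx⟩, dB, sB⟩⟩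

theorem isAtomic_hastype (M P : Tm) : (Tm.app (.app .hastype M) P).IsAtomic := trivial

theorem CanType.not_eqv_implies {Γ : Ctx} {A : Exp .fam} {M D G : Tm} (h : CanType Γ A)
    (hM : HasType (sigOf Γ) M (phi A)) :
    ¬ Eqv (sigOf Γ) (Tm.implies D G) (.app (encType A) M) .o := fun e => by
  rcases h.simple.eq_piF_or_base with ⟨B, C, rfl, sB, sC⟩ | sA
  · exact not_eqv_implies_forAll (e.trans (sB.encType_pi_app sC hM))
  · rw [sA.encType_base.2] at hM
    exact not_eqv_implies_of_isAtomic (isAtomic_hastype _ _) ((e.trans (sA.encType_base_app hM)).symm)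

theorem CanType.not_eqv_top {Γ : Ctx} {A : Exp .fam} {M : Tm} (h : CanType Γ A)
    (hM : HasType (sigOf Γ) M (phi A)) :
    ¬ Eqv (sigOf Γ) .top (.app (encType A) M) .o := fun e => by
  rcases h.simple.eq_piF_or_base with ⟨B, C, rfl, sB, sC⟩ | sA
  · exact not_eqv_top_forAll (e.trans (sB.encType_pi_app sC hM))
  · rw [sA.encType_base.2] at hM
    exact not_eqv_top_of_isAtomic (isAtomic_hastype _ _) ((e.trans (sA.encType_base_app hM)).symm)

/-- A quantified formula is equal to `⟦A⟧ M` only if `A` is a `Π`-type. -/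
theorem CanType.of_eqv_forAll {Γ : Ctx} {A : Exp .fam} {M F : Tm} {a : Ty} (h : CanType Γ A)
    (hM : HasType (sigOf Γ) M (phi A))
    (e : Eqv (sigOf Γ) (Tm.forAll a F) (.app (encType A) M) .o) :
    ∃ B C, A = .piF B C ∧ a = phi B ∧
      Eqv (phi B :: sigOf Γ) F (piBody (encType B) (encType C) M) .o := by
  rcases h.simple.eq_piF_or_base with ⟨B, C, rfl, sB, sC⟩ | sA
  · obtain ⟨rfl, e⟩ := (e.trans (sB.encType_pi_app sC hM)).forAll_inj
    exact ⟨B, C, rfl, rfl, e⟩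
  · rw [sA.encType_base.2] at hM
    exact (not_eqv_forAll_of_isAtomic (isAtomic_hastype _ _) ((e.trans (sA.encType_base_app hM)).symm)).elim

/-- An atomic formula is equal to `⟦A⟧ M` only if `A` is a base type. -/
theorem CanType.of_eqv_isAtomic {Γ : Ctx} {A : Exp .fam} {M F : Tm} (h : CanType Γ A)
    (hM : HasType (sigOf Γ) M (phi A)) (hF : F.IsAtomic)
    (e : Eqv (sigOf Γ) F (.app (encType A) M) .o) :
    Simple (sigOf Γ) A (.neu .lfType) ∧ phi A = .lfObj ∧
      Eqv (sigOf Γ) F (.app (.app .hastype M) (encTerm A)) .o := by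
  rcases h.simple.eq_piF_or_base with ⟨B, C, rfl, sB, sC⟩ | sA
  · exact (not_eqv_forAll_of_isAtomic hF (e.trans (sB.encType_pi_app sC hM))).elim
  · rw [sA.encType_base.2] at hM
    exact ⟨sA, sA.encType_base.2, e.trans (sA.encType_base_app hM)⟩

/-- Pointwise βη-equality of two lists of formulas. -/
abbrev EqvList (S : Sig) (P P' : List Tm) : Prop :=
  List.Forall₂ (fun D D' => Eqv S D D' .o) P P'

theorem EqvList.trans {S : Sig} {P P' P'' : List Tm} (h : EqvList S P P')
    (h' : EqvList S P' P'') : EqvList S P P'' := by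
  induction h generalizing P'' with
  | nil => exact h'
  | cons e _ ih =>
    cases h' with
    | cons e' h' => exact .cons (e.trans e') (ih h')

theorem EqvList.exists_of_mem {S : Sig} {P P' : List Tm} (h : EqvList S P P') {D : Tm}
    (hD : D ∈ P) : ∃ D' ∈ P', Eqv S D D' .o := by
  induction h with
  | nil => simp at hD
  | cons e _ ih =>
    rcases List.mem_cons.1 hD with rfl | hD
    · exact ⟨_, List.mem_cons_self, e⟩
    · obtain ⟨D', h, e⟩ := ih hD
      exact ⟨D', List.mem_cons_of_mem _ h, e⟩

theorem EqvList.shift_one {S : Sig} {P P' : List Tm} (a : Ty) (h : EqvList S P P') :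
    EqvList (a :: S) (P.map (Tm.shift 1)) (P'.map (Tm.shift 1)) := by
  induction h with
  | nil => exact .nil
  | cons e _ ih => exact .cons (e.shift_one a) ih

/-- What a derivation over `⟦Γ⟧` says about LF. A derivation of `⟦A⟧ M`, or of what is left of
`⟦Πx:A.B⟧ M` once the quantifier has been introduced, yields a canonical object encoded by `M`.
A derivation of `⟦M : B⟧`, for a base type `B`, that focuses on `⟦R : A⟧`, for a neutral `R`,
or on an instance of the body of `⟦R : Πx:A.C⟧`, yields a canonical object of type `B`. -/
def Reads (S : Sig) (P : List Tm) : Rhs → Prop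
  | .goal G =>
    (∀ Γ A M, S = sigOf Γ → EqvList S P (encCtx Γ) → CanType Γ A → HasType S M (phi A) →
      Eqv S G (.app (encType A) M) .o → Inhabits Γ A M) ∧
    (∀ Γ A B M, S = sigOf (.ty A :: Γ) → EqvList S P ((encCtx Γ).map (Tm.shift 1)) →
      CanType (.ty A :: Γ) B → HasType S M (phi B) →
      Eqv S G (Tm.implies (.app ((encType A).shift 1) (.var 0)) (.app (encType B) M)) .o →
      Inhabits (.ty A :: Γ) B M)
  | .focus F D =>
    (∀ Γ A R B M, S = sigOf Γ → EqvList S P (encCtx Γ) → CanType Γ A →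
      Simple S R (.neu (phi A)) → Derives Γ (.obj R A) → Derives Γ (.fam B .typ) →
      Simple S B (.neu .lfType) → Eqv S F (.app (.app .hastype M) (encTerm B)) .o →
      Eqv S D (encOf R A) .o → Inhabits Γ B M) ∧
    (∀ Γ A C R t B M, S = sigOf Γ → EqvList S P (encCtx Γ) → CanType Γ (.piF A C) →
      Simple S R (.neu (phi (.piF A C))) → Derives Γ (.obj R (.piF A C)) →
      Derives Γ (.fam B .typ) → Simple S B (.neu .lfType) → HasType S t (phi A) →
      Eqv S F (.app (.app .hastype M) (encTerm B)) .o →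
      Eqv S D (Tm.implies (.app (encType A) t)
        (.app ((encType C).inst t) (.app (encTerm R) t))) .o → Inhabits Γ B M)

theorem Inhabits.lam {Γ : Ctx} {A B : Exp .fam} {M : Tm} (h : CanType Γ (.piF A B))
    (hM : HasType (sigOf Γ) M (.arr (phi A) (phi B)))
    (hi : Inhabits (.ty A :: Γ) B (.app (M.shift 1) (.var 0))) :
    Inhabits Γ (.piF A B) M := by
  obtain ⟨N, sN, eN, dN⟩ := hi
  obtain ⟨hA, -⟩ := h.pi
  exact ⟨.lam A N, .lam hA.simple sN, (Eqv.eta hM).symm.trans (.lam eN),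
    .absObj hA.fam dN hA.simple.normal.nf_self⟩

/-- By induction on the derivation. Since βη-equality preserves the shape of a formula, each rule
applies to at most one of the formulas described by `Reads`. Initial sequents use that base
types with equal encodings are equal; a left implication supplies an argument `N` of a neutral
`R`, and `R N` has the type `B[N/x]`, in normal form. -/
theorem Reads.of_prov {S : Sig} {P : List Tm} {R : Rhs} (h : Prov S P R) : Reads S P R := by
  induction h with
  | topR =>
    refine ⟨fun Γ A M hS _ hA hM e => ?_, fun Γ A B M hS _ hB hM e => ?_⟩
    · subst hS; exact (hA.not_eqv_top hM e).elim
    · exact (not_eqv_top_implies e).elim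
  | impR h ih =>
    refine ⟨fun Γ A M hS _ hA hM e => ?_, fun Γ A B M hS hP hB hM e => ?_⟩
    · subst hS; exact (hA.not_eqv_implies hM e).elim
    · obtain ⟨e₁, e₂⟩ := e.implies_inj
      refine ih.1 (.ty A :: Γ) B M hS (.cons ?_ hP) hB hM e₂
      rw [encOf, Exp.shift, encType_rename]; exact e₁
  | allR h ih =>
    refine ⟨fun Γ A M hS hP hA hM e => ?_, fun Γ A B M hS hP hB hM e => ?_⟩
    · subst hS
      obtain ⟨B, C, rfl, rfl, eF⟩ := hA.of_eqv_forAll hM e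
      exact .lam hA hM (ih.2 Γ B C _ rfl (hP.shift_one _) hA.pi.2
        (.app (hM.shift_one _) .zero) eF)
    · exact (not_eqv_implies_forAll e.symm).elim
  | decide hF hD h ih =>
    refine ⟨fun Γ A M hS hP hA hM e => ?_, fun Γ A B M hS hP hB hM e => ?_⟩
    · subst hS
      obtain ⟨sA, pA, e⟩ := hA.of_eqv_isAtomic hM hF e
      obtain ⟨D', hD', eD⟩ := EqvList.exists_of_mem hP hD
      obtain ⟨x, B, hx, rfl⟩ := exists_of_mem_encCtx hD'
      have hB := (hA.simpleCtx.ty hx).1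
      refine ih.1 Γ (B.shift (x + 1)) (.var x) A M rfl hP
        ⟨hA.ctx, hA.simpleCtx, hA.ctx.ty_fam hA.simpleCtx hx, hB⟩ ?_
        (hA.ctx.varObj_simple hA.simpleCtx hx) hA.fam sA e eD
      rw [phi_shift]; exact .var (sigOf_of_ty hx) (target_phi_fam B)
    · exact (not_eqv_implies_of_isAtomic hF e).elim
  | init hF =>
    refine ⟨fun Γ A R B M hS hP hA hR dR dB sB e e' => ?_,
      fun Γ A C R t B M hS hP hA hR dR dB sB ht e e' => ?_⟩
    · subst hS
      obtain ⟨sA, pA, e'⟩ := hA.of_eqv_isAtomic hR.hasType_neu hF e'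
      obtain ⟨e₁, e₂⟩ := (e.symm.trans e').hastype_inj
      obtain rfl := dB.base_type_eq hA.simpleCtx hA.fam sB sA e₂
      rw [pA] at hR
      exact ⟨R, by rw [pA]; exact .atom hR, by rw [pA]; exact e₁, dR⟩
    · exact (not_eqv_implies_of_isAtomic hF e').elim
  | allL ht h ih =>
    refine ⟨fun Γ A R B M hS hP hA hR dR dB sB e e' => ?_,
      fun Γ A C R t B M hS hP hA hR dR dB sB ht e e' => ?_⟩
    · subst hS
      obtain ⟨A₁, C, rfl, rfl, eF⟩ := hA.of_eqv_forAll hR.hasType_neu e'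
      refine ih.2 Γ A₁ C R _ B M rfl hP hA hR dR dB sB ht e ?_
      have := eF.inst (.refl ht)
      rwa [piBody_inst] at this
    · exact (not_eqv_implies_forAll e'.symm).elim
  | impL hG h ihG ih =>
    refine ⟨fun Γ A R B M hS hP hA hR dR dB sB e e' => ?_,
      fun Γ A C R t B M hS hP hA hR dR dB sB ht e e' => ?_⟩
    · subst hS; exact (hA.not_eqv_implies hR.hasType_neu e').elim
    · subst hS
      obtain ⟨e₁, e₂⟩ := e'.implies_inj
      obtain ⟨N, sN, eN, dN⟩ := ihG.1 Γ A t rfl hP hA.pi.1 ht e₁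
      have sC := hA.pi.2.simple
      obtain ⟨C', hC', -, cC', sC', pC', eC'⟩ := sC.exists_inst (target_phi_fam A) sN
      refine ih.1 Γ C' (.app R N) B M rfl hP ⟨hA.ctx, hA.simpleCtx, ?_, sC'⟩ ?_
        (.appObj dR dN hC') dB sB e ?_
      · exact hA.pi.2.fam.inst_fam hA.ctx hA.simpleCtx hA.pi.1.simple sC dN sN hC'.2 cC'
      · rw [pC']; exact .app hR sN
      · have hq : Eqv (sigOf Γ) ((encType C).inst t) ((encType C).inst (encTerm N))
            (.arr (phi C) .o) := (Eqv.refl sC.hasType_encType).inst eN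
        exact e₂.trans ((hq.app (.app (.refl hR.hasType_neu) eN)).trans
          (sC.encType_inst_app sN hR.hasType_neu hC'))
  | convGoal hP e h ih =>
    exact ⟨fun Γ A M hS hP' hA hM e' => ih.1 Γ A M hS (EqvList.trans hP hP') hA hM (e.trans e'),
      fun Γ A B M hS hP' hB hM e' =>
        ih.2 Γ A B M hS (EqvList.trans hP hP') hB hM (e.trans e')⟩
  | convFocus hP eF eD h ih =>
    exact ⟨fun Γ A R B M hS hP' hA hR dR dB sB e e' =>
        ih.1 Γ A R B M hS (EqvList.trans hP hP') hA hR dR dB sB (eF.trans e) (eD.trans e'),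
      fun Γ A C R t B M hS hP' hA hR dR dB sB ht e e' =>
        ih.2 Γ A C R t B M hS (EqvList.trans hP hP') hA hR dR dB sB ht (eF.trans e)
          (eD.trans e')⟩

end LF

theorem mainTheorem1 (Γ : LF.Ctx) (A : LF.Exp .fam)
    (hΓ : LF.Derives Γ .ctx) (hΓc : LF.CanonicalCtx Γ)
    (hA : LF.Derives Γ (.fam A .typ)) (hAc : LF.Canonical Γ A) :
    (∀ M : LF.Exp .obj, LF.Canonical Γ M → LF.Derives Γ (.obj M A) →
      HH.Prov (Translation.sigOf Γ) (Translation.encCtx Γ)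
        (.goal (Translation.encOf M A))) ∧
    (∀ M : HH.Tm, HH.HasType (Translation.sigOf Γ) M (Translation.phi A) →
      HH.Prov (Translation.sigOf Γ) (Translation.encCtx Γ)
        (.goal (.app (Translation.encType A) M)) →
      ∃ M' : LF.Exp .obj, LF.Canonical Γ M' ∧
        HH.Eqv (Translation.sigOf Γ) M (Translation.encTerm M') (Translation.phi A) ∧
        LF.Derives Γ (.obj M' A)) := by
  have sΓ := LF.SimpleCtx.of_canonicalCtx hΓ hΓc
  have sA := hA.simple_fam sΓ hAc
  refine ⟨fun M hM dM => (dM.prov sΓ).2 _ (dM.simple_obj sΓ hM).2, fun M tM h => ?_⟩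
  obtain ⟨M', sM, e, d⟩ := (LF.Reads.of_prov h).1 Γ A M rfl
    (LF.encCtx_eqv_refl (LF.encCtx_hasType sΓ)) ⟨hΓ, sΓ, hA, sA⟩ tM
    (.refl (.app sA.hasType_encType tM))
  exact ⟨M', sM.canonical sΓ, e, d⟩
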